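/- Let $(V,Y,\mathbf 1,\omega)$ be a vertex operator algebra over $\mathbb C$ ($V=\coprod_{n\in\mathbb Z}V_{(n)}$ graded by $L(0)$-eigenvalues, $\dim V_{(n)}<\infty$, $V_{(n)}=0$ for $n\ll0$), and let $g$ be an automorphism of $V$. For $a\in\mathbb C$ let $V^{[a+\mathbb Z]}$ be the generalized eigenspace of $g$ with eigenvalue $e^{2\pi i a}$, and let $P(V)$ be the set of $a\in\mathbb C$ with $0\le\Re a<1$ and $V^{[a+\mathbb Z]}\ne0$. Write $g=\sigma g_u$ for the multiplicative Jordan–Chevalley decomposition ($\sigma$ semisimple, $g_u$ locally unipotent, $\sigma g_u=g_u\sigma$), let $\mathcal N=\frac1{2\pi i}\log g_u$, a locally nilpotent operator, and let $(1+x)^{\mathcal N}u=\sum_{j\ge0}x^j\binom{\mathcal N}{j}u$. Let $\arg z\in[0,2\pi)$, $\log z=\log|z|+i\arg z$ and $l_p(z)=\log z+2\pi i p$ for $p\in\mathbb Z$. Let $\overline{\mathbb C}_+$ be the closed right half plane. Let $W=\coprod_{n\in\overline{\mathbb C}_+,\,\alpha\in\mathbb C/\mathbb Z}W_n^{[\alpha]}$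 be a graded vector space with a linear map $Y^g:V\otimes W\to W\{x\}[\log x]$ and a linear action of $g$ on $W$, satisfying all the axioms of a $\overline{\mathbb C}_+$-graded weak $g$-twisted $V$-module except the duality property. Write $Y^g(v,x)w=\sum_{k}\sum_{n\in\mathbb C}Y^g_{n,k}(v)w\,x^{-n-1}(\log x)^k$ ($k$ ranging over finitely many natural numbers), let $Y^{g;p}(v,z)w$ be the element of $\prod_{q}W_q$ obtained by $x^s=e^{s\,l_p(z)}$, $\log x=l_p(z)$, and let $W_q=\coprod_\alpha W_q^{[\alpha]}$, with $W_q=0$ for $q\notin\overline{\mathbb C}_+$. The axioms assumed are: * equivariance: $Y^{g;p+1}(gv,z)w=Y^{g;p}(v,z)w$ for $p\in\mathbb Z$, $z\in\mathbb C^\times$; * identity: $Y^g(\mathbf 1,x)w=w$; * grading: for $v\in V_{(m)}$ and $w\in W_p$, $Y^g_{n,k}(v)w\in W_{m-n-1+p}$; $\coprod_{\Re q=0}W_q$ is the space of all $w\in W$ such that $Y^g_{n,k}(v)w=0$ for all $m\in\mathbb Z$, $v\in V_{(m)}$, $k$, $n$ with $\Re(m-n-1)<0$; every $w\in W^{[\alpha]}=\coprod_nW_n^{[\alpha]}$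 is annihilated by some power $(g-e^{2\pi i\alpha})^\Lambda$, $\Lambda\ge 1$; and $gY^g(u,x)w=Y^g(gu,x)gw$; * $L(-1)$-derivative: $\frac{d}{dx}Y^g(v,x)=Y^g(L(-1)v,x)$. Let $Y^g_0(v,x)=\sum_nv(n)x^{-n-1}$ with $v(n)=Y^g_{n,0}(v)$ be the non-logarithmic component, and for $z\in\mathbb C^\times$ let $Y^g_0(v,z)$ be obtained by $x^s=e^{s\log z}$. Let $W'=\coprod_{n,\alpha}(W_n^{[\alpha]})^*$, and let $\pi_n$ denote the projections to the homogeneous subspaces of degree $n$. Then the following four properties are equivalent: (1) (Duality for $Y^g$.) For all $u,v\in V$, $w\in W$, $w'\in W'$ there are $N\in\mathbb N$, $t\in\mathbb Z_+$, $m_i,n_j,a_{ijkl}\in\mathbb C$ $(0\le i,j,k,l\le N)$ such that for every $p\in\mathbb Z$ the series $$\sum_n\langle w',Y^{g;p}(u,z_1)\pi_nY^{g;p}(v,z_2)w\rangle,\quad \sum_n\langle w',Y^{g;p}(v,z_2)\pi_nY^{g;p}(u,z_1)w\rangle,\quad \sum_n\langle w',Y^{g;p}(\pi_nY(u,z_1-z_2)v,z_2)w\rangle$$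 converge absolutely for $|z_1|>|z_2|>0$, for $|z_2|>|z_1|>0$ and for $|z_2|>|z_1-z_2|>0$, respectively, and, when $|\arg z_1-\arg z_2|<\frac\pi2$, have the sum $$\sum_{i,j,k,l=0}^Na_{ijkl}e^{m_il_p(z_1)}e^{n_jl_p(z_2)}l_p(z_1)^kl_p(z_2)^l(z_1-z_2)^{-t}.$$ (2) (Duality for $Y^g_0$.) For all $a,b\in P(V)$, $u\in V^{[a+\mathbb Z]}$, $v\in V^{[b+\mathbb Z]}$, $w\in W$, $w'\in W'$ there are a polynomial $h(z_1,z_2)$ and $r,s,t\in\mathbb Z$ such that the series $$\sum_n\langle w',Y^g_0(u,z_1)\pi_nY^g_0(v,z_2)w\rangle,\qquad \sum_n\langle w',Y^g_0(v,z_2)\pi_nY^g_0(u,z_1)w\rangle,$$ $$\sum_{n,j}\Big(\frac{z_1-z_2}{z_2}\Big)^j\Big\langle w',Y^g_0\Big(\pi_nY\Big(\binom{\mathcal N}{j}u,z_1-z_2\Big)v,z_2\Big)w\Big\rangle$$ (the last one being $\langle w',Y^g_0(Y((1+\frac{z_1-z_2}{z_2})^{\mathcal N}u,z_1-z_2)v,z_2)w\rangle$)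 converge absolutely for $|z_1|>|z_2|>0$, for $|z_2|>|z_1|>0$ and for $|z_2|>|z_1-z_2|>0$, respectively, to $$e^{-a\log z_1}e^{-b\log z_2}\frac{h(z_1,z_2)}{z_1^rz_2^s(z_1-z_2)^t},$$ where for the third series the value of the sum is asserted when $|\arg z_1-\arg z_2|<\frac\pi2$. (3) $Y^g_0$ is lower truncated (for all $v\in V$, $w\in W$: $v(n)w=0$ when $\Re n$ is sufficiently large), and for all $a,b\in P(V)$, $u\in V^{[a+\mathbb Z]}$, $v\in V^{[b+\mathbb Z]}$ the twisted Jacobi identity holds on $W$: $$x_0^{-1}\delta\Big(\frac{x_1-x_2}{x_0}\Big)Y^g_0(u,x_1)Y^g_0(v,x_2)-x_0^{-1}\delta\Big(\frac{-x_2+x_1}{x_0}\Big)Y^g_0(v,x_2)Y^g_0(u,x_1)$$ $$=x_1^{-1}\delta\Big(\frac{x_2+x_0}{x_1}\Big)\Big(\frac{x_2+x_0}{x_1}\Big)^aY^g_0\Big(Y\Big(\Big(1+\frac{x_0}{x_2}\Big)^{\mathcal N}u,x_0\Big)v,x_2\Big).$$ (4) $Y^g_0$ is lower truncated; for all $a,b\in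 P(V)$, $u\in V^{[a+\mathbb Z]}$, $v\in V^{[b+\mathbb Z]}$ the commutator formula holds on $W$: $$[Y^g_0(u,x_1),Y^g_0(v,x_2)]=\mathrm{Res}_{x_0}\,x_1^{-1}\delta\Big(\frac{x_2+x_0}{x_1}\Big)\Big(\frac{x_2+x_0}{x_1}\Big)^aY^g_0\Big(Y\Big(\Big(1+\frac{x_0}{x_2}\Big)^{\mathcal N}u,x_0\Big)v,x_2\Big);$$ and weak associativity holds: for all $a\in P(V)$, $u\in V^{[a+\mathbb Z]}$, $v\in V$, $w\in W$ and all $l\in a+\mathbb Z$ such that $u(n)w=0$ for all $n\in l+\mathbb N$, $$(x_0+x_2)^lY^g_0(u,x_0+x_2)Y^g_0(v,x_2)w=(x_2+x_0)^lY^g_0\Big(Y\Big(\Big(1+\frac{x_0}{x_2}\Big)^{\mathcal N}u,x_0\Big)v,x_2\Big)w.$$ As usual, powers of a sum of two variables are expanded in nonnegative integral powers of the second one. -/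

import Mathlib

namespace TwistedVOA

noncomputable section

/-! ### Internal direct sums -/

/-- The decomposition of a vector space that is the internal direct sum of the subspaces `A i`. -/
def decompose {ι M : Type*} [DecidableEq ι] [AddCommGroup M] [Module ℂ M]
    (A : ι → Submodule ℂ M) (h : DirectSum.IsInternal A) : M ≃ₗ[ℂ] DirectSum ι fun i => A i :=
  (LinearEquiv.ofBijective (DirectSum.coeLinearMap A) h).symm

open scoped Classical in
/-- The projection of such a space onto the sum of those `A i` whose index satisfies `P`. -/
def gradedProj {ι M : Type*} [DecidableEq ι] [AddCommGroup M] [Module ℂ M]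
    (A : ι → Submodule ℂ M) (h : DirectSum.IsInternal A) (P : ι → Prop) : M →ₗ[ℂ] M :=
  DirectSum.coeLinearMap A ∘ₗ DFinsupp.filterLinearMap ℂ (fun i => A i) P ∘ₗ
    (decompose A h).toLinearMap

/-! ### Vertex operator algebras and their automorphisms -/

open scoped Classical in
/-- A vertex operator algebra over `ℂ`. The `n`-th mode `u_n`, i.e. the coefficient of `x^(-n-1)`
in `Y(u, x)`, is `VertexOperator.ncoeff (Y u) n`. That `Y(u, x)v` is lower truncated is part of the
type `VertexOperator`. The Virasoro operators are `L(n) = ω_(n+1)`, and the homogeneous subspace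
`V_(n)` is the eigenspace of `L(0) = ω_1` with eigenvalue `n`. -/
structure VertexOperatorAlgebra (V : Type*) [AddCommGroup V] [Module ℂ V] where
  /-- the vertex operator map -/
  Y : V →ₗ[ℂ] VertexOperator ℂ V
  /-- the vacuum -/
  vac : V
  /-- the conformal element -/
  ω : V
  /-- the central charge -/
  c : ℂ
  /-- `Y(𝟏, x) = 1` -/
  vac_mode : ∀ (n : ℤ) (v : V), VertexOperator.ncoeff (Y vac) n v = if n = -1 then v else 0
  /-- `Y(v, x)𝟏` has no negative powers of `x` -/
  creation : ∀ (v : V) (n : ℤ), 0 ≤ n → VertexOperator.ncoeff (Y v) n vac = 0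
  /-- the constant term of `Y(v, x)𝟏` is `v` -/
  creation_neg_one : ∀ v : V, VertexOperator.ncoeff (Y v) (-1) vac = v
  /-- the Jacobi identity, in component form -/
  jacobi : ∀ (u v w : V) (l m n : ℤ),
    (∑ᶠ i : ℕ, ((-1 : ℂ) ^ i * (Ring.choose l i : ℤ)) •
        (VertexOperator.ncoeff (Y u) (m + l - i) (VertexOperator.ncoeff (Y v) (n + i) w)
          - (-1 : ℂ) ^ l •
            VertexOperator.ncoeff (Y v) (n + l - i) (VertexOperator.ncoeff (Y u) (m + i) w)))
      = ∑ᶠ i : ℕ, ((Ring.choose m i : ℤ) : ℂ) •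
          VertexOperator.ncoeff (Y (VertexOperator.ncoeff (Y u) (l + i) v)) (m + n - i) w
  /-- the Virasoro relations -/
  virasoro : ∀ (m n : ℤ) (v : V),
    VertexOperator.ncoeff (Y ω) (m + 1) (VertexOperator.ncoeff (Y ω) (n + 1) v)
        - VertexOperator.ncoeff (Y ω) (n + 1) (VertexOperator.ncoeff (Y ω) (m + 1) v)
      = ((m : ℂ) - n) • VertexOperator.ncoeff (Y ω) (m + n + 1) v
        + (if m + n = 0 then ((m : ℂ) ^ 3 - m) / 12 * c else 0) • v
  /-- the `L(-1)`-derivative property `Y(L(-1)v, x) = d/dx Y(v, x)` -/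
  L_neg_one_derivative : ∀ (v w : V) (n : ℤ),
    VertexOperator.ncoeff (Y (VertexOperator.ncoeff (Y ω) 0 v)) n w
      = (-(n : ℂ)) • VertexOperator.ncoeff (Y v) (n - 1) w
  /-- `V` is the direct sum of its homogeneous subspaces `V_(n)`, `n ∈ ℤ` -/
  grading_internal : DirectSum.IsInternal fun n : ℤ =>
    Module.End.eigenspace (VertexOperator.ncoeff (Y ω) 1) (n : ℂ)
  /-- `V_(n)` is finite dimensional -/
  finite_dimensional : ∀ n : ℤ,
    FiniteDimensional ℂ (Module.End.eigenspace (VertexOperator.ncoeff (Y ω) 1) (n : ℂ))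
  /-- `V_(n) = 0` for `n` sufficiently negative -/
  lower_bounded : ∃ n₀ : ℤ, ∀ n : ℤ, n < n₀ →
    Module.End.eigenspace (VertexOperator.ncoeff (Y ω) 1) (n : ℂ) = ⊥

namespace VertexOperatorAlgebra

variable {V : Type*} [AddCommGroup V] [Module ℂ V] (A : VertexOperatorAlgebra V)

/-- The mode `u_n`, the coefficient of `x^(-n-1)` in `Y(u, x)`. -/
def mode (u : V) (n : ℤ) : V →ₗ[ℂ] V := VertexOperator.ncoeff (A.Y u) n

/-- The Virasoro operator `L(n)`. -/
def L (n : ℤ) : V →ₗ[ℂ] V := A.mode A.ω (n + 1)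

/-- The homogeneous subspace `V_(n)`. -/
def wt (n : ℤ) : Submodule ℂ V :=
  Module.End.eigenspace (VertexOperator.ncoeff (A.Y A.ω) 1) (n : ℂ)

/-- The projection `π_n : V → V_(n)`. -/
def proj (n : ℤ) : V →ₗ[ℂ] V := gradedProj A.wt A.grading_internal (fun i => i = n)

/-- An automorphism of the vertex operator algebra. -/
structure Automorphism where
  /-- the underlying linear automorphism -/
  toLinearEquiv : V ≃ₗ[ℂ] V
  map_mode : ∀ (u v : V) (n : ℤ),
    toLinearEquiv (A.mode u n v) = A.mode (toLinearEquiv u) n (toLinearEquiv v)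
  map_vac : toLinearEquiv A.vac = A.vac
  map_ω : toLinearEquiv A.ω = A.ω

namespace Automorphism

variable {A} (g : A.Automorphism)

/-- The automorphism as an element of `End V`. -/
def toEnd : Module.End ℂ V := g.toLinearEquiv.toLinearMap

theorem commute_L_zero : Commute g.toEnd (VertexOperator.ncoeff (A.Y A.ω) 1) := by
  refine LinearMap.ext fun v => ?_
  have h := g.map_mode A.ω v 1
  rw [g.map_ω] at h
  exact h

theorem iSup_maxGenEigenspace : ⨆ μ : ℂ, g.toEnd.maxGenEigenspace μ = ⊤ := by
  rw [eq_top_iff, ← A.grading_internal.submodule_iSup_eq_top]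
  refine iSup_le fun n => ?_
  have hmaps : Set.MapsTo g.toEnd (A.wt n) (A.wt n) :=
    Module.End.mapsTo_genEigenspace_of_comm g.commute_L_zero.symm _ _
  have : FiniteDimensional ℂ (A.wt n) := A.finite_dimensional n
  let r : Module.End ℂ (A.wt n) := LinearMap.restrict g.toEnd hmaps
  have htop := Module.End.iSup_maxGenEigenspace_eq_top r
  intro v hv
  have hv' : (⟨v, hv⟩ : A.wt n) ∈ ⨆ μ : ℂ, r.maxGenEigenspace μ := by
    rw [htop]; trivial
  have key : (⨆ μ : ℂ, r.maxGenEigenspace μ).map (A.wt n).subtype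
      ≤ ⨆ μ : ℂ, g.toEnd.maxGenEigenspace μ := by
    rw [Submodule.map_iSup]
    refine iSup_mono fun μ => ?_
    rintro _ ⟨x, hx, rfl⟩
    obtain ⟨k, hk⟩ := (Module.End.mem_maxGenEigenspace _ _ _).1 hx
    refine (Module.End.mem_maxGenEigenspace _ _ _).2 ⟨k, ?_⟩
    have hcomm : ∀ (j : ℕ) (y : A.wt n), (((r - μ • 1) ^ j) y : V)
        = ((g.toEnd - μ • 1) ^ j) (y : V) := by
      intro j
      induction j with
      | zero => intro y; simp
      | succ j ih => intro y; rw [pow_succ, pow_succ, Module.End.mul_apply, ih]; rfl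
    have := hcomm k x
    rw [hk] at this
    exact this.symm
  exact key ⟨⟨v, hv⟩, hv', rfl⟩

open scoped Classical in
/-- `V` is the direct sum of the generalized eigenspaces of `g`. -/
theorem isInternal_maxGenEigenspace :
    DirectSum.IsInternal fun μ : ℂ => g.toEnd.maxGenEigenspace μ :=
  DirectSum.isInternal_submodule_of_iSupIndep_of_iSup_eq_top
    (Module.End.independent_maxGenEigenspace g.toEnd) g.iSup_maxGenEigenspace

open scoped Classical in
/-- The operator that acts on the generalized eigenspace of `g` with eigenvalue `μ` as the
scalar `φ μ`. -/
def scale (φ : ℂ → ℂ) : Module.End ℂ V :=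
  DirectSum.toModule ℂ ℂ V (fun μ => φ μ • (g.toEnd.maxGenEigenspace μ).subtype) ∘ₗ
    (decompose (fun μ : ℂ => g.toEnd.maxGenEigenspace μ)
      g.isInternal_maxGenEigenspace).toLinearMap

/-- The semisimple part `σ` of `g` in its multiplicative Jordan–Chevalley decomposition. -/
def semisimplePart : Module.End ℂ V := g.scale fun μ => μ

/-- The locally unipotent part `g_u = σ⁻¹ g` of `g` in its multiplicative Jordan–Chevalley
decomposition (all eigenvalues of `g` are nonzero). -/
def unipotentPart : Module.End ℂ V := g.scale (fun μ => μ⁻¹) * g.toEnd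

theorem scale_apply (φ : ℂ → ℂ) {μ : ℂ} {v : V} (hv : v ∈ g.toEnd.maxGenEigenspace μ) :
    g.scale φ v = φ μ • v := by
  classical
  have h : decompose (fun μ : ℂ => g.toEnd.maxGenEigenspace μ) g.isInternal_maxGenEigenspace v
      = DirectSum.lof ℂ ℂ (fun μ : ℂ => g.toEnd.maxGenEigenspace μ) μ ⟨v, hv⟩ := by
    rw [decompose, LinearEquiv.symm_apply_eq]
    exact (DirectSum.coeLinearMap_lof (fun μ : ℂ => g.toEnd.maxGenEigenspace μ) μ ⟨v, hv⟩).symm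
  have h2 : g.scale φ v = DirectSum.toModule ℂ ℂ V
      (fun μ => φ μ • (g.toEnd.maxGenEigenspace μ).subtype)
      (decompose (fun μ : ℂ => g.toEnd.maxGenEigenspace μ) g.isInternal_maxGenEigenspace v) := by
    unfold scale
    rw [LinearMap.comp_apply, LinearEquiv.coe_coe]
  rw [h2, h, DirectSum.toModule_lof]
  rfl

theorem maxGenEigenspace_zero : g.toEnd.maxGenEigenspace 0 = ⊥ := by
  rw [eq_bot_iff]
  intro v hv
  obtain ⟨k, hk⟩ := (Module.End.mem_maxGenEigenspace _ _ _).1 hv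
  rw [zero_smul, sub_zero] at hk
  have hinj : Function.Injective ⇑(g.toEnd ^ k) := by
    rw [Module.End.coe_pow]
    exact g.toLinearEquiv.injective.iterate k
  exact hinj (by rw [hk, map_zero])

theorem unipotentPart_locally_unipotent (v : V) :
    ∃ k : ℕ, ((g.unipotentPart - 1) ^ k) v = 0 := by
  have hv : v ∈ ⨆ μ : ℂ, g.toEnd.maxGenEigenspace μ := by
    rw [g.iSup_maxGenEigenspace]; trivial
  induction hv using Submodule.iSup_induction' with
  | mem μ x hx =>
    by_cases hμ : μ = 0
    · subst hμ
      rw [g.maxGenEigenspace_zero] at hx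
      exact ⟨0, by simpa using hx⟩
    obtain ⟨k, hk⟩ := (Module.End.mem_maxGenEigenspace _ _ _).1 hx
    have hstep : ∀ y ∈ g.toEnd.maxGenEigenspace μ,
        (g.unipotentPart - 1) y = μ⁻¹ • (g.toEnd - μ • 1) y := by
      intro y hy
      have hgy : g.toEnd y ∈ g.toEnd.maxGenEigenspace μ :=
        Module.End.mapsTo_maxGenEigenspace_of_comm (Commute.refl g.toEnd) μ hy
      simp only [unipotentPart, LinearMap.sub_apply, Module.End.mul_apply,
        g.scale_apply _ hgy, Module.End.one_apply, LinearMap.smul_apply, smul_sub, smul_smul,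
        inv_mul_cancel₀ hμ, one_smul]
    have hmap : ∀ y ∈ g.toEnd.maxGenEigenspace μ,
        (g.toEnd - μ • 1) y ∈ g.toEnd.maxGenEigenspace μ := by
      intro y hy
      exact Submodule.sub_mem _
        (Module.End.mapsTo_maxGenEigenspace_of_comm (Commute.refl g.toEnd) μ hy)
        (Submodule.smul_mem _ _ hy)
    have hpow : ∀ (j : ℕ), ∀ y ∈ g.toEnd.maxGenEigenspace μ,
        ((g.unipotentPart - 1) ^ j) y = (μ⁻¹) ^ j • ((g.toEnd - μ • 1) ^ j) y := by
      intro j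
      induction j with
      | zero => intro y _; simp
      | succ j ih =>
        intro y hy
        rw [pow_succ, pow_succ, Module.End.mul_apply, hstep y hy, map_smul, ih _ (hmap y hy),
          smul_smul, pow_succ (g.toEnd - μ • 1), Module.End.mul_apply, mul_comm]
    exact ⟨k, by rw [hpow k x hx, hk, smul_zero]⟩
  | zero => exact ⟨0, by simp⟩
  | add x y _ _ hx hy =>
    obtain ⟨k, hk⟩ := hx
    obtain ⟨l, hl⟩ := hy
    refine ⟨k + l, ?_⟩
    rw [map_add]
    have h1 : ((g.unipotentPart - 1) ^ (k + l)) x = 0 := by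
      rw [add_comm, pow_add, Module.End.mul_apply, hk, map_zero]
    have h2 : ((g.unipotentPart - 1) ^ (k + l)) y = 0 := by
      rw [pow_add, Module.End.mul_apply, hl, map_zero]
    rw [h1, h2, add_zero]

theorem log_support_finite (v : V) : (Function.support fun j : ℕ =>
    ((-1 : ℂ) ^ j / (j + 1)) • ((g.unipotentPart - 1) ^ (j + 1)) v).Finite := by
  obtain ⟨k, hk⟩ := g.unipotentPart_locally_unipotent v
  refine (Set.finite_lt_nat k).subset fun j hj => ?_
  by_contra hlt
  apply hj
  have hle : k ≤ j + 1 := by simp only [Set.mem_ofPred_eq, not_lt] at hlt; omega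
  obtain ⟨d, hd⟩ := Nat.exists_eq_add_of_le hle
  simp only [hd]
  rw [add_comm k d, pow_add, Module.End.mul_apply, hk, map_zero, smul_zero]

/-- `log g_u = ∑_{j ≥ 1} (-1)^(j+1) (g_u - 1)^j / j`, a finite sum on every vector. -/
def logUnipotentPart : Module.End ℂ V where
  toFun v := ∑ᶠ j : ℕ, ((-1 : ℂ) ^ j / (j + 1)) • ((g.unipotentPart - 1) ^ (j + 1)) v
  map_add' v w := by
    rw [← finsum_add_distrib (g.log_support_finite v) (g.log_support_finite w)]
    simp only [map_add, smul_add]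
  map_smul' a v := by
    rw [RingHom.id_apply, smul_finsum' a (g.log_support_finite v)]
    simp only [map_smul, smul_comm a]

/-- The locally nilpotent operator `𝒩 = log g_u / (2πi)`. -/
def 𝒩 : Module.End ℂ V := (2 * Real.pi * Complex.I)⁻¹ • g.logUnipotentPart

/-- The binomial coefficient `binom(𝒩, j) = 𝒩(𝒩 - 1)⋯(𝒩 - j + 1) / j!`, so that
`(1 + x)^𝒩 u = ∑_j x^j binom(𝒩, j) u`. -/
def binomN (j : ℕ) : Module.End ℂ V :=
  ((j.factorial : ℂ)⁻¹) • Polynomial.aeval g.𝒩 (descPochhammer ℂ j)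

/-- The generalized eigenspace `V^[a + ℤ]` of `g`, with eigenvalue `e^(2πia)`. -/
def genEigen (a : ℂ) : Submodule ℂ V :=
  g.toEnd.maxGenEigenspace (Complex.exp (2 * Real.pi * Complex.I * a))

/-- The set `P(V)` of `g`-weights of `V`. -/
def P : Set ℂ := {a | 0 ≤ a.re ∧ a.re < 1 ∧ g.genEigen a ≠ ⊥}

end Automorphism

end VertexOperatorAlgebra

open scoped Classical

/-! ### Formal series with arbitrary complex powers and logarithms -/

/-- `W{x}[log x]`: an element `f` stands for `∑_k ∑_{s ∈ ℂ} (f k s) x^s (log x)^k`, where `k` runs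
over a finite set of natural numbers. -/
abbrev LogSeries (W : Type*) [AddCommGroup W] : Type _ := ℕ →₀ (ℂ → W)

/-- The closed right half plane, as an index set. -/
abbrev RightHalfPlane : Type := {n : ℂ // 0 ≤ n.re}

/-- The group `ℂ / ℤ`. -/
abbrev CModZ : Type := ℂ ⧸ AddSubgroup.zmultiples (1 : ℂ)

/-- The argument with values in `[0, 2π)`. -/
def arg₀ (z : ℂ) : ℝ := if 0 ≤ z.arg then z.arg else z.arg + 2 * Real.pi

/-- The branch `l_p(z) = log |z| + i arg z + 2πip` of the logarithm, with `0 ≤ arg z < 2π`. -/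
def lp (p : ℤ) (z : ℂ) : ℂ :=
  (Real.log ‖z‖ : ℂ) + (arg₀ z : ℂ) * Complex.I + 2 * Real.pi * p * Complex.I

section Substitution

variable {W : Type*} [AddCommGroup W] [Module ℂ W]

/-- The substitution `x^s = e^(sℓ)`, `log x = ℓ` in an element of `W{x}[log x]`. The value at `s`
is the sum of the terms that come from the power `x^s`. -/
def LogSeries.subst (f : LogSeries W) (ℓ s : ℂ) : W :=
  f.sum fun k c => (Complex.exp (s * ℓ) * ℓ ^ k) • c s

end Substitution

/-- The component at `(n, α)` of a `ℂ̄₊ × ℂ/ℤ`-grading, as a family with one index. -/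
abbrev bigraded {W : Type*} [AddCommGroup W] [Module ℂ W]
    (comp : RightHalfPlane → CModZ → Submodule ℂ W) (i : RightHalfPlane × CModZ) :
    Submodule ℂ W := comp i.1 i.2

/-- The subspace `W_q = ∐_α W_q^[α]` for `q ∈ ℂ`; it is `0` if `q` is not in the closed right half
plane. -/
def degSpace {W : Type*} [AddCommGroup W] [Module ℂ W]
    (comp : RightHalfPlane → CModZ → Submodule ℂ W) (q : ℂ) : Submodule ℂ W :=
  ⨆ (n : RightHalfPlane) (_ : (n : ℂ) = q) (α : CModZ), comp n α

/-- The projection `π_q : W → W_q` for `q ∈ ℂ`. -/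
def degProj {W : Type*} [AddCommGroup W] [Module ℂ W]
    (comp : RightHalfPlane → CModZ → Submodule ℂ W)
    (h : DirectSum.IsInternal (bigraded comp)) (q : ℂ) : W →ₗ[ℂ] W :=
  gradedProj (bigraded comp) h (fun i => (i.1 : ℂ) = q)

/-- For a linear map `Y : V ⊗ W → W{x}[log x]`, the vector `Y(v, x)w` with `x^s = e^(sℓ)` and
`log x = ℓ`, as an element of the algebraic completion `∏_q W_q` of `W`: its component in `W_q` is
the value at `q`. -/
def evalAt {V W : Type*} [AddCommGroup V] [Module ℂ V] [AddCommGroup W] [Module ℂ W]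
    (comp : RightHalfPlane → CModZ → Submodule ℂ W)
    (h : DirectSum.IsInternal (bigraded comp))
    (Y : V →ₗ[ℂ] W →ₗ[ℂ] LogSeries W) (v : V) (ℓ : ℂ) (w : W) (q : ℂ) : W :=
  ∑ᶠ s : ℂ, degProj comp h q ((Y v w).subst ℓ s)

/-! ### Twisted modules without the duality property -/

open VertexOperatorAlgebra

/-- All the data and all the axioms of a `ℂ̄₊`-graded weak `g`-twisted `V`-module, except for the
duality property. -/
structure PreTwistedModule {V : Type*} [AddCommGroup V] [Module ℂ V]
    (A : VertexOperatorAlgebra V) (g : A.Automorphism)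
    (W : Type*) [AddCommGroup W] [Module ℂ W] where
  /-- the twisted vertex operator map `Y^g : V ⊗ W → W{x}[log x]` -/
  Yg : V →ₗ[ℂ] W →ₗ[ℂ] LogSeries W
  /-- the subspaces `W_n^[α]` -/
  comp : RightHalfPlane → CModZ → Submodule ℂ W
  /-- the action of `g` on `W` -/
  gW : W ≃ₗ[ℂ] W
  /-- `W` is the direct sum of the `W_n^[α]` -/
  internal : DirectSum.IsInternal (bigraded comp)
  /-- the equivariance property `Y^{g; p+1}(gv, z)w = Y^{g; p}(v, z)w` -/
  equivariance : ∀ (p : ℤ) (z : ℂ), z ≠ 0 → ∀ (v : V) (w : W),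
    evalAt comp internal Yg (g.toEnd v) (lp (p + 1) z) w = evalAt comp internal Yg v (lp p z) w
  /-- the identity property `Y^g(𝟏, x)w = w` -/
  identity : ∀ w : W, Yg A.vac w = Finsupp.single 0 (Pi.single 0 w)
  /-- For `v ∈ V_(m)` and `w ∈ W_p`, the coefficient `Y^g_{n,k}(v)w` of `x^(-n-1) (log x)^k` lies
  in `W_{m-n-1+p}`; in particular it is `0` when `m-n-1+p` is not in the closed right half plane. -/
  grading : ∀ (m : ℤ) (p : ℂ), ∀ v ∈ A.wt m, ∀ w ∈ degSpace comp p, ∀ (n : ℂ) (k : ℕ),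
    Yg v w k (-n - 1) ∈ degSpace comp (m - n - 1 + p)
  /-- The sum of the `W_n` with `n` imaginary is the space of all `w` that are annihilated by the
  `Y^g_{n,k}(v)` with `v ∈ V_(m)` and `m-n-1` not in the closed right half plane. -/
  lowest : ∀ w : W, w ∈ (⨆ (q : ℂ) (_ : q.re = 0), degSpace comp q) ↔
    ∀ (m : ℤ), ∀ v ∈ A.wt m, ∀ (n : ℂ) (k : ℕ), ((m : ℂ) - n - 1).re < 0 →
      Yg v w k (-n - 1) = 0
  /-- `W^[α]` consists of generalized eigenvectors of `g` with eigenvalue `e^(2πiα)` -/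
  g_grading : ∀ (n : RightHalfPlane) (a : ℂ), ∀ w ∈ comp n (QuotientAddGroup.mk a),
    ∃ Λ : ℕ, 0 < Λ ∧
      (((gW.toLinearMap : Module.End ℂ W) - Complex.exp (2 * Real.pi * Complex.I * a) • 1) ^ Λ) w
        = 0
  /-- `g Y^g(u, x)w = Y^g(gu, x)gw` -/
  g_compat : ∀ (u : V) (w : W) (k : ℕ) (s : ℂ),
    gW (Yg u w k s) = Yg (g.toEnd u) (gW w) k s
  /-- the `L(-1)`-derivative property: the coefficients of `x^s (log x)^k` in `Y^g(L(-1)v, x)w` and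
  in `d/dx Y^g(v, x)w` agree -/
  L_neg_one_derivative : ∀ (v : V) (w : W) (k : ℕ) (s : ℂ),
    Yg (A.L (-1) v) w k s
      = (s + 1) • Yg v w k (s + 1) + ((k : ℂ) + 1) • Yg v w (k + 1) (s + 1)

namespace PreTwistedModule

variable {V : Type*} [AddCommGroup V] [Module ℂ V] {A : VertexOperatorAlgebra V}
  {g : A.Automorphism} {W : Type*} [AddCommGroup W] [Module ℂ W] (M : PreTwistedModule A g W)

/-- The graded dual `W' = ∐_{n,α} (W_n^[α])^*`. -/
abbrev GradedDual : Type _ :=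
  DirectSum (RightHalfPlane × CModZ) fun i => Module.Dual ℂ (bigraded M.comp i)

/-- The pairing `⟨w', w⟩` of `W'` with `W`. -/
def pairing : M.GradedDual →ₗ[ℂ] Module.Dual ℂ W :=
  DirectSum.toModule ℂ (RightHalfPlane × CModZ) (Module.Dual ℂ W) fun i =>
    (DirectSum.component ℂ (RightHalfPlane × CModZ) (fun i => bigraded M.comp i) i ∘ₗ
      (decompose (bigraded M.comp) M.internal).toLinearMap).dualMap

/-- The pairing `⟨w', x⟩` of `w' ∈ W'` with an element `x` of the algebraic completion
`∏_q W_q`. -/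
def pairCompletion (w' : M.GradedDual) (x : ℂ → W) : ℂ := ∑ᶠ q : ℂ, M.pairing w' (x q)

/-- The non-logarithmic component `Y^g_0`, as a map `V ⊗ W → W{x} ⊆ W{x}[log x]`. -/
def Y₀ : V →ₗ[ℂ] W →ₗ[ℂ] LogSeries W :=
  M.Yg.compr₂ (Finsupp.lsingle (R := ℂ) 0 ∘ₗ Finsupp.lapply (R := ℂ) 0)

/-- For `Y = Y^g` or `Y = Y^g_0`, the `n`-th term `⟨w', Y(u, z₁) π_n Y(v, z₂)w⟩` of the series
`⟨w', Y(u, z₁)Y(v, z₂)w⟩`, where `ℓ₁`, `ℓ₂` are the values of `log z₁`, `log z₂`. -/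
def productTerm (Y : V →ₗ[ℂ] W →ₗ[ℂ] LogSeries W) (w' : M.GradedDual) (u : V) (ℓ₁ : ℂ) (v : V)
    (ℓ₂ : ℂ) (w : W) (n : ℂ) : ℂ :=
  M.pairCompletion w'
    (evalAt M.comp M.internal Y u ℓ₁ (evalAt M.comp M.internal Y v ℓ₂ w n))

/-- For `Y = Y^g` or `Y = Y^g_0`, the `n`-th term `⟨w', Y(π_n Y(u, z₀)v, z₂)w⟩` of the series
`⟨w', Y(Y(u, z₀)v, z₂)w⟩`, where `ℓ₂` is the value of `log z₂`. -/
def iterateTerm (Y : V →ₗ[ℂ] W →ₗ[ℂ] LogSeries W) (w' : M.GradedDual) (u : V) (z₀ : ℂ) (v : V)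
    (ℓ₂ : ℂ) (w : W) (n : ℤ) : ℂ :=
  M.pairCompletion w'
    (evalAt M.comp M.internal Y (∑ᶠ m : ℤ, z₀ ^ (-m - 1) • A.proj n (A.mode u m v)) ℓ₂ w)

/-- The duality property for `Y^g`. -/
def Duality : Prop :=
  ∀ (u v : V) (w : W) (w' : M.GradedDual),
    ∃ (N : ℕ) (a : ℕ → ℕ → ℕ → ℕ → ℂ) (m n : ℕ → ℂ) (t : ℕ), 0 < t ∧
      ∀ (p : ℤ) (z₁ z₂ : ℂ),
        let f : ℂ := ∑ i ∈ Finset.range (N + 1), ∑ j ∈ Finset.range (N + 1),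
          ∑ k ∈ Finset.range (N + 1), ∑ l ∈ Finset.range (N + 1),
            a i j k l * Complex.exp (m i * lp p z₁) * Complex.exp (n j * lp p z₂) *
              lp p z₁ ^ k * lp p z₂ ^ l * (z₁ - z₂) ^ (-(t : ℤ))
        (‖z₂‖ < ‖z₁‖ → 0 < ‖z₂‖ →
          (Summable fun q : ℂ => ‖M.productTerm M.Yg w' u (lp p z₁) v (lp p z₂) w q‖) ∧
          (|arg₀ z₁ - arg₀ z₂| < Real.pi / 2 →
            HasSum (fun q : ℂ => M.productTerm M.Yg w' u (lp p z₁) v (lp p z₂) w q) f)) ∧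
        (‖z₁‖ < ‖z₂‖ → 0 < ‖z₁‖ →
          (Summable fun q : ℂ => ‖M.productTerm M.Yg w' v (lp p z₂) u (lp p z₁) w q‖) ∧
          (|arg₀ z₁ - arg₀ z₂| < Real.pi / 2 →
            HasSum (fun q : ℂ => M.productTerm M.Yg w' v (lp p z₂) u (lp p z₁) w q) f)) ∧
        (‖z₁ - z₂‖ < ‖z₂‖ → 0 < ‖z₁ - z₂‖ →
          (Summable fun q : ℤ => ‖M.iterateTerm M.Yg w' u (z₁ - z₂) v (lp p z₂) w q‖) ∧
          (|arg₀ z₁ - arg₀ z₂| < Real.pi / 2 →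
            HasSum (fun q : ℤ => M.iterateTerm M.Yg w' u (z₁ - z₂) v (lp p z₂) w q) f))

/-- The duality property for `Y^g_0`. The third series is the double series over `n ∈ ℤ` and
`j ∈ ℕ` that results from `(1 + (z₁-z₂)/z₂)^𝒩 u = ∑_j ((z₁-z₂)/z₂)^j binom(𝒩, j)u`. -/
def NonlogDuality : Prop :=
  ∀ a ∈ g.P, ∀ b ∈ g.P, ∀ u ∈ g.genEigen a, ∀ v ∈ g.genEigen b,
    ∀ (w : W) (w' : M.GradedDual),
    ∃ (G : MvPolynomial (Fin 2) ℂ) (r s t : ℤ),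
      ∀ z₁ z₂ : ℂ,
        let f : ℂ := Complex.exp (-a * lp 0 z₁) * Complex.exp (-b * lp 0 z₂) *
          (MvPolynomial.eval ![z₁, z₂] G / (z₁ ^ r * z₂ ^ s * (z₁ - z₂) ^ t))
        (‖z₂‖ < ‖z₁‖ → 0 < ‖z₂‖ →
          (Summable fun q : ℂ => ‖M.productTerm M.Y₀ w' u (lp 0 z₁) v (lp 0 z₂) w q‖) ∧
          HasSum (fun q : ℂ => M.productTerm M.Y₀ w' u (lp 0 z₁) v (lp 0 z₂) w q) f) ∧
        (‖z₁‖ < ‖z₂‖ → 0 < ‖z₁‖ →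
          (Summable fun q : ℂ => ‖M.productTerm M.Y₀ w' v (lp 0 z₂) u (lp 0 z₁) w q‖) ∧
          HasSum (fun q : ℂ => M.productTerm M.Y₀ w' v (lp 0 z₂) u (lp 0 z₁) w q) f) ∧
        (‖z₁ - z₂‖ < ‖z₂‖ → 0 < ‖z₁ - z₂‖ →
          (Summable fun q : ℤ × ℕ => ‖((z₁ - z₂) / z₂) ^ q.2 *
            M.iterateTerm M.Y₀ w' (g.binomN q.2 u) (z₁ - z₂) v (lp 0 z₂) w q.1‖) ∧
          (|arg₀ z₁ - arg₀ z₂| < Real.pi / 2 →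
            HasSum (fun q : ℤ × ℕ => ((z₁ - z₂) / z₂) ^ q.2 *
              M.iterateTerm M.Y₀ w' (g.binomN q.2 u) (z₁ - z₂) v (lp 0 z₂) w q.1) f))

/-! ### Formal calculus

Formal series in `x₀, x₁, x₂` with complex exponents and coefficients in `W` are functions
`ℂ × ℂ × ℂ → W`: the value at `(e₀, e₁, e₂)` is the coefficient of `x₀^e₀ x₁^e₁ x₂^e₂`. -/

/-- The product of the scalar series `∑_i (c i) x^(d i)` with the series `T`. -/
def mulSeries {ι : Type*} (c : ι → ℂ) (d : ι → ℂ × ℂ × ℂ) (T : ℂ × ℂ × ℂ → W) :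
    ℂ × ℂ × ℂ → W := fun e => ∑ᶠ i, c i • T (e - d i)

/-- The coefficient of `x^s` in `Y^g_0(u, x)`. -/
def coef₀ (u : V) (s : ℂ) : W →ₗ[ℂ] W where
  toFun w := M.Yg u w 0 s
  map_add' _ _ := by simp
  map_smul' _ _ := by simp

/-- The operator `u(n) = Y^g_{n,0}(u)`, the coefficient of `x^(-n-1)` in `Y^g_0(u, x)`. -/
def nmode (u : V) (n : ℂ) : W →ₗ[ℂ] W := M.coef₀ u (-n - 1)

/-- The series `Y^g_0(u, x₁) Y^g_0(v, x₂) w`. -/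
def prod₁₂ (u v : V) (w : W) : ℂ × ℂ × ℂ → W := fun e =>
  if e.1 = 0 then M.coef₀ u e.2.1 (M.coef₀ v e.2.2 w) else 0

/-- The series `Y^g_0(v, x₂) Y^g_0(u, x₁) w`. -/
def prod₂₁ (u v : V) (w : W) : ℂ × ℂ × ℂ → W := fun e =>
  if e.1 = 0 then M.coef₀ v e.2.2 (M.coef₀ u e.2.1 w) else 0

/-- The series `Y^g_0(Y(u, x₀)v, x₂) w`. -/
def iter (u v : V) (w : W) : ℂ × ℂ × ℂ → W := fun e =>
  if e.2.1 = 0 then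
    ∑ᶠ m : ℤ, if e.1 = -(m : ℂ) - 1 then M.coef₀ (A.mode u m v) e.2.2 w else 0
  else 0

/-- The series `Y^g_0(Y((1 + x₀/x₂)^𝒩 u, x₀)v, x₂) w`, with
`(1 + x₀/x₂)^𝒩 u = ∑_j x₀^j x₂^(-j) binom(𝒩, j)u`. -/
def iterN (u v : V) (w : W) : ℂ × ℂ × ℂ → W := fun e =>
  ∑ᶠ j : ℕ, M.iter (g.binomN j u) v w (e - ((j : ℂ), 0, -(j : ℂ)))

/-- The series `Y^g_0(u, x₀ + x₂) Y^g_0(v, x₂) w`, where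
`(x₀ + x₂)^s = ∑_k binom(s, k) x₀^(s-k) x₂^k`. A pair `(s, k)` contributes to the coefficient of
`x₀^e₀` only if `s = e₀ + k`. -/
def prodShift (u v : V) (w : W) : ℂ × ℂ × ℂ → W := fun e =>
  if e.2.1 = 0 then
    ∑ᶠ k : ℕ, (Ring.choose (e.1 + k) k : ℂ) • M.coef₀ u (e.1 + k) (M.coef₀ v (e.2.2 - k) w)
  else 0

/-- Multiplication by
`x₀⁻¹ δ((x₁ - x₂)/x₀) = ∑_{l ∈ ℤ} ∑_{k ∈ ℕ} (-1)^k binom(l, k) x₀^(-l-1) x₁^(l-k) x₂^k`. -/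
def mulDelta₁₂ : (ℂ × ℂ × ℂ → W) → (ℂ × ℂ × ℂ → W) :=
  mulSeries (fun i : ℤ × ℕ => (-1) ^ i.2 * Ring.choose (i.1 : ℂ) i.2)
    (fun i => (-(i.1 : ℂ) - 1, (i.1 : ℂ) - i.2, (i.2 : ℂ)))

/-- Multiplication by
`x₀⁻¹ δ((-x₂ + x₁)/x₀) = ∑_{l ∈ ℤ} ∑_{k ∈ ℕ} (-1)^(l-k) binom(l, k) x₀^(-l-1) x₁^k x₂^(l-k)`. -/
def mulDelta₂₁ : (ℂ × ℂ × ℂ → W) → (ℂ × ℂ × ℂ → W) :=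
  mulSeries (fun i : ℤ × ℕ => (-1) ^ (i.1 - i.2) * Ring.choose (i.1 : ℂ) i.2)
    (fun i => (-(i.1 : ℂ) - 1, (i.2 : ℂ), (i.1 : ℂ) - i.2))

/-- Multiplication by
`x₁⁻¹ δ((x₂ + x₀)/x₁) ((x₂ + x₀)/x₁)^a`
`= ∑_{s ∈ ℤ} ∑_{k ∈ ℕ} binom(s + a, k) x₀^k x₁^(-s-a-1) x₂^(s+a-k)`. -/
def mulDelta₂₀ (a : ℂ) : (ℂ × ℂ × ℂ → W) → (ℂ × ℂ × ℂ → W) :=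
  mulSeries (fun i : ℤ × ℕ => Ring.choose ((i.1 : ℂ) + a) i.2)
    (fun i => ((i.2 : ℂ), -(i.1 : ℂ) - a - 1, (i.1 : ℂ) + a - i.2))

/-- Multiplication by `(x₀ + x₂)^l = ∑_k binom(l, k) x₀^(l-k) x₂^k`. -/
def mulPow₀₂ (l : ℂ) : (ℂ × ℂ × ℂ → W) → (ℂ × ℂ × ℂ → W) :=
  mulSeries (fun k : ℕ => Ring.choose l k) (fun k => (l - k, 0, (k : ℂ)))

/-- Multiplication by `(x₂ + x₀)^l = ∑_k binom(l, k) x₂^(l-k) x₀^k`. -/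
def mulPow₂₀ (l : ℂ) : (ℂ × ℂ × ℂ → W) → (ℂ × ℂ × ℂ → W) :=
  mulSeries (fun k : ℕ => Ring.choose l k) (fun k => ((k : ℂ), 0, l - k))

/-- `Y^g_0` is lower truncated: `u(n)w = 0` when the real part of `n` is sufficiently large. -/
def LowerTruncated : Prop :=
  ∀ (u : V) (w : W), ∃ R : ℝ, ∀ n : ℂ, R < n.re → M.nmode u n w = 0

/-- The twisted Jacobi identity. -/
def TwistedJacobi : Prop :=
  ∀ a ∈ g.P, ∀ b ∈ g.P, ∀ u ∈ g.genEigen a, ∀ v ∈ g.genEigen b, ∀ w : W,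
    mulDelta₁₂ (M.prod₁₂ u v w) - mulDelta₂₁ (M.prod₂₁ u v w)
      = mulDelta₂₀ a (M.iterN u v w)

/-- The commutator formula: `[Y^g_0(u, x₁), Y^g_0(v, x₂)]` is the residue in `x₀` of
`x₁⁻¹ δ((x₂ + x₀)/x₁) ((x₂ + x₀)/x₁)^a Y^g_0(Y((1 + x₀/x₂)^𝒩 u, x₀)v, x₂)`. -/
def CommutatorFormula : Prop :=
  ∀ a ∈ g.P, ∀ b ∈ g.P, ∀ u ∈ g.genEigen a, ∀ v ∈ g.genEigen b, ∀ (w : W) (e₁ e₂ : ℂ),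
    M.coef₀ u e₁ (M.coef₀ v e₂ w) - M.coef₀ v e₂ (M.coef₀ u e₁ w)
      = mulDelta₂₀ a (M.iterN u v w) (-1, e₁, e₂)

/-- Weak associativity: if `l ∈ a + ℤ` is such that `u(n)w = 0` for all `n ∈ l + ℕ`, then
`(x₀ + x₂)^l Y^g_0(u, x₀ + x₂)Y^g_0(v, x₂)w`
`= (x₂ + x₀)^l Y^g_0(Y((1 + x₀/x₂)^𝒩 u, x₀)v, x₂)w`. -/
def WeakAssociativity : Prop :=
  ∀ a ∈ g.P, ∀ u ∈ g.genEigen a, ∀ (v : V) (w : W) (l : ℂ), (∃ k : ℤ, l = a + k) →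
    (∀ j : ℕ, M.nmode u (l + j) w = 0) →
    mulPow₀₂ l (M.prodShift u v w) = mulPow₂₀ l (M.iterN u v w)

end PreTwistedModule

end

end TwistedVOA

/-!
All four properties are equivalent to one family of identities between modes, the Borcherds identity
(`PreTwistedModule.Borcherds`). For a functional `f` on `W`, vectors `u ∈ V^[a+ℤ]`, `v ∈ V^[b+ℤ]`
and `w ∈ W`, it relates three sequences of matrix coefficients that are indexed by `ℤ` and vanish at
large indices: `α` from `Y^g_0(u, x₁)Y^g_0(v, x₂)w`, `β` from the product in the opposite order, and
`γ` from `Y^g_0(Y((1 + x₀/x₂)^𝒩 u, x₀)v, x₂)w`. In terms of `x = x₁/x₂` it says that for every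
`l, ν ∈ ℤ` three numbers, the residues of `x^(-1-ν-l) (x-1)^l` times these sequences, add up to zero
(`borcherdsDefect`).

*The formal properties.* The coefficients of the twisted Jacobi identity are the Borcherds
identities (`map_jacobi`), after one has checked that no other powers of the variables occur. The
commutator formula is the case `l = 0`, and weak associativity is the case in which the terms with
`β` vanish. These cases imply all others by Pascal's rule (`borcherdsDefect_succ`,
`borcherdsDefect_eq_zero`).

*From the Borcherds identity to convergence.* The Borcherds identity forces `α`, `β`, `γ` to be the
expansions at `∞`, `0` and `1` of one rational function with poles at these points
(`exists_eq_comb`): multiplied by a high power of `x - 1`, the first two become the same Laurent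
polynomial, and the third one is then determined. Such expansions converge by the binomial series
and have the right sums. For the third series, the factor `(1 + x)^𝒩` is written as
`∑_k 𝒩^k log(1+x)^k / k!` (`mk_chooseCoeff`, `iterNSeq_eq_sum`).

*From convergence to the Borcherds identity.* It suffices to use `z₂ = 1` and `z₁ = e^ℓ` with `ℓ`
real. By hypothesis the sums are `F(ℓ) (e^ℓ - 1)^(-t)` with an exponential polynomial `F`. Then
`(x - 1)^t α` is the sequence of coefficients of a series in `e^ℓ` with sum `F(ℓ)`. As `F` is
annihilated by a nonzero polynomial in the shift `ℓ ↦ ℓ + 1`, this series is finite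
(`finite_of_hasSum_expPoly`). Hence the common sum is a rational function, and by uniqueness of
expansions `α`, `β`, `γ` are its expansions, which satisfy the Borcherds identity by the residue
theorem (`borcherdsDefect_exp`).

*From `Y^g_0` to `Y^g`.* Equivariance gives `Y^g(v, x) = Y^g_0(x^(-𝒩) v, x)` (`subst_Yg`): the two
sides are polynomials in `log x`, and equivariance compares them along `2πi ℕ`. So the series for
`Y^g` are finite combinations of those for `Y^g_0`, with powers of logarithms as coefficients, and
vice versa. The powers of the logarithms in the third series combine with those of `(1 + x)^𝒩`,
because `log z₁ - log z₂ = log(z₁/z₂)` when the arguments differ by less than `π/2` (`lp_sub_lp`).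
The iterate also uses that `𝒩` is a derivation of `V` (`expN_mode`).

That `Y^g_0` is lower truncated is automatic, since the degrees of `W` have nonnegative real part.
-/

namespace TwistedVOA

noncomputable section

/-! ### Binomial coefficients with integral lower index -/

/-- The binomial coefficient `binom(s, e)` for an integer `e`; it is `0` for `e < 0`. -/
def zchoose (s : ℂ) (e : ℤ) : ℂ := if 0 ≤ e then Ring.choose s e.toNat else 0

theorem zchoose_natCast (s : ℂ) (n : ℕ) : zchoose s n = Ring.choose s n := by
  simp [zchoose]

theorem zchoose_of_neg (s : ℂ) {e : ℤ} (h : e < 0) : zchoose s e = 0 := by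
  simp [zchoose, h.not_ge]

theorem zchoose_zero_left (e : ℤ) : zchoose 0 e = if e = 0 then 1 else 0 := by
  rcases lt_or_ge e 0 with h | h
  · rw [zchoose_of_neg _ h, if_neg h.ne]
  · obtain ⟨n, rfl⟩ := Int.eq_ofNat_of_zero_le h
    rw [zchoose_natCast, Ring.choose_zero_ite]
    simp

theorem finsum_eq_sum_range {M : Type*} [AddCommMonoid M] (f : ℕ → M) (n : ℕ)
    (h : ∀ i, n ≤ i → f i = 0) : ∑ᶠ i, f i = ∑ i ∈ Finset.range n, f i := by
  refine finsum_eq_sum_of_support_subset f fun i hi => ?_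
  by_contra hlt
  exact hi (h i (by simpa using hlt))

/-- The Chu–Vandermonde identity. -/
theorem finsum_choose_mul_zchoose (r s : ℂ) (E : ℤ) :
    ∑ᶠ i : ℕ, Ring.choose r i * zchoose s (E - i) = zchoose (r + s) E := by
  rcases lt_or_ge E 0 with h | h
  · rw [zchoose_of_neg _ h]
    refine (finsum_congr fun i => ?_).trans finsum_zero
    rw [zchoose_of_neg _ (by omega), mul_zero]
  · obtain ⟨n, rfl⟩ := Int.eq_ofNat_of_zero_le h
    rw [finsum_eq_sum_range _ (n + 1), zchoose_natCast, Ring.add_choose_eq n (Commute.all r s),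
      Finset.Nat.sum_antidiagonal_eq_sum_range_succ_mk]
    · refine Finset.sum_congr rfl fun i hi => ?_
      have : i ≤ n := by simpa [Nat.lt_succ_iff] using hi
      rw [← Nat.cast_sub this, zchoose_natCast]
    · intro i hi
      rw [zchoose_of_neg _ (by omega), mul_zero]

theorem choose_neg_natCast_succ (r k : ℕ) :
    Ring.choose (-(r : ℂ) - 1) k = (-1) ^ k * (Nat.choose (r + k) k : ℂ) := by
  have h := Ring.choose_neg ((r : ℂ) + 1) k
  rw [show -((r : ℂ) + 1) = -(r : ℂ) - 1 by ring] at h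
  rw [h, show (r : ℂ) + 1 + k - 1 = ((r + k : ℕ) : ℂ) by push_cast; ring, Ring.choose_natCast,
    Units.smul_def, zsmul_eq_mul]
  simp

/-- The coefficients of `z⁻¹` at `∞`, at `0`, and the coefficient of `(z - 1)⁻¹` at `1` of the
rational function `z^j (z - 1)^s` satisfy the residue theorem. -/
theorem zchoose_residue (s j : ℤ) :
    (-1 : ℂ) ^ (j + s + 1) * zchoose s (j + s + 1) - (-1 : ℂ) ^ (s - 1 - j) * zchoose s (-1 - j)
      = zchoose j (-1 - s) := by
  have hm : (-1 : ℂ) ≠ 0 := by norm_num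
  rcases lt_or_ge s 0 with hs | hs
  · obtain ⟨r, rfl⟩ : ∃ r : ℕ, s = -(r : ℤ) - 1 := ⟨(-1 - s).toNat, by omega⟩
    rw [show -1 - (-(r : ℤ) - 1) = (r : ℤ) by ring, zchoose_natCast]
    rcases lt_or_ge j 0 with hj | hj
    · obtain ⟨q, rfl⟩ : ∃ q : ℕ, j = -(q : ℤ) - 1 := ⟨(-1 - j).toNat, by omega⟩
      rw [zchoose_of_neg _ (by omega), show -1 - (-(q : ℤ) - 1) = (q : ℤ) by ring,
        zchoose_natCast]
      push_cast
      rw [choose_neg_natCast_succ, choose_neg_natCast_succ, add_comm q r, Nat.choose_symm_add,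
        show -(r : ℤ) - 1 - 1 - (-(q : ℤ) - 1) = (q : ℤ) - r - 1 by ring, zpow_sub₀ hm,
        zpow_sub₀ hm, zpow_natCast, zpow_natCast, ← mul_assoc]
      rcases neg_one_pow_eq_or ℂ q with h | h <;> rcases neg_one_pow_eq_or ℂ r with h' | h' <;>
        simp [h, h']
    · obtain ⟨q, rfl⟩ := Int.eq_ofNat_of_zero_le hj
      rw [zchoose_of_neg _ (show -1 - (q : ℤ) < 0 by omega), mul_zero, sub_zero]
      rw [show (q : ℤ) + (-(r : ℤ) - 1) + 1 = (q : ℤ) - r by ring]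
      push_cast
      rw [Ring.choose_natCast]
      rcases lt_or_ge q r with h | h
      · rw [zchoose_of_neg _ (by omega), Nat.choose_eq_zero_of_lt h]
        simp
      · obtain ⟨d, rfl⟩ := Nat.exists_eq_add_of_le h
        rw [show ((r + d : ℕ) : ℤ) - r = (d : ℤ) by push_cast; ring, zchoose_natCast, zpow_natCast,
          choose_neg_natCast_succ, ← mul_assoc, ← mul_pow, Nat.choose_symm_add]
        simp
  · obtain ⟨n, rfl⟩ := Int.eq_ofNat_of_zero_le hs
    rw [zchoose_of_neg (j : ℂ) (by omega)]
    have hsign : (-1 : ℂ) ^ (j + n + 1) = (-1 : ℂ) ^ ((n : ℤ) - 1 - j) := by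
      rw [show j + (n : ℤ) + 1 = ((n : ℤ) - 1 - j) + 2 * (j + 1) by ring, zpow_add₀ hm,
        zpow_mul]
      simp
    have hch : zchoose ((n : ℤ) : ℂ) (j + n + 1) = zchoose ((n : ℤ) : ℂ) (-1 - j) := by
      push_cast
      rcases lt_or_ge j 0 with hj | hj
      · obtain ⟨q, rfl⟩ : ∃ q : ℕ, j = -(q : ℤ) - 1 := ⟨(-1 - j).toNat, by omega⟩
        rw [show -1 - (-(q : ℤ) - 1) = (q : ℤ) by ring, zchoose_natCast, Ring.choose_natCast,
          show -(q : ℤ) - 1 + n + 1 = (n : ℤ) - q by ring]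
        rcases lt_or_ge n q with h | h
        · rw [zchoose_of_neg _ (by omega), Nat.choose_eq_zero_of_lt h]
          simp
        · rw [← Nat.cast_sub h, zchoose_natCast, Ring.choose_natCast, Nat.choose_symm h]
      · obtain ⟨q, rfl⟩ := Int.eq_ofNat_of_zero_le hj
        rw [zchoose_of_neg _ (show -1 - (q : ℤ) < 0 by omega),
          show (q : ℤ) + n + 1 = ((q + n + 1 : ℕ) : ℤ) by push_cast; ring, zchoose_natCast,
          Ring.choose_natCast, Nat.choose_eq_zero_of_lt (by omega)]
        simp
    rw [hsign, hch, sub_self]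

/-! ### Sequences bounded above and the scalar Borcherds identity -/

/-- The sequences indexed by `ℤ` that vanish at all sufficiently large integers. -/
def boundedAbove : Submodule ℂ (ℤ → ℂ) where
  carrier := {f | ∃ K : ℤ, ∀ k, K ≤ k → f k = 0}
  zero_mem' := ⟨0, fun _ _ => rfl⟩
  add_mem' := by
    rintro f g ⟨K, hK⟩ ⟨L, hL⟩
    exact ⟨max K L, fun k hk => by
      simp [hK k (le_trans (le_max_left _ _) hk), hL k (le_trans (le_max_right _ _) hk)]⟩
  smul_mem' := by
    rintro c f ⟨K, hK⟩
    exact ⟨K, fun k hk => by simp [hK k hk]⟩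

/-- The number `∑_{i ≥ 0} c_i f_{ν+i}`. -/
def conv (c : ℕ → ℂ) (ν : ℤ) (f : ℤ → ℂ) : ℂ := ∑ᶠ i : ℕ, c i * f (ν + i)

theorem conv_finite_support (c : ℕ → ℂ) (ν : ℤ) {f : ℤ → ℂ} (hf : f ∈ boundedAbove) :
    (Function.support fun i : ℕ => c i * f (ν + i)).Finite := by
  obtain ⟨K, hK⟩ := hf
  refine (Set.finite_lt_nat (K - ν).toNat).subset fun i hi => ?_
  by_contra hlt
  refine hi ?_
  simp only [Set.mem_ofPred_eq, not_lt] at hlt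
  simp only [hK (ν + i) (by omega), mul_zero]

theorem conv_add (c : ℕ → ℂ) (ν : ℤ) {f g : ℤ → ℂ} (hf : f ∈ boundedAbove)
    (hg : g ∈ boundedAbove) : conv c ν (f + g) = conv c ν f + conv c ν g := by
  unfold conv
  rw [← finsum_add_distrib (conv_finite_support c ν hf) (conv_finite_support c ν hg)]
  exact finsum_congr fun i => by simp [mul_add]

theorem conv_smul (c : ℕ → ℂ) (ν : ℤ) (a : ℂ) (f : ℤ → ℂ) :
    conv c ν (a • f) = a * conv c ν f := by
  unfold conv
  rw [mul_finsum]
  exact finsum_congr fun i => by simp; ring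

theorem conv_zero (c : ℕ → ℂ) (ν : ℤ) : conv c ν 0 = 0 := by
  simp [conv]

theorem conv_sub (c : ℕ → ℂ) (ν : ℤ) {f g : ℤ → ℂ} (hf : f ∈ boundedAbove)
    (hg : g ∈ boundedAbove) : conv c ν (f - g) = conv c ν f - conv c ν g := by
  rw [sub_eq_add_neg, ← neg_one_smul ℂ g, conv_add c ν hf (Submodule.smul_mem _ _ hg), conv_smul]
  ring

/-- Pascal's rule for `conv`. -/
theorem conv_choose_succ (r : ℂ) (ε : ℂ) (ν : ℤ) {f : ℤ → ℂ} (hf : f ∈ boundedAbove) :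
    conv (fun i => ε ^ i * Ring.choose (r + 1) i) ν f
      = conv (fun i => ε ^ i * Ring.choose r i) ν f
        + ε * conv (fun i => ε ^ i * Ring.choose r i) (ν + 1) f := by
  obtain ⟨K, hK⟩ := hf
  set n := (K - ν).toNat with hn
  unfold conv
  rw [finsum_eq_sum_range _ (n + 1), finsum_eq_sum_range _ (n + 1), finsum_eq_sum_range _ n,
    Finset.sum_range_succ', Finset.sum_range_succ', Finset.mul_sum]
  · have : ∀ i ∈ Finset.range n, ε ^ (i + 1) * Ring.choose (r + 1) (i + 1) * f (ν + (i + 1 : ℕ))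
        = ε ^ (i + 1) * Ring.choose r (i + 1) * f (ν + (i + 1 : ℕ))
          + ε * (ε ^ i * Ring.choose r i * f (ν + 1 + i)) := by
      intro i _
      rw [Ring.choose_succ_succ, show ν + 1 + (i : ℤ) = ν + (i + 1 : ℕ) by push_cast; ring]
      ring
    rw [Finset.sum_congr rfl this, Finset.sum_add_distrib]
    simp only [Ring.choose_zero_right]
    ring
  · intro i hi
    rw [hK _ (by omega), mul_zero]
  · intro i hi
    rw [hK _ (by omega), mul_zero]
  · intro i hi
    rw [hK _ (by omega), mul_zero]

/-- A sequence that is bounded above is determined by its products with power series of constant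
term `1`. -/
theorem eq_zero_of_conv_eq_zero (c : ℤ → ℕ → ℂ) (hc : ∀ ν, c ν 0 = 1) {f : ℤ → ℂ}
    (hf : f ∈ boundedAbove) (h : ∀ ν, conv (c ν) ν f = 0) : f = 0 := by
  obtain ⟨K, hK⟩ := hf
  have key : ∀ n : ℕ, ∀ k : ℤ, K - n ≤ k → f k = 0 := by
    intro n
    induction n with
    | zero => intro k hk; exact hK k (by simpa using hk)
    | succ n ih =>
      intro k hk
      rcases eq_or_lt_of_le hk with h1 | h1
      · have := h k
        unfold conv at this
        rw [finsum_eq_sum_range _ 1] at this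
        · simpa [hc] using this
        · intro i hi
          rw [ih _ (by push_cast at h1; omega), mul_zero]
      · exact ih k (by push_cast at h1; omega)
  funext k
  exact key (K - k).toNat k (by omega)

/-- The sequence of coefficients `binom(s, E - k)`. -/
def binSeq (ε s : ℂ) (E : ℤ) (k : ℤ) : ℂ := ε ^ (E - k) * zchoose s (E - k)

theorem binSeq_mem (ε s : ℂ) (E : ℤ) : binSeq ε s E ∈ boundedAbove :=
  ⟨E + 1, fun k hk => by simp [binSeq, zchoose_of_neg s (show E - k < 0 by omega)]⟩

theorem conv_binSeq {ε : ℂ} (hε : ε ≠ 0) (r s : ℂ) (E ν : ℤ) :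
    conv (fun i => ε ^ i * Ring.choose r i) ν (binSeq ε s E)
      = ε ^ (E - ν) * zchoose (r + s) (E - ν) := by
  rw [← finsum_choose_mul_zchoose, mul_finsum, conv]
  refine finsum_congr fun i => ?_
  rw [binSeq, show E - (ν + (i : ℤ)) = E - ν - i by ring, zpow_sub₀ hε, zpow_natCast]
  field_simp

/-- The difference of the two sides of the Borcherds identity with parameters `l`, `ν`, for the
sequences `α` and `β` that encode two products of operators and the sequence `γ` that encodes their
iterate. If `f` is a rational function with poles at `0`, `1`, `∞` whose expansions at these points
are `f = ∑ α_k x^k` at `∞`, `f = ∑ β_k x^(-k)` at `0` and `f = x^κ ∑ γ_k (x-1)^(-k-1)` at `1`, then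
the three terms are the residues of `x^(-1-ν-l) (x-1)^l f`. -/
def borcherdsDefect (κ : ℂ) (α β γ : ℤ → ℂ) (l ν : ℤ) : ℂ :=
  conv (fun i => (-1) ^ i * Ring.choose (l : ℂ) i) ν α
    - (-1) ^ l * conv (fun i => (-1) ^ i * Ring.choose (l : ℂ) i) (-(ν + l)) β
    - conv (fun i => 1 ^ i * Ring.choose (κ - 1 - ν - l) i) l γ

section Defect

variable {κ : ℂ} {α β γ α' β' γ' : ℤ → ℂ}

theorem borcherdsDefect_add (hα : α ∈ boundedAbove) (hβ : β ∈ boundedAbove)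
    (hγ : γ ∈ boundedAbove) (hα' : α' ∈ boundedAbove) (hβ' : β' ∈ boundedAbove)
    (hγ' : γ' ∈ boundedAbove) (l ν : ℤ) :
    borcherdsDefect κ (α + α') (β + β') (γ + γ') l ν
      = borcherdsDefect κ α β γ l ν + borcherdsDefect κ α' β' γ' l ν := by
  simp only [borcherdsDefect, conv_add _ _ hα hα', conv_add _ _ hβ hβ', conv_add _ _ hγ hγ']
  ring

theorem borcherdsDefect_smul (a : ℂ) (l ν : ℤ) :
    borcherdsDefect κ (a • α) (a • β) (a • γ) l ν = a * borcherdsDefect κ α β γ l ν := by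
  simp only [borcherdsDefect, conv_smul]
  ring

/-- Pascal's rule: `x^(-1-ν-(l+1)) (x-1)^(l+1)` is the difference of `x^(-1-ν-l) (x-1)^l` and
`x^(-1-(ν+1)-l) (x-1)^l`. -/
theorem borcherdsDefect_succ (hα : α ∈ boundedAbove) (hβ : β ∈ boundedAbove)
    (hγ : γ ∈ boundedAbove) (l ν : ℤ) :
    borcherdsDefect κ α β γ (l + 1) ν
      = borcherdsDefect κ α β γ l ν - borcherdsDefect κ α β γ l (ν + 1) := by
  have h1 := conv_choose_succ (l : ℂ) (-1) ν hα
  have h2 := conv_choose_succ (l : ℂ) (-1) (-(ν + (l + 1))) hβ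
  have h3 := conv_choose_succ (κ - 1 - ν - (l + 1)) 1 l hγ
  rw [show κ - 1 - ν - ((l : ℂ) + 1) + 1 = κ - 1 - ν - l by ring] at h3
  rw [show -(ν + (l + 1)) + 1 = -(ν + l) by ring] at h2
  unfold borcherdsDefect
  push_cast
  rw [h1, h2, h3, zpow_add₀ (by norm_num : (-1 : ℂ) ≠ 0),
    show ν + 1 + l = ν + (l + 1) by ring,
    show κ - 1 - ((ν : ℂ) + 1) - l = κ - 1 - ν - (l + 1) by ring, zpow_one]
  ring

/-- The Borcherds identities follow from the commutator formula (`l = 0`) and from weak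
associativity (`ν` sufficiently negative). -/
theorem borcherdsDefect_eq_zero (hα : α ∈ boundedAbove) (hβ : β ∈ boundedAbove)
    (hγ : γ ∈ boundedAbove) (h0 : ∀ ν, borcherdsDefect κ α β γ 0 ν = 0) (N : ℤ)
    (hN : ∀ l ν, ν + l ≤ N → borcherdsDefect κ α β γ l ν = 0) (l ν : ℤ) :
    borcherdsDefect κ α β γ l ν = 0 := by
  have hpos : ∀ n : ℕ, ∀ ν, borcherdsDefect κ α β γ n ν = 0 := by
    intro n
    induction n with
    | zero => exact h0
    | succ n ih =>
      intro ν
      have := borcherdsDefect_succ (κ := κ) hα hβ hγ n ν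
      rw [ih, ih, sub_zero] at this
      exact_mod_cast this
  have hneg : ∀ n : ℕ, ∀ ν, borcherdsDefect κ α β γ (-n) ν = 0 := by
    intro n
    induction n with
    | zero => simpa using h0
    | succ n ih =>
      have hstep : ∀ ν, borcherdsDefect κ α β γ (-(n + 1 : ℕ)) ν
          = borcherdsDefect κ α β γ (-(n + 1 : ℕ)) (ν + 1) := by
        intro ν
        have := borcherdsDefect_succ (κ := κ) hα hβ hγ (-(n + 1 : ℕ)) ν
        rw [show -((n + 1 : ℕ) : ℤ) + 1 = -n by push_cast; ring, ih] at this
        exact (sub_eq_zero.1 this.symm)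
      have hall : ∀ j : ℕ, ∀ ν, ν - j ≤ N + (n + 1 : ℕ) →
          borcherdsDefect κ α β γ (-(n + 1 : ℕ)) ν = 0 := by
        intro j
        induction j with
        | zero => intro ν hν; exact hN _ _ (by push_cast at hν ⊢; omega)
        | succ j ihj =>
          intro ν hν
          have := hstep (ν - 1)
          rw [sub_add_cancel] at this
          rw [← this]
          exact ihj _ (by push_cast at hν ⊢; omega)
      intro ν
      exact hall (ν - (N + (n + 1 : ℕ))).toNat ν (by omega)
  rcases le_total 0 l with h | h
  · obtain ⟨n, rfl⟩ := Int.eq_ofNat_of_zero_le h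
    exact hpos n ν
  · obtain ⟨n, rfl⟩ : ∃ n : ℕ, l = -(n : ℤ) := ⟨(-l).toNat, by omega⟩
    exact hneg n ν

end Defect

/-! ### Expansions of rational functions with poles at `0`, `1` and `∞` -/

/-- The coefficient of `x^k` in the expansion of `x^d (x-1)^(-t)` at `∞`. -/
def expInfty (t : ℕ) (d : ℤ) : ℤ → ℂ := binSeq (-1) (-(t : ℂ)) (d - t)

/-- The coefficient of `x^(-k)` in the expansion of `x^d (x-1)^(-t)` at `0`. -/
def expZero (t : ℕ) (d : ℤ) : ℤ → ℂ := (-1 : ℂ) ^ t • binSeq (-1) (-(t : ℂ)) (-d)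

/-- The coefficient of `(x-1)^(-k-1)` in the expansion of `x^(-κ) x^d (x-1)^(-t)` at `1`. -/
def expOne (κ : ℂ) (t : ℕ) (d : ℤ) : ℤ → ℂ := binSeq 1 (d - κ) (t - 1)

theorem expInfty_mem (t : ℕ) (d : ℤ) : expInfty t d ∈ boundedAbove := binSeq_mem _ _ _

theorem expZero_mem (t : ℕ) (d : ℤ) : expZero t d ∈ boundedAbove :=
  Submodule.smul_mem _ _ (binSeq_mem _ _ _)

theorem expOne_mem (κ : ℂ) (t : ℕ) (d : ℤ) : expOne κ t d ∈ boundedAbove := binSeq_mem _ _ _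

/-- The expansions of a rational function satisfy the Borcherds identities, by the residue
theorem. -/
theorem borcherdsDefect_exp (κ : ℂ) (t : ℕ) (d l ν : ℤ) :
    borcherdsDefect κ (expInfty t d) (expZero t d) (expOne κ t d) l ν = 0 := by
  have hm : (-1 : ℂ) ≠ 0 := by norm_num
  have h := zchoose_residue (l - t) (d - 1 - ν - l)
  unfold borcherdsDefect expInfty expZero expOne
  rw [conv_smul, conv_binSeq hm, conv_binSeq hm, conv_binSeq one_ne_zero]
  rw [show d - 1 - ν - l + (l - t) + 1 = d - t - ν by ring,
    show l - t - 1 - (d - 1 - ν - l) = l - t + (ν + l - d) by ring,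
    show -1 - (d - 1 - ν - l) = ν + l - d by ring,
    show -1 - (l - (t : ℤ)) = t - 1 - l by ring, zpow_add₀ hm (l - t), zpow_sub₀ hm l,
    zpow_natCast] at h
  rw [show -d - -(ν + l) = ν + l - d by ring,
    show κ - 1 - ν - l + (d - κ) = ((d - 1 - ν - l : ℤ) : ℂ) by push_cast; ring, one_zpow, one_mul,
    ← h]
  push_cast
  rcases neg_one_pow_eq_or ℂ t with ht | ht <;> rw [ht] <;> ring_nf

/-- The linear combination of a family of sequences with coefficients `h`. -/
def comb (h : ℤ →₀ ℂ) (f : ℤ → ℤ → ℂ) : ℤ → ℂ := h.sum fun d c => c • f d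

theorem comb_mem (h : ℤ →₀ ℂ) {f : ℤ → ℤ → ℂ} (hf : ∀ d, f d ∈ boundedAbove) :
    comb h f ∈ boundedAbove :=
  Submodule.sum_mem _ fun d _ => Submodule.smul_mem _ _ (hf d)

theorem comb_add (h h' : ℤ →₀ ℂ) (f : ℤ → ℤ → ℂ) : comb (h + h') f = comb h f + comb h' f :=
  Finsupp.sum_add_index' (by simp) (by intros; rw [add_smul])

theorem comb_single (d : ℤ) (c : ℂ) (f : ℤ → ℤ → ℂ) : comb (Finsupp.single d c) f = c • f d :=
  Finsupp.sum_single_index (by simp)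

theorem conv_comb (c : ℕ → ℂ) (ν : ℤ) (h : ℤ →₀ ℂ) {f : ℤ → ℤ → ℂ}
    (hf : ∀ d, f d ∈ boundedAbove) : conv c ν (comb h f) = h.sum fun d a => a * conv c ν (f d) := by
  induction h using Finsupp.induction_linear with
  | zero => simp [comb, conv_zero]
  | add h h' ih ih' =>
    rw [comb_add, conv_add _ _ (comb_mem h hf) (comb_mem h' hf), ih, ih',
      Finsupp.sum_add_index' (by simp) (by intros; rw [add_mul])]
  | single d a => rw [comb_single, conv_smul, Finsupp.sum_single_index (by simp)]

theorem borcherdsDefect_comb (κ : ℂ) (t : ℕ) (h : ℤ →₀ ℂ) (l ν : ℤ) :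
    borcherdsDefect κ (comb h (expInfty t)) (comb h (expZero t)) (comb h (expOne κ t)) l ν = 0 := by
  induction h using Finsupp.induction_linear with
  | zero => simp [comb, borcherdsDefect, conv_zero]
  | add h h' ih ih' =>
    rw [comb_add, comb_add, comb_add, borcherdsDefect_add, ih, ih', add_zero] <;>
    first
    | exact comb_mem _ (expInfty_mem t)
    | exact comb_mem _ (expZero_mem t)
    | exact comb_mem _ (expOne_mem κ t)
  | single d a =>
    rw [comb_single, comb_single, comb_single, borcherdsDefect_smul, borcherdsDefect_exp, mul_zero]

/-- Sequences that satisfy all Borcherds identities are the expansions of a rational function with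
poles at `0`, `1` and `∞`. -/
theorem exists_eq_comb {κ : ℂ} {α β γ : ℤ → ℂ} (hα : α ∈ boundedAbove) (hβ : β ∈ boundedAbove)
    (hγ : γ ∈ boundedAbove) (h : ∀ l ν, borcherdsDefect κ α β γ l ν = 0) :
    ∃ (t : ℕ) (H : ℤ →₀ ℂ), α = comb H (expInfty t) ∧ β = comb H (expZero t) ∧
      γ = comb H (expOne κ t) := by
  have hm : (-1 : ℂ) ≠ 0 := by norm_num
  obtain ⟨J, hJ⟩ := hγ
  obtain ⟨K, hK⟩ := hα
  obtain ⟨K', hK'⟩ := hβ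
  set t : ℕ := J.toNat with ht
  have hγ0 : ∀ c, conv c t γ = 0 := by
    intro c
    refine (finsum_congr fun i => ?_).trans finsum_zero
    rw [hJ _ (by omega), mul_zero]
  have hcomm : ∀ ν : ℤ, conv (fun i => (-1) ^ i * Ring.choose (t : ℂ) i) ν α
      = (-1) ^ t * conv (fun i => (-1) ^ i * Ring.choose (t : ℂ) i) (-(ν + t)) β := by
    intro ν
    have := h t ν
    rw [borcherdsDefect, hγ0, sub_zero, sub_eq_zero] at this
    exact_mod_cast this
  set p : ℤ → ℂ := fun d => conv (fun i => (-1) ^ i * Ring.choose (t : ℂ) i) (d - t) α with hp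
  have hfin : (Function.support p).Finite := by
    refine (Set.finite_Icc (-K') (K + t)).subset fun d hd => ?_
    rw [Set.mem_Icc]
    constructor
    · by_contra hlt
      refine hd ?_
      rw [hp]
      simp only
      rw [hcomm, conv, (finsum_congr fun i => ?_).trans finsum_zero, mul_zero]
      rw [hK' _ (by omega), mul_zero]
    · by_contra hlt
      refine hd ?_
      refine (finsum_congr fun i => ?_).trans finsum_zero
      rw [hK _ (by omega), mul_zero]
  set H : ℤ →₀ ℂ := Finsupp.ofSupportFinite p hfin with hH
  have hHp : ∀ d, H d = p d := fun d => rfl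
  have hα : α ∈ boundedAbove := ⟨K, hK⟩
  have hβ : β ∈ boundedAbove := ⟨K', hK'⟩
  have hγ : γ ∈ boundedAbove := ⟨J, hJ⟩
  have eα : α = comb H (expInfty t) := by
    rw [← sub_eq_zero]
    refine eq_zero_of_conv_eq_zero (fun _ i => (-1) ^ i * Ring.choose (t : ℂ) i) (by simp)
      (Submodule.sub_mem _ hα (comb_mem H (expInfty_mem t))) fun ν => ?_
    rw [conv_sub _ _ hα (comb_mem H (expInfty_mem t)), conv_comb _ _ _ (expInfty_mem t)]
    unfold expInfty
    simp only [conv_binSeq hm, add_neg_cancel, zchoose_zero_left]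
    rw [Finsupp.sum, Finset.sum_eq_single (ν + t)]
    · simp [hHp, hp]
    · intro d _ hd
      rw [if_neg (by omega)]
      simp
    · intro hd
      rw [Finsupp.notMem_support_iff.1 hd, zero_mul]
  have eβ : β = comb H (expZero t) := by
    rw [← sub_eq_zero]
    refine eq_zero_of_conv_eq_zero (fun _ i => (-1) ^ i * Ring.choose (t : ℂ) i) (by simp)
      (Submodule.sub_mem _ hβ (comb_mem H (expZero_mem t))) fun ν => ?_
    rw [conv_sub _ _ hβ (comb_mem H (expZero_mem t)), conv_comb _ _ _ (expZero_mem t)]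
    unfold expZero
    simp only [conv_smul, conv_binSeq hm, add_neg_cancel, zchoose_zero_left]
    have := hcomm (-ν - t)
    rw [show -(-ν - (t : ℤ) + t) = ν by ring] at this
    rw [Finsupp.sum, Finset.sum_eq_single (-ν)]
    · simp only [hHp, hp, this]
      rcases neg_one_pow_eq_or ℂ t with ht | ht <;> rw [ht] <;> simp
    · intro d _ hd
      rw [if_neg (by omega)]
      simp
    · intro hd
      rw [Finsupp.notMem_support_iff.1 hd, zero_mul]
  refine ⟨t, H, eα, eβ, ?_⟩
  rw [← sub_eq_zero]
  refine eq_zero_of_conv_eq_zero (fun l i => 1 ^ i * Ring.choose (κ - 1 - (0 : ℤ) - l) i) (by simp)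
    (Submodule.sub_mem _ hγ (comb_mem H (expOne_mem κ t))) fun l => ?_
  have h1 := h l 0
  have h2 := borcherdsDefect_comb κ t H l 0
  rw [← eα, ← eβ, ← h1] at h2
  unfold borcherdsDefect at h2
  rw [conv_sub _ _ hγ (comb_mem H (expOne_mem κ t)), sub_eq_zero]
  exact (sub_right_injective h2).symm

theorem hasSum_of_eq {ι : Type*} {f g : ι → ℂ} {a b : ℂ} (h : HasSum f a) (hf : ∀ i, g i = f i)
    (hab : b = a) : HasSum g b := by
  rw [funext hf, hab]
  exact h

theorem hasSum_choose_mul_pow (s : ℂ) {y : ℂ} (hy : ‖y‖ < 1) :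
    HasSum (fun n : ℕ => Ring.choose s n * y ^ n) ((1 + y) ^ s) := by
  have h := (Complex.one_add_cpow_hasFPowerSeriesOnBall_zero (a := s)).hasSum (y := y)
    (by rw [← ENNReal.ofReal_one, Metric.eball_ofReal]; simpa using hy)
  rw [zero_add] at h
  refine hasSum_of_eq h (fun n => ?_) rfl
  rw [binomialSeries_apply, List.prod_ofFn, Finset.prod_const, Finset.card_univ, Fintype.card_fin,
    smul_eq_mul]

/-- Reindexing of a series over `ℤ` with finitely many terms of one sign. -/
theorem hasSum_int_of_sub {f : ℤ → ℂ} {s : ℂ} (E : ℤ) (hf : ∀ k, E < k → f k = 0)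
    (h : HasSum (fun n : ℕ => f (E - n)) s) : HasSum f s := by
  have hinj : Function.Injective fun n : ℕ => E - (n : ℤ) := fun a b hab => by
    simpa using hab
  refine (hinj.hasSum_iff fun k hk => ?_).1 h
  refine hf k ?_
  by_contra hlt
  exact hk ⟨(E - k).toNat, by simp only; omega⟩

theorem hasSum_sub_of_int {f : ℤ → ℂ} {s : ℂ} (E : ℤ) (hf : ∀ k, E < k → f k = 0)
    (h : HasSum f s) : HasSum (fun n : ℕ => f (E - n)) s := by
  have hinj : Function.Injective fun n : ℕ => E - (n : ℤ) := fun a b hab => by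
    simpa using hab
  refine (hinj.hasSum_iff fun k hk => ?_).2 h
  refine hf k ?_
  by_contra hlt
  exact hk ⟨(E - k).toNat, by simp only; omega⟩

theorem hasSum_binSeq {ε s y : ℂ} (hy0 : y ≠ 0) (hy : ‖ε * y‖ < 1) (E : ℤ) :
    HasSum (fun k => binSeq ε s E k * y ^ (-k)) (y ^ (-E) * (1 + ε * y) ^ s) := by
  refine hasSum_int_of_sub E (fun k hk => ?_) ?_
  · simp [binSeq, zchoose_of_neg s (show E - k < 0 by omega)]
  · refine hasSum_of_eq ((hasSum_choose_mul_pow s hy).mul_left (y ^ (-E))) (fun n => ?_) rfl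
    rw [binSeq, sub_sub_cancel, zchoose_natCast, neg_sub, zpow_natCast,
      show (n : ℤ) - E = -E + n by ring, zpow_add₀ hy0, zpow_natCast, mul_pow]
    ring

theorem hasSum_expInfty (t : ℕ) (d : ℤ) {x : ℂ} (hx : 1 < ‖x‖) :
    HasSum (fun k => expInfty t d k * x ^ k) (x ^ d * (x - 1) ^ (-(t : ℤ))) := by
  have hx0 : x ≠ 0 := by rintro rfl; norm_num at hx
  have h := hasSum_binSeq (ε := -1) (s := -(t : ℂ)) (y := x⁻¹) (inv_ne_zero hx0)
    (by simpa using inv_lt_one_of_one_lt₀ hx) (d - t)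
  refine hasSum_of_eq h (fun k => ?_) ?_
  · simp [expInfty]
  · rw [show (1 : ℂ) + -1 * x⁻¹ = (x - 1) * x⁻¹ by field_simp; ring,
      show (-(t : ℂ)) = ((-(t : ℤ) : ℤ) : ℂ) by push_cast; ring, Complex.cpow_intCast, mul_zpow,
      inv_zpow', inv_zpow', neg_neg, neg_neg, mul_left_comm, ← zpow_add₀ hx0, sub_add_cancel,
      mul_comm]

theorem hasSum_expZero (t : ℕ) (d : ℤ) {x : ℂ} (hx0 : x ≠ 0) (hx : ‖x‖ < 1) :
    HasSum (fun k => expZero t d k * x ^ (-k)) (x ^ d * (x - 1) ^ (-(t : ℤ))) := by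
  have h := (hasSum_binSeq (ε := -1) (s := -(t : ℂ)) (y := x) hx0
    (by simpa using hx) (-d)).mul_left ((-1) ^ t)
  refine hasSum_of_eq h (fun k => ?_) ?_
  · simp [expZero, mul_assoc]
  · rw [show (1 : ℂ) + -1 * x = -1 * (x - 1) by ring,
      show (-(t : ℂ)) = ((-(t : ℤ) : ℤ) : ℂ) by push_cast; ring, Complex.cpow_intCast, mul_zpow,
      neg_neg, zpow_neg (-1 : ℂ), zpow_natCast]
    field_simp

theorem one_add_ne_zero {y : ℂ} (hy : ‖y‖ < 1) : 1 + y ≠ 0 := by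
  intro h
  rw [show y = -1 by linear_combination h] at hy
  norm_num at hy

theorem hasSum_expOne (κ : ℂ) (t : ℕ) (d : ℤ) {y : ℂ} (hy0 : y ≠ 0) (hy : ‖y‖ < 1) :
    HasSum (fun k => expOne κ t d k * y ^ (-k - 1))
      ((1 + y) ^ (-κ) * ((1 + y) ^ d * y ^ (-(t : ℤ)))) := by
  have h := (hasSum_binSeq (ε := 1) (s := d - κ) (y := y) hy0
    (by simpa using hy) (t - 1)).mul_left (y⁻¹)
  refine hasSum_of_eq h (fun k => ?_) ?_
  · rw [expOne, zpow_sub₀ hy0, zpow_one]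
    ring
  · rw [one_mul, show (d : ℂ) - κ = d + -κ by ring, Complex.cpow_add _ _ (one_add_ne_zero hy),
      Complex.cpow_intCast,
      neg_sub, zpow_sub₀ hy0, zpow_neg, zpow_one]
    field_simp

/-- The rational function `∑_d H_d x^d (x-1)^(-t)`. -/
def ratFun (t : ℕ) (H : ℤ →₀ ℂ) (x : ℂ) : ℂ := H.sum fun d c => c * (x ^ d * (x - 1) ^ (-(t : ℤ)))

theorem comb_apply (h : ℤ →₀ ℂ) (f : ℤ → ℤ → ℂ) (k : ℤ) :
    comb h f k = h.sum fun d c => c * f d k := by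
  simp [comb, Finsupp.sum, Finset.sum_apply]

theorem hasSum_comb (h : ℤ →₀ ℂ) {f : ℤ → ℤ → ℂ} {e : ℤ → ℂ} {s : ℤ → ℂ}
    (hs : ∀ d, HasSum (fun k => f d k * e k) (s d)) :
    HasSum (fun k => comb h f k * e k) (h.sum fun d c => c * s d) := by
  simp only [comb_apply, Finsupp.sum, Finset.sum_mul]
  refine hasSum_sum fun d _ => ?_
  simp only [mul_assoc]
  exact (hs d).mul_left _

theorem hasSum_comb_expInfty (t : ℕ) (H : ℤ →₀ ℂ) {x : ℂ} (hx : 1 < ‖x‖) :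
    HasSum (fun k => comb H (expInfty t) k * x ^ k) (ratFun t H x) :=
  hasSum_comb H fun d => hasSum_expInfty t d hx

theorem hasSum_comb_expZero (t : ℕ) (H : ℤ →₀ ℂ) {x : ℂ} (hx0 : x ≠ 0) (hx : ‖x‖ < 1) :
    HasSum (fun k => comb H (expZero t) k * x ^ (-k)) (ratFun t H x) :=
  hasSum_comb H fun d => hasSum_expZero t d hx0 hx

theorem hasSum_comb_expOne (κ : ℂ) (t : ℕ) (H : ℤ →₀ ℂ) {y : ℂ} (hy0 : y ≠ 0) (hy : ‖y‖ < 1) :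
    HasSum (fun k => comb H (expOne κ t) k * y ^ (-k - 1))
      ((1 + y) ^ (-κ) * ratFun t H (1 + y)) := by
  have := hasSum_comb H fun d => hasSum_expOne κ t d hy0 hy
  convert this using 1
  simp only [ratFun, Finsupp.sum, Finset.mul_sum, add_sub_cancel_left]
  exact Finset.sum_congr rfl fun d _ => by ring

/-! ### Uniqueness of expansions -/

theorem eq_zero_of_hasSum_pow {g : ℕ → ℂ}
    (h : ∀ r : ℝ, 0 < r → r < 1 → HasSum (fun n => g n * (r : ℂ) ^ n) 0) : g = 0 := by
  set p := FormalMultilinearSeries.ofScalars ℂ g with hp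
  have hrad : (0 : ENNReal) < p.radius := by
    have h1 : Summable fun n => ‖p n‖ * ((1 / 2 : NNReal) : ℝ) ^ n := by
      have := (h (1 / 2) (by norm_num) (by norm_num)).summable.norm
      refine this.congr fun n => ?_
      rw [hp, FormalMultilinearSeries.ofScalars_norm]
      simp
    exact lt_of_lt_of_le (by norm_num) (p.le_radius_of_summable_norm h1)
  have hps := p.hasFPowerSeriesOnBall hrad
  have hfreq : ∃ᶠ z in nhdsWithin (0 : ℂ) {0}ᶜ, p.sum z = 0 := by
    have htend : Filter.Tendsto (fun n : ℕ => (((n : ℝ) + 2)⁻¹ : ℂ)) Filter.atTop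
        (nhdsWithin (0 : ℂ) {0}ᶜ) := by
      refine tendsto_nhdsWithin_iff.2 ⟨?_, Filter.Eventually.of_forall fun n => ?_⟩
      · have : Filter.Tendsto (fun n : ℕ => ((n : ℝ) + 2)⁻¹) Filter.atTop (nhds 0) :=
          tendsto_inv_atTop_zero.comp
            (Filter.tendsto_atTop_add_const_right _ _ tendsto_natCast_atTop_atTop)
        have := (Complex.continuous_ofReal.tendsto 0).comp this
        simpa [Function.comp_def] using this
      · simp only [Set.mem_compl_iff, Set.mem_singleton_iff, inv_eq_zero]
        have : ((n : ℝ) + 2 : ℝ) ≠ 0 := by positivity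
        exact_mod_cast this
    refine htend.frequently (Filter.Eventually.frequently (Filter.Eventually.of_forall fun n => ?_))
    have hs := h (((n : ℝ) + 2)⁻¹) (by positivity) (inv_lt_one_of_one_lt₀ (by
      have : (0 : ℝ) ≤ n := Nat.cast_nonneg n
      linarith))
    rw [hp]
    refine (FormalMultilinearSeries.ofScalars_sum_eq g _).trans ?_
    simp only [smul_eq_mul]
    push_cast at hs
    exact hs.tsum_eq
  have hev := (hps.analyticAt.frequently_zero_iff_eventually_zero).1 hfreq
  have := hps.hasFPowerSeriesAt.eq_zero_of_eventually hev
  rw [hp, FormalMultilinearSeries.ofScalars_series_eq_zero] at this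
  exact this

theorem eq_zero_of_hasSum_zpow {f : ℤ → ℂ} (hf : f ∈ boundedAbove)
    (h : ∀ r : ℝ, 0 < r → r < 1 → HasSum (fun k => f k * (r : ℂ) ^ (-k)) 0) : f = 0 := by
  obtain ⟨K, hK⟩ := hf
  have hg : (fun n : ℕ => f (K - n)) = 0 := by
    refine eq_zero_of_hasSum_pow fun r hr0 hr1 => ?_
    have hr : (r : ℂ) ≠ 0 := by exact_mod_cast hr0.ne'
    have := (hasSum_sub_of_int K (fun k hk => by rw [hK k hk.le, zero_mul])
      (h r hr0 hr1)).mul_left ((r : ℂ) ^ K)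
    rw [mul_zero] at this
    refine this.congr_fun fun n => ?_
    rw [neg_sub, zpow_sub₀ hr, zpow_natCast]
    field_simp
  funext k
  rcases le_or_gt K k with hk | hk
  · exact hK k hk
  · have := congrFun hg (K - k).toNat
    simp only [Pi.zero_apply] at this
    rwa [show K - ((K - k).toNat : ℤ) = k by omega] at this

/-! ### Exponential polynomials -/

/-- The algebra of exponential polynomials in one complex variable `ℓ`, generated by `ℓ` and by
the exponentials `e^(mℓ)`. -/
def expPoly : Subalgebra ℂ (ℂ → ℂ) :=
  Algebra.adjoin ℂ (Set.range (fun (m : ℂ) (ℓ : ℂ) => Complex.exp (m * ℓ)) ∪ {id})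

theorem exp_mem_expPoly (m : ℂ) : (fun ℓ : ℂ => Complex.exp (m * ℓ)) ∈ expPoly :=
  Algebra.subset_adjoin (Or.inl ⟨m, rfl⟩)

theorem id_mem_expPoly : (fun ℓ : ℂ => ℓ) ∈ expPoly :=
  Algebra.subset_adjoin (Or.inr rfl)

theorem const_mem_expPoly (c : ℂ) : (fun _ : ℂ => c) ∈ expPoly :=
  expPoly.algebraMap_mem c

theorem expPoly_le_span : Subalgebra.toSubmodule expPoly ≤
    Submodule.span ℂ (Set.range fun (i : ℂ × ℕ) (ℓ : ℂ) => Complex.exp (i.1 * ℓ) * ℓ ^ i.2) := by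
  rw [expPoly, Algebra.adjoin_eq_span]
  refine Submodule.span_mono fun F hF => ?_
  induction hF using Submonoid.closure_induction with
  | mem F hF =>
    rcases hF with ⟨m, rfl⟩ | rfl
    · exact ⟨(m, 0), by simp⟩
    · exact ⟨(0, 1), by funext; simp⟩
  | one => exact ⟨(0, 0), by funext; simp⟩
  | mul F G _ _ hF hG =>
    obtain ⟨⟨m, k⟩, rfl⟩ := hF
    obtain ⟨⟨m', k'⟩, rfl⟩ := hG
    refine ⟨(m + m', k + k'), ?_⟩
    funext ℓ
    simp only [Pi.mul_apply, add_mul, Complex.exp_add, pow_add]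
    ring

theorem differentiable_of_mem_expPoly {F : ℂ → ℂ} (hF : F ∈ expPoly) : Differentiable ℂ F := by
  induction hF using Algebra.adjoin_induction with
  | mem F hF =>
    rcases hF with ⟨m, rfl⟩ | rfl
    · fun_prop
    · exact differentiable_id
  | algebraMap c => exact differentiable_const c
  | add F G _ _ hF hG => exact hF.add hG
  | mul F G _ _ hF hG => exact hF.mul hG

/-- The operator `F(ℓ) ↦ F(ℓ + 1)`. -/
def shiftOp : Module.End ℂ (ℂ → ℂ) where
  toFun F := fun ℓ => F (ℓ + 1)
  map_add' _ _ := rfl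
  map_smul' _ _ := rfl

/-- An exponential polynomial is annihilated by a nonzero polynomial in the shift operator. -/
theorem exists_aeval_shiftOp_eq_zero {F : ℂ → ℂ} (hF : F ∈ expPoly) :
    ∃ p : Polynomial ℂ, p ≠ 0 ∧ Polynomial.aeval shiftOp p F = 0 := by
  have hF' := expPoly_le_span hF
  clear hF
  induction hF' using Submodule.span_induction with
  | mem F hF =>
    obtain ⟨⟨m, k⟩, rfl⟩ := hF
    refine ⟨(Polynomial.X - Polynomial.C (Complex.exp m)) ^ (k + 1),
      pow_ne_zero _ (Polynomial.X_sub_C_ne_zero _), ?_⟩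
    rw [map_pow, map_sub, Polynomial.aeval_X, Polynomial.aeval_C]
    have key : ∀ (n : ℕ) (q : ℂ → ℂ),
        ((shiftOp - algebraMap ℂ (Module.End ℂ (ℂ → ℂ)) (Complex.exp m)) ^ n)
            (fun ℓ => Complex.exp (m * ℓ) * q ℓ)
          = fun ℓ => Complex.exp (m * (ℓ + n)) * (fwdDiff 1)^[n] q ℓ := by
      intro n
      induction n with
      | zero => intro q; simp
      | succ n ih =>
        intro q
        have h1 : (shiftOp - algebraMap ℂ (Module.End ℂ (ℂ → ℂ)) (Complex.exp m))
            (fun ℓ => Complex.exp (m * ℓ) * q ℓ)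
            = fun ℓ => Complex.exp (m * ℓ) * (Complex.exp m * fwdDiff 1 q ℓ) := by
          funext ℓ
          simp only [LinearMap.sub_apply, Module.algebraMap_end_apply, Pi.sub_apply, Pi.smul_apply,
            smul_eq_mul, shiftOp, LinearMap.coe_mk, AddHom.coe_mk, fwdDiff, mul_add, mul_one,
            Complex.exp_add]
          ring
        rw [pow_succ, Module.End.mul_apply, h1, ih]
        funext ℓ
        have h2 : (fun ℓ => Complex.exp m * fwdDiff 1 q ℓ) = Complex.exp m • fwdDiff 1 q := rfl
        rw [h2, fwdDiff_iter_const_smul, Function.iterate_succ_apply, Pi.smul_apply, smul_eq_mul,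
          ← mul_assoc, ← Complex.exp_add]
        push_cast
        ring_nf
    rw [key, fwdDiff_iter_pow_eq_zero_of_lt (Nat.lt_succ_self k)]
    funext ℓ
    simp
  | zero => exact ⟨1, one_ne_zero, by simp⟩
  | add F G _ _ hF hG =>
    obtain ⟨p, hp, hpF⟩ := hF
    obtain ⟨q, hq, hqG⟩ := hG
    refine ⟨p * q, mul_ne_zero hp hq, ?_⟩
    rw [map_add, map_mul, Module.End.mul_apply, Module.End.mul_apply, hqG, map_zero, add_zero,
      ← Module.End.mul_apply, ← map_mul, mul_comm, map_mul, Module.End.mul_apply, hpF, map_zero]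
  | smul c F _ hF =>
    obtain ⟨p, hp, hpF⟩ := hF
    exact ⟨p, hp, by rw [map_smul, hpF, smul_zero]⟩

theorem shiftOp_pow_apply (n : ℕ) (F : ℂ → ℂ) (ℓ : ℂ) : (shiftOp ^ n) F ℓ = F (ℓ + n) := by
  induction n generalizing F with
  | zero => simp
  | succ n ih =>
    rw [pow_succ, Module.End.mul_apply, ih]
    simp only [shiftOp, LinearMap.coe_mk, AddHom.coe_mk]
    push_cast
    ring_nf

/-- A polynomial in the shift operator multiplies the coefficients of `e^(kℓ)` by its values at
`e^k`. -/
theorem hasSum_aeval_shiftOp {f : ℤ → ℂ} {F : ℂ → ℂ}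
    (h : ∀ ℓ : ℝ, 0 < ℓ → HasSum (fun k : ℤ => f k * Complex.exp (k * ℓ)) (F ℓ))
    (p : Polynomial ℂ) (ℓ : ℝ) (hℓ : 0 < ℓ) :
    HasSum (fun k : ℤ => p.eval (Complex.exp k) * f k * Complex.exp (k * ℓ))
      (Polynomial.aeval shiftOp p F ℓ) := by
  induction p using Polynomial.induction_on' with
  | add p q hp hq =>
    rw [map_add]
    exact hasSum_of_eq (hp.add hq) (fun k => by rw [Polynomial.eval_add]; ring) rfl
  | monomial n a =>
    have hs := h (ℓ + n) (by positivity)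
    refine hasSum_of_eq (hs.mul_left a) (fun k => ?_) ?_
    · rw [Polynomial.eval_monomial, ← Complex.exp_nat_mul]
      push_cast
      rw [mul_add, Complex.exp_add, mul_comm (n : ℂ) k]
      ring
    · rw [Polynomial.aeval_monomial, Module.End.mul_apply, Module.algebraMap_end_apply,
        Pi.smul_apply, shiftOp_pow_apply, smul_eq_mul]
      push_cast
      rfl

theorem exp_intCast_injective : Function.Injective fun k : ℤ => Complex.exp (k : ℂ) := by
  intro a b hab
  have h : Real.exp (a : ℝ) = Real.exp (b : ℝ) := by
    have : Complex.exp ((a : ℝ) : ℂ) = Complex.exp ((b : ℝ) : ℂ) := by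
      push_cast
      exact hab
    rw [← Complex.ofReal_exp, ← Complex.ofReal_exp] at this
    exact_mod_cast this
  exact_mod_cast Real.exp_injective h

theorem eq_zero_of_hasSum_exp {f : ℤ → ℂ} (hf : f ∈ boundedAbove)
    (h : ∀ ℓ : ℝ, 0 < ℓ → HasSum (fun k : ℤ => f k * Complex.exp (k * ℓ)) 0) : f = 0 := by
  refine eq_zero_of_hasSum_zpow hf fun r hr0 hr1 => ?_
  refine hasSum_of_eq (h (-Real.log r) (by linarith [Real.log_neg hr0 hr1])) (fun k => ?_) rfl
  rw [Complex.exp_int_mul, ← Complex.ofReal_exp, Real.exp_neg, Real.exp_log hr0, zpow_neg]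
  push_cast
  rw [inv_zpow]

/-- A series of integral exponentials that is bounded above and sums to an exponential polynomial is
finite: the coefficient of `e^(kℓ)` vanishes unless `e^k` is a root of the polynomial in the shift
operator that annihilates the sum. -/
theorem finite_of_hasSum_expPoly {f : ℤ → ℂ} (hf : f ∈ boundedAbove) {F : ℂ → ℂ} (hF : F ∈ expPoly)
    (h : ∀ ℓ : ℝ, 0 < ℓ → HasSum (fun k : ℤ => f k * Complex.exp (k * ℓ)) (F ℓ)) :
    ∃ H : ℤ →₀ ℂ, (∀ k, f k = H k) ∧
      ∀ ℓ : ℂ, F ℓ = H.sum fun d c => c * Complex.exp (d * ℓ) := by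
  obtain ⟨p, hp, hpF⟩ := exists_aeval_shiftOp_eq_zero hF
  have hzero : (fun k : ℤ => p.eval (Complex.exp k) * f k) = 0 := by
    refine eq_zero_of_hasSum_exp ?_ fun ℓ hℓ => ?_
    · obtain ⟨K, hK⟩ := hf
      exact ⟨K, fun k hk => by simp [hK k hk]⟩
    · have := hasSum_aeval_shiftOp h p ℓ hℓ
      rwa [hpF] at this
  have hfin : (Function.support f).Finite := by
    refine ((p.rootSet_finite ℂ).preimage exp_intCast_injective.injOn).subset fun k hk => ?_
    have := congrFun hzero k
    simp only [Pi.zero_apply, mul_eq_zero] at this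
    rw [Set.mem_preimage, Polynomial.mem_rootSet]
    exact ⟨hp, by simpa using this.resolve_right hk⟩
  refine ⟨Finsupp.ofSupportFinite f hfin, fun k => rfl, ?_⟩
  set H := Finsupp.ofSupportFinite f hfin with hH
  set L : ℂ → ℂ := fun ℓ => H.sum fun d c => c * Complex.exp (d * ℓ) with hL
  have hLd : Differentiable ℂ L := by
    rw [hL]
    unfold Finsupp.sum
    fun_prop
  have hpos : ∀ ℓ : ℝ, 0 < ℓ → F ℓ = L ℓ := by
    intro ℓ hℓ
    refine (h ℓ hℓ).unique ?_
    have hs : HasSum (fun k : ℤ => f k * Complex.exp (k * ℓ))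
        (∑ k ∈ H.support, f k * Complex.exp (k * ℓ)) :=
      hasSum_sum_of_ne_finset_zero fun k hk => by
        have : f k = 0 := Finsupp.notMem_support_iff.1 hk
        simp [this]
    exact hs
  -- both sides are entire functions of `ℓ` that agree on the positive real axis
  have heq : F = L := by
    refine AnalyticOnNhd.eq_of_frequently_eq (z₀ := 1) (𝕜 := ℂ)
      ((differentiable_of_mem_expPoly hF).differentiableOn.analyticOnNhd isOpen_univ)
      (hLd.differentiableOn.analyticOnNhd isOpen_univ) ?_
    have htend : Filter.Tendsto (fun n : ℕ => ((1 + ((n : ℝ) + 1)⁻¹ : ℝ) : ℂ)) Filter.atTop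
        (nhdsWithin (1 : ℂ) {1}ᶜ) := by
      refine tendsto_nhdsWithin_iff.2 ⟨?_, Filter.Eventually.of_forall fun n => ?_⟩
      · have h1 : Filter.Tendsto (fun n : ℕ => ((n : ℝ) + 1)⁻¹) Filter.atTop (nhds 0) :=
          tendsto_inv_atTop_zero.comp
            (Filter.tendsto_atTop_add_const_right _ _ tendsto_natCast_atTop_atTop)
        have h2 := (Complex.continuous_ofReal.tendsto _).comp (h1.const_add 1)
        simpa [Function.comp_def] using h2
      · have : (0 : ℝ) < ((n : ℝ) + 1)⁻¹ := by positivity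
        simp only [Set.mem_compl_iff, Set.mem_singleton_iff]
        intro hc
        have : (1 + ((n : ℝ) + 1)⁻¹ : ℝ) = 1 := by exact_mod_cast hc
        linarith
    exact htend.frequently (Filter.Eventually.frequently
      (Filter.Eventually.of_forall fun n => hpos _ (by positivity)))
  intro ℓ
  rw [heq]

/-- Multiplication by `(x - 1)^t`, where `x = e^ℓ`, preserves series in `x` that are bounded
above. -/
theorem exists_hasSum_mul_exp_sub_one (t : ℕ) {f : ℤ → ℂ} (hf : f ∈ boundedAbove) {F : ℂ → ℂ}
    (h : ∀ ℓ : ℝ, 0 < ℓ → HasSum (fun k : ℤ => f k * Complex.exp (k * ℓ)) (F ℓ)) :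
    ∃ f' ∈ boundedAbove, ∀ ℓ : ℝ, 0 < ℓ → HasSum (fun k : ℤ => f' k * Complex.exp (k * ℓ))
      ((Complex.exp ℓ - 1) ^ t * F ℓ) := by
  induction t with
  | zero => exact ⟨f, hf, by simpa using h⟩
  | succ t ih =>
    obtain ⟨f', ⟨K, hK⟩, h'⟩ := ih
    refine ⟨fun k => f' (k - 1) - f' k, ⟨K + 1, fun k hk => ?_⟩, fun ℓ hℓ => ?_⟩
    · simp only [hK (k - 1) (by omega), hK k (by omega), sub_zero]
    · have h1 := h' ℓ hℓ
      have h2 : HasSum (fun k : ℤ => f' (k - 1) * Complex.exp (k * ℓ))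
          (Complex.exp ℓ * ((Complex.exp ℓ - 1) ^ t * F ℓ)) := by
        rw [← (Equiv.addRight (1 : ℤ)).hasSum_iff]
        refine hasSum_of_eq (h1.mul_left (Complex.exp ℓ)) (fun k => ?_) rfl
        simp only [Function.comp_apply, Equiv.coe_addRight, add_sub_cancel_right]
        push_cast
        rw [add_mul, one_mul, Complex.exp_add]
        ring
      exact hasSum_of_eq (h2.sub h1) (fun k => by ring) (by ring)

theorem exp_ofReal_ne_one {ℓ : ℝ} (hℓ : ℓ ≠ 0) : Complex.exp (ℓ : ℂ) - 1 ≠ 0 := by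
  intro h
  have : Complex.exp (ℓ : ℂ) = 1 := by linear_combination h
  rw [← Complex.ofReal_exp] at this
  have h2 : Real.exp ℓ = 1 := by exact_mod_cast this
  exact hℓ (by simpa using h2)

/-- Three series on the positive real axis (`x = e^ℓ`) that are the expansions of one function of
the form `F(log x) (x-1)^(-t)`, with `F` an exponential polynomial, satisfy the Borcherds
identities. -/
theorem borcherdsDefect_eq_zero_of_hasSum {κ : ℂ} {α β γ : ℤ → ℂ} (hα : α ∈ boundedAbove)
    (hβ : β ∈ boundedAbove) (hγ : γ ∈ boundedAbove) {F : ℂ → ℂ} (hF : F ∈ expPoly) (t : ℕ)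
    (hinf : ∀ ℓ : ℝ, 0 < ℓ → HasSum (fun k : ℤ => α k * Complex.exp (k * ℓ))
      (F ℓ * (Complex.exp ℓ - 1) ^ (-(t : ℤ))))
    (hzero : ∀ ℓ : ℝ, ℓ < 0 → HasSum (fun k : ℤ => β k * Complex.exp (-k * ℓ))
      (F ℓ * (Complex.exp ℓ - 1) ^ (-(t : ℤ))))
    (hone : ∀ ℓ : ℝ, 0 < ℓ → ℓ < Real.log 2 →
      HasSum (fun k : ℤ => γ k * (Complex.exp ℓ - 1) ^ (-k - 1))
        (Complex.exp (-κ * ℓ) * (F ℓ * (Complex.exp ℓ - 1) ^ (-(t : ℤ)))))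
    (l ν : ℤ) : borcherdsDefect κ α β γ l ν = 0 := by
  obtain ⟨f, hf, hsum⟩ := exists_hasSum_mul_exp_sub_one t hα
    (F := fun ℓ => F ℓ * (Complex.exp ℓ - 1) ^ (-(t : ℤ))) hinf
  obtain ⟨H, -, hH⟩ := finite_of_hasSum_expPoly hf hF fun ℓ hℓ => by
    refine hasSum_of_eq (hsum ℓ hℓ) (fun k => rfl) ?_
    have := exp_ofReal_ne_one hℓ.ne'
    rw [zpow_neg, zpow_natCast]
    field_simp
  have hrat : ∀ ℓ : ℝ, F ℓ * (Complex.exp ℓ - 1) ^ (-(t : ℤ)) = ratFun t H (Complex.exp ℓ) := by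
    intro ℓ
    rw [hH, ratFun, Finsupp.sum, Finsupp.sum, Finset.sum_mul]
    exact Finset.sum_congr rfl fun d _ => by rw [Complex.exp_int_mul]; ring
  have eα : α = comb H (expInfty t) := by
    rw [← sub_eq_zero]
    refine eq_zero_of_hasSum_exp (Submodule.sub_mem _ hα (comb_mem H (expInfty_mem t)))
      fun ℓ hℓ => ?_
    have h2 := hasSum_comb_expInfty t H (x := Complex.exp ℓ) (by
      rw [← Complex.ofReal_exp, Complex.norm_real, Real.norm_of_nonneg (Real.exp_pos _).le]
      exact Real.one_lt_exp_iff.2 hℓ)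
    refine hasSum_of_eq ((hinf ℓ hℓ).sub h2) (fun k => ?_) ?_
    · rw [Complex.exp_int_mul, Pi.sub_apply, sub_mul]
    · rw [hrat, sub_self]
  have eβ : β = comb H (expZero t) := by
    rw [← sub_eq_zero]
    refine eq_zero_of_hasSum_exp (Submodule.sub_mem _ hβ (comb_mem H (expZero_mem t)))
      fun ℓ hℓ => ?_
    have h2 := hasSum_comb_expZero t H (x := Complex.exp (-ℓ : ℝ)) (Complex.exp_ne_zero _) (by
      rw [← Complex.ofReal_exp, Complex.norm_real, Real.norm_of_nonneg (Real.exp_pos _).le]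
      exact Real.exp_lt_one_iff.2 (by linarith))
    refine hasSum_of_eq ((hzero (-ℓ) (by linarith)).sub h2) (fun k => ?_) ?_
    · rw [Pi.sub_apply, sub_mul, ← Complex.exp_int_mul]
      push_cast
      ring_nf
    · rw [hrat, sub_self]
  have eγ : γ = comb H (expOne κ t) := by
    rw [← sub_eq_zero]
    refine eq_zero_of_hasSum_zpow (Submodule.sub_mem _ hγ (comb_mem H (expOne_mem κ t)))
      fun r hr0 hr1 => ?_
    have hr : (r : ℂ) ≠ 0 := by exact_mod_cast hr0.ne'
    have hpos : 0 < 1 + r := by linarith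
    have hexp : Complex.exp (Real.log (1 + r) : ℝ) = 1 + (r : ℂ) := by
      rw [← Complex.ofReal_exp, Real.exp_log hpos]
      push_cast
      rfl
    have h1 := hone (Real.log (1 + r)) (Real.log_pos (by linarith))
      (Real.log_lt_log hpos (by linarith))
    have h2 := hasSum_comb_expOne κ t H (y := (r : ℂ)) hr (by
      rw [Complex.norm_real, Real.norm_of_nonneg hr0.le]; exact hr1)
    refine hasSum_of_eq ((h1.sub h2).mul_left (r : ℂ)) (fun k => ?_) ?_
    · rw [hexp, add_sub_cancel_left, Pi.sub_apply, zpow_sub₀ hr, zpow_one]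
      field_simp
    · rw [hrat, hexp, Complex.cpow_def_of_ne_zero (by exact_mod_cast hpos.ne'),
        Complex.ofReal_log hpos.le]
      push_cast
      ring_nf
  rw [eα, eβ, eγ]
  exact borcherdsDefect_comb κ t H l ν

/-! ### Powers of the logarithm and binomial coefficients -/

/-- The coefficient of `X^k` in the polynomial `binom(X, i)`. -/
def chooseCoeff (i k : ℕ) : ℂ := (i.factorial : ℂ)⁻¹ * (descPochhammer ℂ i).coeff k

theorem descPochhammer_eval_eq (t : ℂ) (i : ℕ) :
    (descPochhammer ℂ i).eval t = i.factorial * Ring.choose t i := by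
  have h := Ring.descPochhammer_eq_factorial_smul_choose t i
  rw [nsmul_eq_mul] at h
  rw [← h, ← descPochhammer_map (Int.castRingHom ℂ) i, Polynomial.eval_map,
    ← Polynomial.eval₂_smulOneHom_eq_smeval]
  congr 1
  exact Subsingleton.elim _ _

theorem chooseCoeff_eq_zero {i k : ℕ} (h : i < k) : chooseCoeff i k = 0 := by
  rw [chooseCoeff, Polynomial.coeff_eq_zero_of_natDegree_lt, mul_zero]
  rwa [descPochhammer_natDegree]

theorem choose_eq_sum_chooseCoeff (t : ℂ) (i K : ℕ) (h : i < K) :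
    Ring.choose t i = ∑ k ∈ Finset.range K, chooseCoeff i k * t ^ k := by
  have h1 : (i.factorial : ℂ) ≠ 0 := by exact_mod_cast i.factorial_ne_zero
  have h2 := descPochhammer_eval_eq t i
  rw [Polynomial.eval_eq_sum_range' (n := K) (by rwa [descPochhammer_natDegree])] at h2
  simp only [chooseCoeff, mul_assoc, ← Finset.mul_sum]
  rw [h2, inv_mul_cancel_left₀ h1]

/-- The series `log(1+X)^k / k!` is the generating function of the coefficients of `X^k` in the
polynomials `binom(X, i)`, because `(1+X)^t = e^(t log(1+X))`. -/
theorem mk_chooseCoeff (k : ℕ) : PowerSeries.mk (fun i => chooseCoeff i k)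
    = ((k.factorial : ℂ)⁻¹) • (PowerSeries.log ℂ) ^ k := by
  induction k with
  | zero =>
    ext i
    rw [PowerSeries.coeff_mk, Nat.factorial_zero, Nat.cast_one, inv_one, one_smul, pow_zero,
      PowerSeries.coeff_one, chooseCoeff, Polynomial.coeff_zero_eq_eval_zero]
    rcases Nat.eq_zero_or_pos i with rfl | hi
    · simp
    · rw [if_neg hi.ne', descPochhammer_ne_zero_eval_zero ℂ hi.ne', mul_zero]
  | succ k ih =>
    have hlog : (1 + PowerSeries.X) * (PowerSeries.derivative ℂ) (PowerSeries.log ℂ) = 1 := by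
      rw [PowerSeries.deriv_log]
      ext i
      rw [add_mul, one_mul, map_add, PowerSeries.coeff_one]
      rcases i with _ | i
      · simp
      · rw [PowerSeries.coeff_succ_X_mul, PowerSeries.coeff_mk, PowerSeries.coeff_mk]
        simp [pow_succ]
    have hunit : (1 + PowerSeries.X : PowerSeries ℂ) ≠ 0 := by
      intro h
      have := congrArg (PowerSeries.coeff 0) h
      simp at this
    refine PowerSeries.derivative.ext ?_ ?_
    · refine mul_left_cancel₀ hunit ?_
      have h1 : (1 + PowerSeries.X) * (PowerSeries.derivative ℂ)
          ((((k + 1).factorial : ℂ)⁻¹) • (PowerSeries.log ℂ) ^ (k + 1))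
          = ((k.factorial : ℂ)⁻¹) • (PowerSeries.log ℂ) ^ k := by
        rw [Derivation.map_smul, Derivation.leibniz_pow, Nat.add_sub_cancel, mul_smul_comm,
          nsmul_eq_mul, smul_eq_mul, mul_left_comm, mul_left_comm (1 + PowerSeries.X), hlog,
          mul_one, ← nsmul_eq_mul, ← Nat.cast_smul_eq_nsmul ℂ, smul_smul, Nat.factorial_succ]
        congr 1
        have : (k.factorial : ℂ) ≠ 0 := by exact_mod_cast k.factorial_ne_zero
        have : (k : ℂ) + 1 ≠ 0 := by exact_mod_cast k.succ_ne_zero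
        push_cast
        field_simp
      rw [h1, ← ih]
      ext i
      rw [add_mul, one_mul, map_add, PowerSeries.coeff_derivative, PowerSeries.coeff_mk,
        PowerSeries.coeff_mk]
      have hrec : ((i : ℂ) + 1) * chooseCoeff (i + 1) (k + 1) + i * chooseCoeff i (k + 1)
          = chooseCoeff i k := by
        have : (i.factorial : ℂ) ≠ 0 := by exact_mod_cast i.factorial_ne_zero
        have : (i : ℂ) + 1 ≠ 0 := by exact_mod_cast i.succ_ne_zero
        unfold chooseCoeff
        rw [descPochhammer_succ_right, mul_sub, Polynomial.coeff_sub, Polynomial.coeff_mul_X,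
          ← Polynomial.C_eq_natCast, Polynomial.coeff_mul_C, Nat.factorial_succ]
        push_cast
        field_simp
        ring
      rcases i with _ | i
      · rw [PowerSeries.coeff_zero_X_mul]
        rw [← hrec]
        push_cast
        ring
      · rw [PowerSeries.coeff_succ_X_mul, PowerSeries.coeff_derivative, PowerSeries.coeff_mk,
          ← hrec]
        push_cast
        ring
    · rw [← PowerSeries.coeff_zero_eq_constantCoeff_apply,
        ← PowerSeries.coeff_zero_eq_constantCoeff_apply, PowerSeries.coeff_mk,
        chooseCoeff_eq_zero (Nat.succ_pos k)]
      simp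

theorem hasSum_coeff_log_pow (k : ℕ) {y : ℂ} (hy : ‖y‖ < 1) :
    HasSum (fun i => PowerSeries.coeff i ((PowerSeries.log ℂ) ^ k) * y ^ i)
      (Complex.log (1 + y) ^ k) := by
  have hlog : HasSum (fun i => PowerSeries.coeff i (PowerSeries.log ℂ) * y ^ i)
      (Complex.log (1 + y)) := by
    refine hasSum_of_eq (Complex.hasSum_taylorSeries_log hy) (fun i => ?_) rfl
    rw [PowerSeries.coeff_log]
    rcases i with _ | i
    · simp
    · rw [if_neg (Nat.succ_ne_zero i)]
      simp only [eq_ratCast, Rat.cast_div, Rat.cast_pow, Rat.cast_neg, Rat.cast_one,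
        Rat.cast_natCast]
      ring
  induction k with
  | zero =>
    rw [pow_zero, pow_zero]
    refine hasSum_of_eq (hasSum_ite_eq 0 (1 : ℂ)) (fun i => ?_) rfl
    rw [PowerSeries.coeff_one]
    split_ifs with h <;> simp [h]
  | succ k ih =>
    have hs : (Summable fun i => PowerSeries.coeff i ((PowerSeries.log ℂ) ^ (k + 1)) * y ^ i) ∧
        ∑' i, PowerSeries.coeff i ((PowerSeries.log ℂ) ^ (k + 1)) * y ^ i
          = Complex.log (1 + y) ^ (k + 1) := by
      have hterm : ∀ i, PowerSeries.coeff i ((PowerSeries.log ℂ) ^ (k + 1)) * y ^ i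
          = ∑ p ∈ Finset.HasAntidiagonal.antidiagonal i,
              (PowerSeries.coeff p.1 ((PowerSeries.log ℂ) ^ k) * y ^ p.1)
                * (PowerSeries.coeff p.2 (PowerSeries.log ℂ) * y ^ p.2) := by
        intro i
        rw [pow_succ, PowerSeries.coeff_mul, Finset.sum_mul]
        refine Finset.sum_congr rfl fun p hp => ?_
        rw [← Finset.HasAntidiagonal.mem_antidiagonal.1 hp, pow_add]
        ring
      simp only [hterm]
      refine ⟨(summable_norm_sum_mul_antidiagonal_of_summable_norm ih.summable.norm
        hlog.summable.norm).of_norm, ?_⟩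
      rw [← tsum_mul_tsum_eq_tsum_sum_antidiagonal_of_summable_norm ih.summable.norm
        hlog.summable.norm, ih.tsum_eq, hlog.tsum_eq, pow_succ]
    exact hs.2 ▸ hs.1.hasSum

theorem hasSum_chooseCoeff (k : ℕ) {y : ℂ} (hy : ‖y‖ < 1) :
    HasSum (fun i => chooseCoeff i k * y ^ i) ((k.factorial : ℂ)⁻¹ * Complex.log (1 + y) ^ k) := by
  refine hasSum_of_eq ((hasSum_coeff_log_pow k hy).mul_left _) (fun i => ?_) rfl
  have := congrArg (PowerSeries.coeff i) (mk_chooseCoeff k)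
  rw [PowerSeries.coeff_mk, PowerSeries.coeff_smul] at this
  rw [this, smul_eq_mul, mul_assoc]

/-! ### Double series -/

/-- Grouping a double series by the total power of `y`. -/
theorem hasSum_regroup {T : ℤ → ℕ → ℂ} {J : ℤ} (hT : ∀ p i, J ≤ p → T p i = 0) {y S : ℂ}
    (h : HasSum (fun q : ℤ × ℕ => T q.1 q.2 * y ^ ((q.2 : ℤ) - q.1 - 1)) S) :
    HasSum (fun j : ℤ => (∑ᶠ i : ℕ, T (j + i) i) * y ^ (-j - 1)) S := by
  let e : ℤ × ℕ ≃ ℤ × ℕ :=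
    { toFun := fun q => (q.1 + q.2, q.2)
      invFun := fun q => (q.1 - q.2, q.2)
      left_inv := fun q => by simp
      right_inv := fun q => by simp }
  have h' := (e.hasSum_iff).2 h
  refine h'.prod_fiberwise fun j => ?_
  have hs : HasSum (fun i : ℕ => T (j + i) i * y ^ (-j - 1))
      (∑ i ∈ Finset.range (J - j).toNat, T (j + i) i * y ^ (-j - 1)) :=
    hasSum_sum_of_ne_finset_zero fun i hi => by
      rw [hT _ _ (by rw [Finset.mem_range] at hi; omega), zero_mul]
  refine hasSum_of_eq hs (fun i => ?_) ?_
  · simp only [Function.comp_apply, e, Equiv.coe_fn_mk]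
    congr 2
    ring
  · rw [finsum_eq_sum_range _ (J - j).toNat, Finset.sum_mul]
    intro i hi
    exact hT _ _ (by omega)

theorem hasSum_mul_prod {ι κ : Type*} {f : ι → ℂ} {g : κ → ℂ} {a b : ℂ} (hf : HasSum f a)
    (hg : HasSum g b) : HasSum (fun q : ι × κ => f q.1 * g q.2) (a * b) :=
  hf.mul hg (summable_mul_of_summable_norm hf.summable.norm hg.summable.norm)

/-- The product of a power series in `y` and a Laurent series in `y`. -/
theorem hasSum_conv {φ : ℕ → ℂ} {f : ℤ → ℂ} (hf : f ∈ boundedAbove) {y a b : ℂ} (hy0 : y ≠ 0)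
    (hφ : HasSum (fun i => φ i * y ^ i) a) (hfs : HasSum (fun j => f j * y ^ (-j - 1)) b) :
    HasSum (fun j => conv φ j f * y ^ (-j - 1)) (a * b) := by
  obtain ⟨J, hJ⟩ := hf
  have h := hasSum_mul_prod hfs hφ
  rw [mul_comm b] at h
  refine hasSum_regroup (T := fun p i => φ i * f p) (J := J) (fun p i hp => by
    rw [hJ p hp, mul_zero])
    (hasSum_of_eq h (fun q => ?_) rfl)
  rw [show (q.2 : ℤ) - q.1 - 1 = (q.2 : ℤ) + (-q.1 - 1) by ring, zpow_add₀ hy0, zpow_natCast]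
  ring

theorem sum_range_eq_sum_antidiagonal {M : Type*} [AddCommMonoid M] {K : ℕ} (F : ℕ → ℕ → M)
    (hF : ∀ i k, K ≤ i + k → F i k = 0) :
    ∑ i ∈ Finset.range K, ∑ k ∈ Finset.range K, F i k
      = ∑ n ∈ Finset.range K, ∑ p ∈ Finset.HasAntidiagonal.antidiagonal n, F p.1 p.2 := by
  rw [← Finset.sum_product', Finset.sum_sigma']
  have hsub : ∑ q ∈ Finset.range K ×ˢ Finset.range K, F q.1 q.2
      = ∑ q ∈ (Finset.range K ×ˢ Finset.range K).filter (fun q => q.1 + q.2 < K), F q.1 q.2 := by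
    refine (Finset.sum_filter_of_ne fun q _ hq => ?_).symm
    by_contra hlt
    exact hq (hF _ _ (not_lt.1 hlt))
  rw [hsub]
  refine Finset.sum_bij' (fun q _ => ⟨q.1 + q.2, q⟩) (fun s _ => s.2) ?_ ?_ ?_ ?_ ?_
  · intro q hq
    simp only [Finset.mem_filter] at hq
    simp [hq.2]
  · rintro ⟨n, q⟩ hq
    simp only [Finset.mem_sigma, Finset.mem_range, Finset.HasAntidiagonal.mem_antidiagonal] at hq
    simp only [Finset.mem_filter, Finset.mem_product, Finset.mem_range]
    omega
  · intro q _
    rfl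
  · rintro ⟨n, q⟩ hq
    simp only [Finset.mem_sigma, Finset.HasAntidiagonal.mem_antidiagonal] at hq
    obtain ⟨-, rfl⟩ := hq
    rfl
  · intro q _
    rfl

/-- The addition theorem `e^(x+z) = e^x e^z`, for the exponential of a nilpotent operator. -/
theorem sum_exp_add {M : Type*} [AddCommGroup M] [Module ℂ M] (φ : ℕ → M) {K : ℕ}
    (hφ : ∀ n, K ≤ n → φ n = 0) (x z : ℂ) :
    ∑ i ∈ Finset.range K, ∑ k ∈ Finset.range K,
      (((i.factorial : ℂ)⁻¹ * x ^ i) * ((k.factorial : ℂ)⁻¹ * z ^ k)) • φ (i + k)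
      = ∑ n ∈ Finset.range K, ((n.factorial : ℂ)⁻¹ * (x + z) ^ n) • φ n := by
  rw [sum_range_eq_sum_antidiagonal (fun i k =>
    (((i.factorial : ℂ)⁻¹ * x ^ i) * ((k.factorial : ℂ)⁻¹ * z ^ k)) • φ (i + k))
    fun i k h => by rw [hφ _ h, smul_zero]]
  refine Finset.sum_congr rfl fun n _ => ?_
  rw [(Commute.all x z).add_pow', Finset.mul_sum, Finset.sum_smul]
  refine Finset.sum_congr rfl fun p hp => ?_
  obtain rfl := Finset.HasAntidiagonal.mem_antidiagonal.1 hp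
  congr 1
  have ha : (p.1.factorial : ℂ) ≠ 0 := by exact_mod_cast p.1.factorial_ne_zero
  have hb : (p.2.factorial : ℂ) ≠ 0 := by exact_mod_cast p.2.factorial_ne_zero
  have hc : ((p.1 + p.2).factorial : ℂ) ≠ 0 := by exact_mod_cast (p.1 + p.2).factorial_ne_zero
  rw [nsmul_eq_mul, Nat.cast_add_choose ℂ]
  field_simp

/-- Let the sequences `Γ_k` be obtained from `R_k` by multiplication with `(1+y)^𝒩`, where `𝒩`
shifts the index `k`. If all series `∑ Γ_{k,j} y^(-j-1)` converge, so do the series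
`∑ R_{k,j} y^(-j-1)`. -/
theorem exists_hasSum_of_logShift {K : ℕ} {R Γ : ℕ → ℤ → ℂ} (hR : ∀ k, R k ∈ boundedAbove)
    (hRK : ∀ k, K ≤ k → R k = 0)
    (hΓ : ∀ k j, Γ k j = ∑ k' ∈ Finset.range K, conv (fun i => chooseCoeff i k') j (R (k + k')))
    {y : ℂ} (hy0 : y ≠ 0) (hy : ‖y‖ < 1) {G : ℕ → ℂ}
    (hG : ∀ k, HasSum (fun j => Γ k j * y ^ (-j - 1)) (G k)) :
    ∃ ρ : ℕ → ℂ, (∀ k, HasSum (fun j => R k j * y ^ (-j - 1)) (ρ k)) ∧ (∀ k, K ≤ k → ρ k = 0) ∧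
      ∀ k, G k = ∑ k' ∈ Finset.range K,
        ((k'.factorial : ℂ)⁻¹ * Complex.log (1 + y) ^ k') * ρ (k + k') := by
  have hzero : ∀ k, K ≤ k → HasSum (fun j => R k j * y ^ (-j - 1)) 0 := by
    intro k hk
    refine hasSum_of_eq hasSum_zero (fun j => ?_) rfl
    rw [hRK k hk, Pi.zero_apply, zero_mul]
  have hex : ∀ n : ℕ, ∀ k, K ≤ k + n → ∃ ρ, HasSum (fun j => R k j * y ^ (-j - 1)) ρ := by
    intro n
    induction n with
    | zero => intro k hk; exact ⟨0, hzero k hk⟩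
    | succ n ih =>
      intro k hk
      rcases Nat.eq_zero_or_pos K with hK | hK
      · exact ⟨0, hzero k (by omega)⟩
      have hchoice : ∀ k', ∃ ρ, 0 < k' → HasSum (fun j => R (k + k') j * y ^ (-j - 1)) ρ := by
        intro k'
        rcases Nat.eq_zero_or_pos k' with h0 | h0
        · exact ⟨0, fun h => absurd h0 h.ne'⟩
        · obtain ⟨ρ, hρ⟩ := ih (k + k') (by omega)
          exact ⟨ρ, fun _ => hρ⟩
      choose ρ hρ using hchoice
      obtain ⟨K, rfl⟩ : ∃ K', K = K' + 1 := ⟨K - 1, by omega⟩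
      have hsum := hasSum_sum (s := Finset.range K) fun k' _ =>
        hasSum_conv (hR (k + (k' + 1))) hy0 (hasSum_chooseCoeff (k' + 1) hy) (hρ (k' + 1)
          (Nat.succ_pos k'))
      refine ⟨_, hasSum_of_eq ((hG k).sub hsum) (fun j => ?_) rfl⟩
      rw [hΓ, Finset.sum_range_succ', ← Finset.sum_mul, ← sub_mul, add_sub_cancel_left, add_zero]
      congr 1
      rw [conv, finsum_eq_sum_range _ 1]
      · simp [chooseCoeff]
      · intro i hi
        have := congrArg (PowerSeries.coeff i) (mk_chooseCoeff 0)
        rw [PowerSeries.coeff_mk] at this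
        rw [this]
        simp [PowerSeries.coeff_one, show i ≠ 0 by omega]
  have hex' : ∀ k, ∃ ρ, HasSum (fun j => R k j * y ^ (-j - 1)) ρ := fun k => hex K k (by omega)
  choose ρ hρ using hex'
  refine ⟨ρ, hρ, fun k hk => (hρ k).unique (hzero k hk), fun k => ?_⟩
  refine (hG k).unique ?_
  refine hasSum_of_eq (hasSum_sum (s := Finset.range K) fun k' _ =>
    hasSum_conv (hR (k + k')) hy0 (hasSum_chooseCoeff k' hy) (hρ (k + k'))) (fun j => ?_) rfl
  rw [hΓ, Finset.sum_mul]

/-! ### Power series in a locally nilpotent operator -/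

theorem aeval_eq_of_coeff_eq {V : Type*} [AddCommGroup V] [Module ℂ V] {D : Module.End ℂ V} {K : ℕ}
    {u : V} (hu : (D ^ K) u = 0) {p q : Polynomial ℂ} (h : ∀ i < K, p.coeff i = q.coeff i) :
    Polynomial.aeval D p u = Polynomial.aeval D q u := by
  obtain ⟨r, hr⟩ : Polynomial.X ^ K ∣ p - q :=
    Polynomial.X_pow_dvd_iff.2 fun i hi => by rw [Polynomial.coeff_sub, h i hi, sub_self]
  rw [← sub_eq_zero, ← LinearMap.sub_apply, ← map_sub, hr, mul_comm, map_mul, map_pow,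
    Polynomial.aeval_X, Module.End.mul_apply, hu, map_zero]

theorem aeval_trunc_pow {V : Type*} [AddCommGroup V] [Module ℂ V] {D : Module.End ℂ V} {K : ℕ}
    {u : V} (hu : (D ^ K) u = 0) (φ : PowerSeries ℂ) (n : ℕ) :
    Polynomial.aeval D (PowerSeries.trunc K (φ ^ n)) u
      = ((Polynomial.aeval D (PowerSeries.trunc K φ)) ^ n) u := by
  rw [← map_pow]
  refine aeval_eq_of_coeff_eq hu fun i hi => ?_
  have h := PowerSeries.trunc_trunc_pow φ K n
  rw [← h, PowerSeries.coeff_trunc, if_pos hi, ← Polynomial.coe_pow, Polynomial.coeff_coe]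

/-! ### Graded projections -/

theorem decompose_of_mem {ι M : Type*} [DecidableEq ι] [AddCommGroup M] [Module ℂ M]
    (A : ι → Submodule ℂ M) (h : DirectSum.IsInternal A) {i : ι} {x : M} (hx : x ∈ A i) :
    decompose A h x = DirectSum.lof ℂ ι (fun i => A i) i ⟨x, hx⟩ := by
  rw [decompose, LinearEquiv.symm_apply_eq]
  exact (DirectSum.coeLinearMap_lof A i ⟨x, hx⟩).symm

open scoped Classical in
theorem gradedProj_of_mem {ι M : Type*} [DecidableEq ι] [AddCommGroup M] [Module ℂ M]
    (A : ι → Submodule ℂ M) (h : DirectSum.IsInternal A) (P : ι → Prop) {i : ι} {x : M}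
    (hx : x ∈ A i) : gradedProj A h P x = if P i then x else 0 := by
  have h1 : gradedProj A h P x = DirectSum.coeLinearMap A
      (DFinsupp.filterLinearMap ℂ (fun i => A i) P (decompose A h x)) := by
    unfold gradedProj
    rw [LinearMap.comp_apply, LinearMap.comp_apply, LinearEquiv.coe_coe]
  rw [h1, decompose_of_mem A h hx]
  have h2 : DFinsupp.filterLinearMap ℂ (fun i => A i) P
      (DirectSum.lof ℂ ι (fun i => A i) i ⟨x, hx⟩)
      = if P i then DirectSum.lof ℂ ι (fun i => A i) i ⟨x, hx⟩ else 0 :=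
    DFinsupp.filter_single (β := fun i => A i) P i ⟨x, hx⟩
  rw [h2]
  split_ifs
  · exact DirectSum.coeLinearMap_lof A i ⟨x, hx⟩
  · exact map_zero _

/-! ### Polynomial functions with values in a vector space -/

/-- The space of polynomial functions of one complex variable with values in `M`. -/
def polyFun (M : Type*) [AddCommGroup M] [Module ℂ M] : Submodule ℂ (ℂ → M) :=
  Submodule.span ℂ (Set.range fun (i : ℕ × M) (t : ℂ) => t ^ i.1 • i.2)

section PolyFun

variable {M : Type*} [AddCommGroup M] [Module ℂ M]

theorem pow_smul_mem_polyFun (k : ℕ) (m : M) : (fun t : ℂ => t ^ k • m) ∈ polyFun M :=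
  Submodule.subset_span ⟨(k, m), rfl⟩

theorem sum_mem_polyFun {ι : Type*} (s : Finset ι) {F : ι → ℂ → M} (h : ∀ i ∈ s, F i ∈ polyFun M) :
    (fun t => ∑ i ∈ s, F i t) ∈ polyFun M := by
  have := Submodule.sum_mem (polyFun M) h
  convert this using 1
  funext t
  simp

theorem exists_polynomial_of_mem_polyFun {F : ℂ → M} (hF : F ∈ polyFun M)
    (f : Module.Dual ℂ M) : ∃ p : Polynomial ℂ, ∀ t, f (F t) = p.eval t := by
  induction hF using Submodule.span_induction with
  | mem F hF =>
    obtain ⟨⟨k, m⟩, rfl⟩ := hF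
    exact ⟨Polynomial.X ^ k * Polynomial.C (f m), fun t => by
      simp only [map_smul, smul_eq_mul, Polynomial.eval_mul, Polynomial.eval_pow, Polynomial.eval_X,
        Polynomial.eval_C]⟩
  | zero => exact ⟨0, fun t => by simp⟩
  | add F G _ _ hF hG =>
    obtain ⟨p, hp⟩ := hF
    obtain ⟨q, hq⟩ := hG
    exact ⟨p + q, fun t => by simp [hp, hq]⟩
  | smul c F _ hF =>
    obtain ⟨p, hp⟩ := hF
    exact ⟨Polynomial.C c * p, fun t => by simp [hp]⟩

theorem polyFun_eq_of_natCast {F G : ℂ → M} (hF : F ∈ polyFun M) (hG : G ∈ polyFun M)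
    (h : ∀ n : ℕ, F n = G n) (t : ℂ) : F t = G t := by
  rw [← sub_eq_zero, ← Module.forall_dual_apply_eq_zero_iff ℂ]
  intro f
  obtain ⟨p, hp⟩ := exists_polynomial_of_mem_polyFun hF f
  obtain ⟨q, hq⟩ := exists_polynomial_of_mem_polyFun hG f
  rw [map_sub, hp, hq, sub_eq_zero]
  congr 1
  refine Polynomial.eq_of_infinite_eval_eq p q (Set.Infinite.mono ?_
    (Set.infinite_range_of_injective (Nat.cast_injective (R := ℂ))))
  rintro _ ⟨n, rfl⟩
  simp only [Set.mem_ofPred_eq]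
  rw [← hp, ← hq, h]

end PolyFun

namespace VertexOperatorAlgebra

variable {V : Type*} [AddCommGroup V] [Module ℂ V] (A : VertexOperatorAlgebra V)

/-! ### Modes of vertex operators on `V` -/

/-- The `n`-th product `u_n v` as a bilinear map. -/
def modeL (n : ℤ) : V →ₗ[ℂ] V →ₗ[ℂ] V :=
  LinearMap.proj n ∘ₗ VertexOperator.ncoeff ∘ₗ A.Y

theorem modeL_apply (n : ℤ) (u : V) : A.modeL n u = A.mode u n := rfl

theorem mode_add_left (u u' v : V) (n : ℤ) :
    A.mode (u + u') n v = A.mode u n v + A.mode u' n v := by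
  rw [← modeL_apply, map_add]
  rfl

theorem mode_smul_left (c : ℂ) (u v : V) (n : ℤ) : A.mode (c • u) n v = c • A.mode u n v := by
  rw [← modeL_apply, map_smul]
  rfl

theorem mode_zero_left (v : V) (n : ℤ) : A.mode 0 n v = 0 := by
  rw [← modeL_apply, map_zero]
  rfl

theorem mode_sum_left {ι : Type*} (s : Finset ι) (u : ι → V) (v : V) (n : ℤ) :
    A.mode (∑ i ∈ s, u i) n v = ∑ i ∈ s, A.mode (u i) n v := by
  rw [← modeL_apply, map_sum, LinearMap.sum_apply]
  rfl

theorem exists_mode_eq_zero (u v : V) : ∃ N : ℤ, ∀ n, N ≤ n → A.mode u n v = 0 := by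
  refine ⟨-((HahnModule.of ℂ).symm (A.Y u v)).order, fun n hn => ?_⟩
  exact VertexOperator.ncoeff_eq_zero_of_lt_order _ _ _ (by omega)

theorem mem_wt_iff {n : ℤ} {v : V} : v ∈ A.wt n ↔ A.mode A.ω 1 v = (n : ℂ) • v :=
  Module.End.mem_eigenspace_iff

/-- The Jacobi identity with `ω` as first vector gives `[L(0), u_k] = (L(-1)u)_(k+1) + (L(0)u)_k`,
and the `L(-1)`-derivative property gives `(L(-1)u)_(k+1) = -(k+1)u_k`. -/
theorem mode_mem_wt {m n : ℤ} {u v : V} (hu : u ∈ A.wt m) (hv : v ∈ A.wt n) (k : ℤ) :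
    A.mode u k v ∈ A.wt (m + n - k - 1) := by
  have hj := A.jacobi A.ω u v 0 1 k
  rw [finsum_eq_sum_range _ 1, finsum_eq_sum_range _ 2] at hj
  · simp only [Finset.sum_range_succ, Finset.sum_range_zero, zero_add] at hj
    simp only [pow_zero, Ring.choose_zero_right, Int.cast_one, mul_one, one_smul, Nat.cast_zero,
      add_zero, sub_zero, zpow_zero, Ring.choose_one_right, Nat.cast_one,
      A.L_neg_one_derivative] at hj
    have h1 : VertexOperator.ncoeff (A.Y A.ω) 1 u = (m : ℂ) • u := (A.mem_wt_iff).1 hu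
    have h2 : VertexOperator.ncoeff (A.Y A.ω) 1 v = (n : ℂ) • v := (A.mem_wt_iff).1 hv
    rw [h1, h2] at hj
    rw [mem_wt_iff]
    have h3 : VertexOperator.ncoeff (A.Y ((m : ℂ) • u)) (1 + k - 1) v
        = (m : ℂ) • A.mode u k v := by
      rw [show 1 + k - 1 = k by ring]
      exact A.mode_smul_left _ _ _ _
    have h4 : VertexOperator.ncoeff (A.Y u) k ((n : ℂ) • v) = (n : ℂ) • A.mode u k v :=
      map_smul _ _ _
    rw [h3, h4, show 1 + k - 1 = k by ring, sub_eq_iff_eq_add] at hj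
    refine hj.trans ?_
    change -((1 + k : ℤ) : ℂ) • A.mode u k v + _ + _ = _
    rw [← add_smul, ← add_smul]
    congr 1
    push_cast
    ring
  · intro i hi
    have : Ring.choose (1 : ℤ) i = 0 := by
      have := Ring.choose_natCast (R := ℤ) 1 i
      rw [Nat.choose_eq_zero_of_lt (by omega)] at this
      exact_mod_cast this
    rw [this, Int.cast_zero, zero_smul]
  · intro i hi
    rw [Ring.choose_zero_pos ℤ (by omega), Int.cast_zero, mul_zero, zero_smul]

theorem proj_of_mem (n : ℤ) {m : ℤ} {v : V} (hv : v ∈ A.wt m) :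
    A.proj n v = if m = n then v else 0 := by
  rw [proj, gradedProj_of_mem A.wt A.grading_internal _ hv]
  split_ifs <;> rfl

theorem iSup_wt : ⨆ n, A.wt n = ⊤ := A.grading_internal.submodule_iSup_eq_top

namespace Automorphism

variable {A} (g : A.Automorphism)

/-! ### Generalized eigenspaces of an automorphism -/

theorem toEnd_mode (u v : V) (n : ℤ) :
    g.toEnd (A.mode u n v) = A.mode (g.toEnd u) n (g.toEnd v) := g.map_mode u v n

/-- The identity `g(u_n v) = (gu)_n (gv)` is expanded with `g = μ + (g - μ)` on `u` and
`g = ν + (g - ν)` on `v`. -/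
theorem mode_mem_maxGenEigenspace {μ ν : ℂ} {u v : V} (hu : u ∈ g.toEnd.maxGenEigenspace μ)
    (hv : v ∈ g.toEnd.maxGenEigenspace ν) (n : ℤ) :
    A.mode u n v ∈ g.toEnd.maxGenEigenspace (μ * ν) := by
  obtain ⟨k, hk⟩ := (Module.End.mem_maxGenEigenspace _ _ _).1 hu
  obtain ⟨l, hl⟩ := (Module.End.mem_maxGenEigenspace _ _ _).1 hv
  have key : ∀ N k l : ℕ, k + l ≤ N → ∀ u v : V, ((g.toEnd - μ • 1) ^ k) u = 0 →
      ((g.toEnd - ν • 1) ^ l) v = 0 →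
      A.mode u n v ∈ g.toEnd.maxGenEigenspace (μ * ν) := by
    intro N
    induction N with
    | zero =>
      intro k l hkl u v hu _
      obtain rfl : k = 0 := by omega
      rw [pow_zero, Module.End.one_apply] at hu
      rw [hu, A.mode_zero_left]
      exact Submodule.zero_mem _
    | succ N ih =>
      intro k l hkl u v hu hv
      rcases k with _ | k
      · rw [pow_zero, Module.End.one_apply] at hu
        rw [hu, A.mode_zero_left]
        exact Submodule.zero_mem _
      rcases l with _ | l
      · rw [pow_zero, Module.End.one_apply] at hv
        rw [hv, map_zero]
        exact Submodule.zero_mem _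
      rw [pow_succ, Module.End.mul_apply] at hu hv
      set u' := (g.toEnd - μ • 1) u with hu'
      set v' := (g.toEnd - ν • 1) v with hv'
      have hgu : g.toEnd u = u' + μ • u := by simp [hu']
      have hgv : g.toEnd v = v' + ν • v := by simp [hv']
      have h1 := ih k (l + 1) (by omega) u' v hu (by rw [pow_succ, Module.End.mul_apply]; exact hv)
      have h2 := ih (k + 1) l (by omega) u v' (by rw [pow_succ, Module.End.mul_apply]; exact hu) hv
      have h3 := ih k l (by omega) u' v' hu hv
      have hstep : (g.toEnd - (μ * ν) • 1) (A.mode u n v)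
          ∈ g.toEnd.maxGenEigenspace (μ * ν) := by
        have : (g.toEnd - (μ * ν) • 1) (A.mode u n v)
            = A.mode u' n v' + ν • A.mode u' n v + μ • A.mode u n v' := by
          rw [LinearMap.sub_apply, toEnd_mode, hgu, hgv]
          simp only [mode_add_left, mode_smul_left, map_add, map_smul, LinearMap.smul_apply,
            Module.End.one_apply, smul_smul, smul_add]
          rw [mul_comm ν μ]
          abel
        rw [this]
        exact Submodule.add_mem _ (Submodule.add_mem _ h3 (Submodule.smul_mem _ _ h1))
          (Submodule.smul_mem _ _ h2)
      obtain ⟨K, hK⟩ := (Module.End.mem_maxGenEigenspace _ _ _).1 hstep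
      exact (Module.End.mem_maxGenEigenspace _ _ _).2
        ⟨K + 1, by rw [pow_succ, Module.End.mul_apply, hK]⟩
  exact key (k + l) k l le_rfl u v hk hl

theorem mode_mem_genEigen {a b : ℂ} {u v : V} (hu : u ∈ g.genEigen a) (hv : v ∈ g.genEigen b)
    (n : ℤ) : A.mode u n v ∈ g.genEigen (a + b) := by
  have := g.mode_mem_maxGenEigenspace hu hv n
  rwa [← Complex.exp_add, ← mul_add] at this

theorem genEigen_add_intCast (a : ℂ) (n : ℤ) : g.genEigen (a + n) = g.genEigen a := by
  unfold genEigen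
  rw [mul_add, Complex.exp_add]
  have : Complex.exp (2 * Real.pi * Complex.I * n) = 1 := by
    rw [mul_comm]
    exact Complex.exp_int_mul_two_pi_mul_I n
  rw [this, mul_one]

/-- Every vector of a generalized eigenspace of `g` is a sum of homogeneous ones. -/
theorem genEigen_induction (a : ℂ) {Q : V → Prop}
    (hom : ∀ n, ∀ u ∈ g.genEigen a, u ∈ A.wt n → Q u) (zero : Q 0)
    (add : ∀ u v, Q u → Q v → Q (u + v)) {u : V} (hu : u ∈ g.genEigen a) : Q u := by
  have hu' : u ∈ ⨆ n, A.wt n := by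
    rw [A.iSup_wt]; trivial
  obtain ⟨f, hf, rfl⟩ := (Submodule.mem_iSup_iff_exists_finsupp _ _).1 hu'
  have hproj : ∀ n, f n = A.proj n (f.sum fun _ x => x) := by
    intro n
    rw [Finsupp.sum, map_sum]
    simp only [A.proj_of_mem n (hf _)]
    rw [Finset.sum_ite_eq']
    split_ifs with h
    · rfl
    · exact Finsupp.notMem_support_iff.1 h
  have hcomm : ∀ n, Commute g.toEnd (A.proj n) := by
    intro n
    refine LinearMap.ext fun x => ?_
    have hx : x ∈ ⨆ n, A.wt n := by
      rw [A.iSup_wt]; trivial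
    rw [Module.End.mul_apply, Module.End.mul_apply]
    induction hx using Submodule.iSup_induction' with
    | mem m x hx =>
      have hgx : g.toEnd x ∈ A.wt m :=
        Module.End.mapsTo_genEigenspace_of_comm g.commute_L_zero.symm _ _ hx
      rw [A.proj_of_mem n hx, A.proj_of_mem n hgx]
      split_ifs <;> simp
    | zero => simp
    | add x y _ _ hx hy => rw [map_add, map_add, map_add, map_add, hx, hy]
  have hmem : ∀ n, f n ∈ g.genEigen a := by
    intro n
    rw [hproj n]
    exact Module.End.mapsTo_maxGenEigenspace_of_comm (hcomm n) _ hu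
  exact Finset.sum_induction _ Q add zero fun n _ => hom n _ (hmem n) (hf n)

/-- Every vector of `V` is a sum of homogeneous vectors in the spaces `V^[a+ℤ]`, `a ∈ P(V)`. -/
theorem homogeneous_induction {Q : V → Prop}
    (hom : ∀ a ∈ g.P, ∀ n, ∀ u ∈ g.genEigen a, u ∈ A.wt n → Q u) (zero : Q 0)
    (add : ∀ u v, Q u → Q v → Q (u + v)) (u : V) : Q u := by
  have hu : u ∈ ⨆ μ : ℂ, g.toEnd.maxGenEigenspace μ := by
    rw [g.iSup_maxGenEigenspace]; trivial
  induction hu using Submodule.iSup_induction' with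
  | mem μ x hx =>
    by_cases hμ : μ = 0
    · rw [hμ, g.maxGenEigenspace_zero] at hx
      rw [(Submodule.mem_bot ℂ).1 hx]
      exact zero
    by_cases hx0 : x = 0
    · rw [hx0]; exact zero
    set a₁ : ℂ := Complex.log μ / (2 * Real.pi * Complex.I) with ha₁
    have hpi : (2 * Real.pi * Complex.I : ℂ) ≠ 0 := Complex.two_pi_I_ne_zero
    set a : ℂ := a₁ - (⌊a₁.re⌋ : ℤ) with ha
    have hexp : Complex.exp (2 * Real.pi * Complex.I * a₁) = μ := by
      rw [ha₁, mul_div_cancel₀ _ hpi, Complex.exp_log hμ]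
    have hgen : g.genEigen a = g.toEnd.maxGenEigenspace μ := by
      have := g.genEigen_add_intCast a ⌊a₁.re⌋
      rw [ha, sub_add_cancel] at this
      rw [ha, ← this, genEigen, hexp]
    have haP : a ∈ g.P := by
      refine ⟨?_, ?_, fun hbot => hx0 ?_⟩
      · simp [ha]
      · simp [ha, Int.fract_lt_one]
      · rw [← hgen, hbot] at hx
        exact (Submodule.mem_bot ℂ).1 hx
    rw [← hgen] at hx
    exact g.genEigen_induction a (hom a haP) zero add hx
  | zero => exact zero
  | add x y _ _ hx hy => exact add x y hx hy

/-! ### The unipotent part and its complex powers -/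

theorem unipotentPart_apply {μ : ℂ} {v : V} (hv : v ∈ g.toEnd.maxGenEigenspace μ) :
    g.unipotentPart v = μ⁻¹ • g.toEnd v := by
  rw [unipotentPart, Module.End.mul_apply, g.scale_apply _
    (Module.End.mapsTo_maxGenEigenspace_of_comm (Commute.refl g.toEnd) μ hv)]

theorem unipotentPart_mode (u v : V) (n : ℤ) :
    g.unipotentPart (A.mode u n v) = A.mode (g.unipotentPart u) n (g.unipotentPart v) := by
  have hu : u ∈ ⨆ μ : ℂ, g.toEnd.maxGenEigenspace μ := by
    rw [g.iSup_maxGenEigenspace]; trivial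
  induction hu using Submodule.iSup_induction' with
  | mem μ x hx =>
    have hv : v ∈ ⨆ μ : ℂ, g.toEnd.maxGenEigenspace μ := by
      rw [g.iSup_maxGenEigenspace]; trivial
    induction hv using Submodule.iSup_induction' with
    | mem ν y hy =>
      rw [g.unipotentPart_apply hx, g.unipotentPart_apply hy,
        g.unipotentPart_apply (g.mode_mem_maxGenEigenspace hx hy n), toEnd_mode, mode_smul_left,
        map_smul, smul_smul, mul_inv]
    | zero => simp
    | add y z _ _ hy hz => rw [map_add, map_add, hy, hz, map_add, map_add]
  | zero => simp [mode_zero_left]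
  | add x y _ _ hx hy => rw [mode_add_left, map_add, hx, hy, map_add, mode_add_left]

theorem unipotentPart_mem_wt {n : ℤ} {v : V} (hv : v ∈ A.wt n) : g.unipotentPart v ∈ A.wt n := by
  have hcomm : ∀ v, A.mode A.ω 1 (g.unipotentPart v) = g.unipotentPart (A.mode A.ω 1 v) := by
    intro v
    have hu : v ∈ ⨆ μ : ℂ, g.toEnd.maxGenEigenspace μ := by
      rw [g.iSup_maxGenEigenspace]; trivial
    induction hu using Submodule.iSup_induction' with
    | mem μ x hx =>
      have hx' : A.mode A.ω 1 x ∈ g.toEnd.maxGenEigenspace μ :=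
        Module.End.mapsTo_maxGenEigenspace_of_comm g.commute_L_zero μ hx
      rw [g.unipotentPart_apply hx, g.unipotentPart_apply hx', map_smul, toEnd_mode]
      congr 3
      exact g.map_ω.symm
    | zero => simp
    | add y z _ _ hy hz => rw [map_add, map_add, hy, hz, map_add, map_add]
  rw [mem_wt_iff, hcomm, (A.mem_wt_iff).1 hv, map_smul]

theorem unipotentPart_mem_genEigen {a : ℂ} {v : V} (hv : v ∈ g.genEigen a) :
    g.unipotentPart v ∈ g.genEigen a := by
  rw [g.unipotentPart_apply hv]
  exact Submodule.smul_mem _ _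
    (Module.End.mapsTo_maxGenEigenspace_of_comm (Commute.refl g.toEnd) _ hv)

theorem 𝒩_mem {S : Submodule ℂ V} (hS : ∀ v ∈ S, g.unipotentPart v ∈ S) {v : V} (hv : v ∈ S) :
    g.𝒩 v ∈ S := by
  have hpow : ∀ j : ℕ, ((g.unipotentPart - 1) ^ j) v ∈ S := by
    intro j
    induction j with
    | zero => simpa using hv
    | succ j ih =>
      rw [pow_succ', Module.End.mul_apply, LinearMap.sub_apply, Module.End.one_apply]
      exact Submodule.sub_mem _ (hS _ ih) ih
  rw [𝒩, LinearMap.smul_apply]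
  refine Submodule.smul_mem _ _ ?_
  change (∑ᶠ j : ℕ, ((-1 : ℂ) ^ j / (j + 1)) • ((g.unipotentPart - 1) ^ (j + 1)) v) ∈ S
  exact finsum_induction (· ∈ S) S.zero_mem (fun _ _ => S.add_mem)
    fun j => S.smul_mem _ (hpow _)

theorem 𝒩_pow_mem_wt {n : ℤ} {v : V} (hv : v ∈ A.wt n) (k : ℕ) : (g.𝒩 ^ k) v ∈ A.wt n := by
  induction k with
  | zero => simpa using hv
  | succ k ih =>
    rw [pow_succ', Module.End.mul_apply]
    exact g.𝒩_mem (fun v hv => g.unipotentPart_mem_wt hv) ih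

theorem 𝒩_pow_mem_genEigen {a : ℂ} {v : V} (hv : v ∈ g.genEigen a) (k : ℕ) :
    (g.𝒩 ^ k) v ∈ g.genEigen a := by
  induction k with
  | zero => simpa using hv
  | succ k ih =>
    rw [pow_succ', Module.End.mul_apply]
    exact g.𝒩_mem (fun v hv => g.unipotentPart_mem_genEigen hv) ih

/-- The powers of `𝒩 = (2πi)⁻¹ log g_u` as polynomials in `g_u - 1`. -/
theorem 𝒩_pow_eq {K : ℕ} {u : V} (hu : ((g.unipotentPart - 1) ^ K) u = 0) (k : ℕ) :
    (g.𝒩 ^ k) u = ((2 * Real.pi * Complex.I : ℂ)⁻¹ ^ k * k.factorial) •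
      ∑ j ∈ Finset.range K, chooseCoeff j k • ((g.unipotentPart - 1) ^ j) u := by
  set D : Module.End ℂ V := g.unipotentPart - 1 with hD
  have hlog : ∀ v, (D ^ K) v = 0 → g.logUnipotentPart v
      = Polynomial.aeval D (PowerSeries.trunc K (PowerSeries.log ℂ)) v := by
    intro v hv
    have h0 : ∀ j, K ≤ j → (D ^ j) v = 0 := by
      intro j hj
      obtain ⟨d, rfl⟩ := Nat.exists_eq_add_of_le hj
      rw [add_comm, pow_add, Module.End.mul_apply, hv, map_zero]
    change (∑ᶠ j : ℕ, ((-1 : ℂ) ^ j / (j + 1)) • (D ^ (j + 1)) v) = _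
    rw [finsum_eq_sum_range _ K (fun j hj => by rw [h0 _ (by omega), smul_zero])]
    have h1 : Polynomial.aeval D (PowerSeries.trunc K (PowerSeries.log ℂ)) v
        = ∑ j ∈ Finset.range (K + 1), PowerSeries.coeff j (PowerSeries.log ℂ) • (D ^ j) v := by
      rw [Polynomial.aeval_eq_sum_range' (n := K + 1)
        (Nat.lt_succ_of_le (Polynomial.natDegree_le_of_degree_le
          (PowerSeries.degree_trunc_lt _ _).le)), LinearMap.sum_apply]
      refine Finset.sum_congr rfl fun j hj => ?_
      rw [LinearMap.smul_apply, PowerSeries.coeff_trunc]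
      split_ifs with hlt
      · rfl
      · rw [h0 j (by omega), smul_zero, smul_zero]
    rw [h1, Finset.sum_range_succ', PowerSeries.coeff_log 0, if_pos rfl, zero_smul, add_zero]
    refine Finset.sum_congr rfl fun j _ => ?_
    rw [PowerSeries.coeff_log, if_neg (Nat.succ_ne_zero j)]
    congr 1
    simp only [eq_ratCast, Rat.cast_div, Rat.cast_pow, Rat.cast_neg, Rat.cast_one,
      Rat.cast_natCast]
    push_cast
    ring
  have hker : ∀ (p : Polynomial ℂ) (v : V),
      (D ^ K) v = 0 → (D ^ K) (Polynomial.aeval D p v) = 0 := by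
    intro p v hv
    rw [← Module.End.mul_apply, ← Polynomial.aeval_X_pow (R := ℂ) D, ← map_mul, mul_comm, map_mul,
      Module.End.mul_apply, Polynomial.aeval_X_pow, hv, map_zero]
  have hpow : ∀ k : ℕ, (g.𝒩 ^ k) u = (2 * Real.pi * Complex.I : ℂ)⁻¹ ^ k •
      ((Polynomial.aeval D (PowerSeries.trunc K (PowerSeries.log ℂ))) ^ k) u ∧
      (D ^ K) (((Polynomial.aeval D (PowerSeries.trunc K (PowerSeries.log ℂ))) ^ k) u) = 0 := by
    intro k
    induction k with
    | zero => exact ⟨by simp, by simpa using hu⟩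
    | succ k ih =>
      constructor
      · rw [pow_succ' g.𝒩, Module.End.mul_apply, ih.1, map_smul, 𝒩, LinearMap.smul_apply,
          hlog _ ih.2, smul_smul, pow_succ' (Polynomial.aeval D _), Module.End.mul_apply, pow_succ]
      · rw [pow_succ', Module.End.mul_apply]
        exact hker _ _ ih.2
  rw [(hpow k).1, ← aeval_trunc_pow hu, mul_smul]
  congr 1
  have hfac : (k.factorial : ℂ) ≠ 0 := by exact_mod_cast k.factorial_ne_zero
  rw [Polynomial.aeval_eq_sum_range' (n := K + 1)
    (Nat.lt_succ_of_le (Polynomial.natDegree_le_of_degree_le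
      (PowerSeries.degree_trunc_lt _ _).le)), LinearMap.sum_apply,
    Finset.sum_range_succ, LinearMap.smul_apply, hu, smul_zero, add_zero, Finset.smul_sum]
  refine Finset.sum_congr rfl fun j hj => ?_
  have := congrArg (PowerSeries.coeff j) (mk_chooseCoeff k)
  rw [PowerSeries.coeff_mk, PowerSeries.coeff_smul, smul_eq_mul] at this
  rw [LinearMap.smul_apply, PowerSeries.coeff_trunc, if_pos (Finset.mem_range.1 hj), this,
    smul_smul, mul_inv_cancel_left₀ hfac]

theorem exists_𝒩_pow_eq_zero (u : V) : ∃ K : ℕ, ∀ k, K ≤ k → (g.𝒩 ^ k) u = 0 := by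
  obtain ⟨K, hK⟩ := g.unipotentPart_locally_unipotent u
  refine ⟨K, fun k hk => ?_⟩
  rw [g.𝒩_pow_eq hK, Finset.sum_eq_zero, smul_zero]
  intro j hj
  rw [chooseCoeff_eq_zero (lt_of_lt_of_le (Finset.mem_range.1 hj) hk), zero_smul]

theorem binomN_eq_sum {K : ℕ} {u : V} (hK : ∀ k, K ≤ k → (g.𝒩 ^ k) u = 0) (j : ℕ) :
    g.binomN j u = ∑ k ∈ Finset.range K, chooseCoeff j k • (g.𝒩 ^ k) u := by
  have h0 : ∀ k ∈ Finset.range (K + j + 1), k ∉ Finset.range K →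
      chooseCoeff j k • (g.𝒩 ^ k) u = 0 := by
    intro k _ hk
    rw [hK k (by simpa using hk), smul_zero]
  rw [Finset.sum_subset (Finset.range_subset_range.2 (by omega)) h0, binomN,
    LinearMap.smul_apply, Polynomial.aeval_eq_sum_range' (n := K + j + 1)
      (by rw [descPochhammer_natDegree]; omega), LinearMap.sum_apply, Finset.smul_sum]
  exact Finset.sum_congr rfl fun k _ => by rw [LinearMap.smul_apply, smul_smul, chooseCoeff]

/-- The operator `e^(x𝒩)`. -/
def expN (x : ℂ) (u : V) : V := ∑ᶠ k : ℕ, ((k.factorial : ℂ)⁻¹ * x ^ k) • (g.𝒩 ^ k) u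

theorem expN_eq_sum {K : ℕ} {u : V} (hK : ∀ k, K ≤ k → (g.𝒩 ^ k) u = 0) (x : ℂ) :
    g.expN x u = ∑ k ∈ Finset.range K, ((k.factorial : ℂ)⁻¹ * x ^ k) • (g.𝒩 ^ k) u :=
  finsum_eq_sum_range _ K fun k hk => by rw [hK k hk, smul_zero]

theorem expN_mem {S : Submodule ℂ V} {u : V} (h : ∀ k : ℕ, (g.𝒩 ^ k) u ∈ S) (x : ℂ) :
    g.expN x u ∈ S :=
  finsum_induction (· ∈ S) S.zero_mem (fun _ _ => S.add_mem) fun k => S.smul_mem _ (h k)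

theorem expN_zero (u : V) : g.expN 0 u = u := by
  rw [expN, finsum_eq_sum_range _ 1]
  · simp
  · intro k hk
    rw [zero_pow (by omega), mul_zero, zero_smul]

theorem expN_add (x y : ℂ) (u : V) : g.expN x (g.expN y u) = g.expN (x + y) u := by
  obtain ⟨K, hK⟩ := g.exists_𝒩_pow_eq_zero u
  have hK' : ∀ k, K ≤ k → (g.𝒩 ^ k) (g.expN y u) = 0 := by
    intro k hk
    rw [g.expN_eq_sum hK, map_sum]
    refine Finset.sum_eq_zero fun i _ => ?_
    rw [map_smul, ← Module.End.mul_apply, ← pow_add, hK _ (by omega), smul_zero]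
  rw [g.expN_eq_sum hK', g.expN_eq_sum hK, g.expN_eq_sum hK,
    ← sum_exp_add (fun n => (g.𝒩 ^ n) u) hK]
  refine Finset.sum_congr rfl fun i _ => ?_
  rw [map_sum, Finset.smul_sum]
  refine Finset.sum_congr rfl fun k _ => ?_
  rw [map_smul, smul_smul, ← Module.End.mul_apply, ← pow_add]

/-- The operator `e^(2πi t 𝒩)` is `g_u^t`, by the binomial series of `g_u^t` in `g_u - 1`. -/
theorem expN_two_pi_I_mul {K : ℕ} {u : V} (hu : ((g.unipotentPart - 1) ^ K) u = 0) (t : ℂ) :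
    g.expN (2 * Real.pi * Complex.I * t) u
      = ∑ j ∈ Finset.range K, Ring.choose t j • ((g.unipotentPart - 1) ^ j) u := by
  have hK : ∀ k, K ≤ k → (g.𝒩 ^ k) u = 0 := by
    intro k hk
    rw [g.𝒩_pow_eq hu, Finset.sum_eq_zero, smul_zero]
    intro j hj
    rw [chooseCoeff_eq_zero (lt_of_lt_of_le (Finset.mem_range.1 hj) hk), zero_smul]
  rw [g.expN_eq_sum hK]
  have h1 : ∀ j ∈ Finset.range K, Ring.choose t j • ((g.unipotentPart - 1) ^ j) u
      = ∑ k ∈ Finset.range K, (chooseCoeff j k * t ^ k) • ((g.unipotentPart - 1) ^ j) u := by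
    intro j hj
    rw [choose_eq_sum_chooseCoeff t j K (Finset.mem_range.1 hj), Finset.sum_smul]
  rw [Finset.sum_congr rfl h1, Finset.sum_comm]
  refine Finset.sum_congr rfl fun k _ => ?_
  rw [g.𝒩_pow_eq hu, smul_smul, Finset.smul_sum]
  refine Finset.sum_congr rfl fun j _ => ?_
  rw [smul_smul]
  congr 1
  have hfac : (k.factorial : ℂ) ≠ 0 := by exact_mod_cast k.factorial_ne_zero
  have hpi : (2 * Real.pi * Complex.I : ℂ) ≠ 0 := Complex.two_pi_I_ne_zero
  rw [mul_pow (2 * Real.pi * Complex.I), inv_pow]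
  field_simp

theorem expN_two_pi_I_mul_natCast (n : ℕ) (u : V) :
    g.expN (2 * Real.pi * Complex.I * n) u = (g.unipotentPart ^ n) u := by
  obtain ⟨K, hK⟩ := g.unipotentPart_locally_unipotent u
  have hK' : ((g.unipotentPart - 1) ^ (K + n + 1)) u = 0 := by
    rw [add_assoc, add_comm, pow_add, Module.End.mul_apply, hK, map_zero]
  rw [g.expN_two_pi_I_mul hK']
  have h1 : g.unipotentPart ^ n = ((g.unipotentPart - 1) + 1) ^ n := by rw [sub_add_cancel]
  rw [h1, (Commute.one_right (g.unipotentPart - 1)).add_pow, LinearMap.sum_apply]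
  refine (Finset.sum_subset (s₁ := Finset.range (n + 1))
    (Finset.range_subset_range.2 (by omega)) ?_).symm.trans ?_
  · intro j _ hj
    rw [Ring.choose_natCast, Nat.choose_eq_zero_of_lt (by simpa using hj), Nat.cast_zero, zero_smul]
  · refine Finset.sum_congr rfl fun j _ => ?_
    rw [Ring.choose_natCast, one_pow, mul_one, ← nsmul_eq_mul', LinearMap.smul_apply,
      Nat.cast_smul_eq_nsmul]

theorem expN_mem_polyFun (c : ℂ) (u : V) : (fun t => g.expN (c * t) u) ∈ polyFun V := by
  obtain ⟨K, hK⟩ := g.exists_𝒩_pow_eq_zero u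
  simp only [g.expN_eq_sum hK]
  refine sum_mem_polyFun _ fun k _ => ?_
  have := pow_smul_mem_polyFun k (((k.factorial : ℂ)⁻¹ * c ^ k) • (g.𝒩 ^ k) u)
  refine (congrArg (· ∈ polyFun V) (funext fun t => ?_)).mp this
  rw [smul_smul, mul_pow]
  congr 1
  ring

/-- `𝒩` is a derivation, in exponential form. For `x ∈ 2πi ℕ` the operator `e^(x𝒩)` is a power of
`g_u`, and both sides are polynomials in `x`. -/
theorem expN_mode (x : ℂ) (u v : V) (n : ℤ) :
    g.expN x (A.mode u n v) = A.mode (g.expN x u) n (g.expN x v) := by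
  have hpi : (2 * Real.pi * Complex.I : ℂ) ≠ 0 := Complex.two_pi_I_ne_zero
  have h : ∀ t : ℂ, g.expN (2 * Real.pi * Complex.I * t) (A.mode u n v)
      = A.mode (g.expN (2 * Real.pi * Complex.I * t) u) n
          (g.expN (2 * Real.pi * Complex.I * t) v) := by
    refine polyFun_eq_of_natCast (g.expN_mem_polyFun _ _) ?_ fun k => ?_
    · obtain ⟨K, hK⟩ := g.exists_𝒩_pow_eq_zero u
      obtain ⟨L, hL⟩ := g.exists_𝒩_pow_eq_zero v
      simp only [g.expN_eq_sum hK, g.expN_eq_sum hL, mode_sum_left, map_sum]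
      refine sum_mem_polyFun _ fun j _ => sum_mem_polyFun _ fun i _ => ?_
      have := pow_smul_mem_polyFun (i + j) (((i.factorial : ℂ)⁻¹ * (j.factorial : ℂ)⁻¹ *
        (2 * Real.pi * Complex.I) ^ (i + j)) • A.mode ((g.𝒩 ^ i) u) n ((g.𝒩 ^ j) v))
      refine (congrArg (· ∈ polyFun V) (funext fun t => ?_)).mp this
      rw [map_smul, mode_smul_left, smul_smul, smul_smul]
      congr 1
      rw [mul_pow, mul_pow, pow_add, pow_add]
      ring
    · simp only [g.expN_two_pi_I_mul_natCast]
      induction k with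
      | zero => simp
      | succ k ih =>
        rw [pow_succ', Module.End.mul_apply, ih, unipotentPart_mode, Module.End.mul_apply,
          Module.End.mul_apply]
  have := h (x / (2 * Real.pi * Complex.I))
  rwa [mul_div_cancel₀ _ hpi] at this

end Automorphism

end VertexOperatorAlgebra

open scoped Classical

/-! ### Branches of the logarithm -/

theorem lp_eq (p : ℤ) (z : ℂ) : lp p z = lp 0 z + 2 * Real.pi * Complex.I * p := by
  simp only [lp]
  push_cast
  ring

theorem lp_add_one (p : ℤ) (z : ℂ) : lp (p + 1) z = lp p z + 2 * Real.pi * Complex.I := by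
  rw [lp_eq (p + 1), lp_eq p]
  push_cast
  ring

theorem exists_lp_zero_eq (z : ℂ) :
    ∃ k : ℤ, lp 0 z = Complex.log z + 2 * Real.pi * Complex.I * k := by
  unfold lp arg₀ Complex.log
  split_ifs
  · exact ⟨0, by push_cast; ring⟩
  · exact ⟨1, by push_cast; ring⟩

theorem exp_two_pi_I_mul_intCast (n : ℤ) : Complex.exp (2 * Real.pi * Complex.I * n) = 1 := by
  rw [mul_comm]
  exact Complex.exp_int_mul_two_pi_mul_I n

theorem exp_lp (p : ℤ) {z : ℂ} (hz : z ≠ 0) : Complex.exp (lp p z) = z := by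
  obtain ⟨k, hk⟩ := exists_lp_zero_eq z
  rw [lp_eq, hk, Complex.exp_add, Complex.exp_add, Complex.exp_log hz, exp_two_pi_I_mul_intCast,
    exp_two_pi_I_mul_intCast, mul_one, mul_one]

theorem exists_lp_exp (ℓ : ℂ) : ∃ p : ℤ, lp p (Complex.exp ℓ) = ℓ := by
  have h := exp_lp 0 (Complex.exp_ne_zero ℓ)
  obtain ⟨n, hn⟩ := Complex.exp_eq_exp_iff_exists_int.1 h
  refine ⟨-n, ?_⟩
  rw [lp_eq, hn]
  push_cast
  ring

theorem lp_zero_ofReal_exp (ℓ : ℝ) : lp 0 (Complex.exp ℓ) = ℓ := by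
  have harg : (Complex.exp (ℓ : ℂ)).arg = 0 := by
    rw [← Complex.ofReal_exp]
    exact Complex.arg_ofReal_of_nonneg (Real.exp_pos ℓ).le
  have hnorm : ‖Complex.exp (ℓ : ℂ)‖ = Real.exp ℓ := by
    rw [← Complex.ofReal_exp, Complex.norm_real, Real.norm_of_nonneg (Real.exp_pos _).le]
  simp [lp, arg₀, harg, hnorm]

theorem arg₀_ofReal_exp (ℓ : ℝ) : arg₀ (Complex.exp ℓ) = 0 := by
  have harg : (Complex.exp (ℓ : ℂ)).arg = 0 := by
    rw [← Complex.ofReal_exp]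
    exact Complex.arg_ofReal_of_nonneg (Real.exp_pos ℓ).le
  simp [arg₀, harg]

theorem lp_zero_one : lp 0 1 = 0 := by
  have := lp_zero_ofReal_exp 0
  simpa using this

theorem arg₀_one : arg₀ 1 = 0 := by
  have := arg₀_ofReal_exp 0
  simpa using this

/-- On the region where the arguments are close, the difference of the chosen logarithms is the
principal logarithm of the quotient. -/
theorem lp_sub_lp (p : ℤ) {z₁ z₂ : ℂ} (h₁ : z₁ ≠ 0) (h₂ : z₂ ≠ 0)
    (h : |arg₀ z₁ - arg₀ z₂| < Real.pi / 2) :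
    lp p z₁ - lp p z₂ = Complex.log (z₁ / z₂) := by
  have him : (lp p z₁ - lp p z₂).im = arg₀ z₁ - arg₀ z₂ := by
    simp [lp, Complex.sub_im, Complex.add_im, Complex.mul_im]
  have hexp : Complex.exp (lp p z₁ - lp p z₂) = z₁ / z₂ := by
    rw [Complex.exp_sub, exp_lp p h₁, exp_lp p h₂]
  rw [abs_lt] at h
  rw [← hexp, Complex.log_exp]
  · rw [him]; linarith [Real.pi_pos]
  · rw [him]; linarith [Real.pi_pos]

/-! ### The grading of the module -/

section Grading

variable {W : Type*} [AddCommGroup W] [Module ℂ W]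
  {comp : RightHalfPlane → CModZ → Submodule ℂ W}

theorem le_degSpace (i : RightHalfPlane × CModZ) : bigraded comp i ≤ degSpace comp i.1 :=
  le_iSup_of_le i.1 (le_iSup_of_le rfl (le_iSup_of_le i.2 le_rfl))

theorem degSpace_le {q : ℂ} {S : Submodule ℂ W}
    (hS : ∀ i : RightHalfPlane × CModZ, (i.1 : ℂ) = q → bigraded comp i ≤ S) :
    degSpace comp q ≤ S :=
  iSup_le fun n => iSup_le fun hn => iSup_le fun α => hS (n, α) hn

theorem degProj_of_mem (h : DirectSum.IsInternal (bigraded comp)) {p : ℂ} (q : ℂ) {x : W}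
    (hx : x ∈ degSpace comp p) :
    degProj comp h q x = if p = q then x else 0 := by
  have hle : degSpace comp p ≤ LinearMap.eqLocus (degProj comp h q)
      (if p = q then LinearMap.id else 0) := by
    refine degSpace_le fun i hi x hx => ?_
    rw [LinearMap.mem_eqLocus, degProj, gradedProj_of_mem _ h _ hx, hi]
    split_ifs <;> rfl
  have := hle hx
  rw [LinearMap.mem_eqLocus] at this
  rw [this]
  split_ifs <;> rfl

theorem degProj_mem (h : DirectSum.IsInternal (bigraded comp)) (q : ℂ) (x : W) :
    degProj comp h q x ∈ degSpace comp q := by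
  have hx : x ∈ ⨆ i, bigraded comp i := by
    rw [h.submodule_iSup_eq_top]; trivial
  induction hx using Submodule.iSup_induction' with
  | mem i x hx =>
    rw [degProj_of_mem h q (le_degSpace i hx)]
    split_ifs with heq
    · rw [← heq]
      exact le_degSpace i hx
    · exact Submodule.zero_mem _
  | zero => rw [map_zero]; exact Submodule.zero_mem _
  | add x y _ _ hx hy => rw [map_add]; exact Submodule.add_mem _ hx hy

theorem degSpace_induction (h : DirectSum.IsInternal (bigraded comp)) {Q : W → Prop}
    (hom : ∀ p, ∀ w ∈ degSpace comp p, Q w)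
    (zero : Q 0) (add : ∀ x y, Q x → Q y → Q (x + y)) (w : W) : Q w := by
  have hx : w ∈ ⨆ i, bigraded comp i := by
    rw [h.submodule_iSup_eq_top]; trivial
  induction hx using Submodule.iSup_induction' with
  | mem i x hx => exact hom _ x (le_degSpace i hx)
  | zero => exact zero
  | add x y _ _ hx hy => exact add x y hx hy

end Grading

/-! ### Substitution in logarithmic series -/

section Subst

variable {W : Type*} [AddCommGroup W] [Module ℂ W]

/-- Substitution as a linear map. -/
def substL (ℓ s : ℂ) : LogSeries W →ₗ[ℂ] W where
  toFun f := f.subst ℓ s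
  map_add' f g := by
    unfold LogSeries.subst
    exact Finsupp.sum_add_index' (by simp) (by intros; rw [Pi.add_apply, smul_add])
  map_smul' c f := by
    unfold LogSeries.subst
    rw [Finsupp.sum_smul_index' (by simp), RingHom.id_apply, Finsupp.smul_sum]
    exact Finsupp.sum_congr fun k _ => by rw [Pi.smul_apply, smul_comm]

theorem substL_apply (ℓ s : ℂ) (f : LogSeries W) :
    (substL ℓ s : LogSeries W →ₗ[ℂ] W) f = f.subst ℓ s := rfl

theorem subst_mem {S : Submodule ℂ W} {f : LogSeries W} {s : ℂ} (h : ∀ k, f k s ∈ S) (ℓ : ℂ) :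
    f.subst ℓ s ∈ S :=
  S.sum_mem fun k _ => S.smul_mem _ (h k)

theorem subst_single_zero (c : ℂ → W) (ℓ s : ℂ) :
    LogSeries.subst (Finsupp.single 0 c) ℓ s = Complex.exp (s * ℓ) • c s := by
  unfold LogSeries.subst
  rw [Finsupp.sum_single_index (by simp), pow_zero, mul_one]

end Subst

/-! ### Graded maps and their values in the algebraic completion -/

namespace PreTwistedModule

variable {V : Type*} [AddCommGroup V] [Module ℂ V] {A : VertexOperatorAlgebra V}
  {g : A.Automorphism} {W : Type*} [AddCommGroup W] [Module ℂ W] (M : PreTwistedModule A g W)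

/-- A map `V ⊗ W → W{x}[log x]` that has the grading property of a twisted vertex operator map. -/
def IsGraded (Y : V →ₗ[ℂ] W →ₗ[ℂ] LogSeries W) : Prop :=
  ∀ (m : ℤ) (p : ℂ), ∀ v ∈ A.wt m, ∀ w ∈ degSpace M.comp p, ∀ (k : ℕ) (s : ℂ),
    Y v w k s ∈ degSpace M.comp (m + s + p)

theorem isGraded_Yg : M.IsGraded M.Yg := by
  intro m p v hv w hw k s
  have := M.grading m p v hv w hw (-s - 1) k
  rwa [show -(-s - 1) - 1 = s by ring, show (m : ℂ) - (-s - 1) - 1 + p = m + s + p by ring] at this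

theorem Y₀_apply (v : V) (w : W) : M.Y₀ v w = Finsupp.single 0 (M.Yg v w 0) := rfl

theorem isGraded_Y₀ : M.IsGraded M.Y₀ := by
  intro m p v hv w hw k s
  rw [Y₀_apply, Finsupp.single_apply]
  split_ifs
  · exact M.isGraded_Yg m p v hv w hw 0 s
  · exact Submodule.zero_mem _

theorem subst_Y₀ (v : V) (w : W) (ℓ s : ℂ) :
    (M.Y₀ v w).subst ℓ s = Complex.exp (s * ℓ) • M.coef₀ v s w := by
  rw [Y₀_apply, subst_single_zero]
  rfl

section Eval

variable {Y : V →ₗ[ℂ] W →ₗ[ℂ] LogSeries W}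

/-- The value of `Y(v, x)w` at `x = e^ℓ` in degree `q`, for homogeneous `v` and `w`. -/
theorem evalAt_of_mem (hY : M.IsGraded Y) {m : ℤ} {p : ℂ} {v : V} (hv : v ∈ A.wt m) {w : W}
    (hw : w ∈ degSpace M.comp p) (ℓ q : ℂ) :
    evalAt M.comp M.internal Y v ℓ w q = (Y v w).subst ℓ (q - m - p) := by
  have h : ∀ s, degProj M.comp M.internal q ((Y v w).subst ℓ s)
      = if m + s + p = q then (Y v w).subst ℓ s else 0 := fun s =>
    degProj_of_mem M.internal q (subst_mem (fun k => hY m p v hv w hw k s) ℓ)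
  unfold evalAt
  rw [finsum_eq_single _ (q - m - p)]
  · rw [h, if_pos (by ring)]
  · intro s hs
    rw [h, if_neg]
    intro heq
    exact hs (by rw [← heq]; ring)

theorem evalAt_support_finite (hY : M.IsGraded Y) (ℓ q : ℂ) (v : V) (w : W) :
    (Function.support fun s => degProj M.comp M.internal q ((Y v w).subst ℓ s)).Finite := by
  have hv : v ∈ ⨆ n, A.wt n := by
    rw [A.iSup_wt]; trivial
  induction hv using Submodule.iSup_induction' with
  | mem m v hv =>
    refine degSpace_induction M.internal (Q := fun w => (Function.support fun s =>
      degProj M.comp M.internal q ((Y v w).subst ℓ s)).Finite) ?_ ?_ ?_ w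
    · intro p w hw
      refine (Set.finite_singleton (q - m - p)).subset fun s hs => ?_
      by_contra hne
      refine hs ?_
      simp only
      rw [degProj_of_mem M.internal q (subst_mem (fun k => hY m p v hv w hw k s) ℓ), if_neg]
      intro heq
      exact hne (by rw [Set.mem_singleton_iff, ← heq]; ring)
    · simp only [map_zero, ← substL_apply]
      simp
    · intro x y hx hy
      refine (hx.union hy).subset fun s hs => ?_
      by_contra hne
      rw [Set.mem_union, not_or, Function.notMem_support, Function.notMem_support] at hne
      refine hs ?_
      simp only [map_add, ← substL_apply] at hne ⊢
      rw [hne.1, hne.2, add_zero]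
  | zero =>
    simp only [map_zero, LinearMap.zero_apply, ← substL_apply]
    simp
  | add x y _ _ hx hy =>
    refine (hx.union hy).subset fun s hs => ?_
    by_contra hne
    rw [Set.mem_union, not_or, Function.notMem_support, Function.notMem_support] at hne
    refine hs ?_
    simp only [map_add, LinearMap.add_apply, ← substL_apply] at hne ⊢
    rw [hne.1, hne.2, add_zero]

/-- The component of degree `q` of `Y(v, x)w` at `x = e^ℓ` as a bilinear map. -/
def evalL (hY : M.IsGraded Y) (ℓ q : ℂ) : V →ₗ[ℂ] W →ₗ[ℂ] W :=
  LinearMap.mk₂ ℂ (fun v w => evalAt M.comp M.internal Y v ℓ w q)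
    (fun v v' w => by
      unfold evalAt
      rw [← finsum_add_distrib (M.evalAt_support_finite hY ℓ q v w)
        (M.evalAt_support_finite hY ℓ q v' w)]
      exact finsum_congr fun s => by
        rw [map_add, LinearMap.add_apply, ← substL_apply, map_add, map_add]; rfl)
    (fun c v w => by
      unfold evalAt
      rw [smul_finsum' c (M.evalAt_support_finite hY ℓ q v w)]
      exact finsum_congr fun s => by
        rw [map_smul, LinearMap.smul_apply, ← substL_apply, map_smul, map_smul]; rfl)
    (fun v w w' => by
      unfold evalAt
      rw [← finsum_add_distrib (M.evalAt_support_finite hY ℓ q v w)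
        (M.evalAt_support_finite hY ℓ q v w')]
      exact finsum_congr fun s => by
        rw [map_add, ← substL_apply, map_add, map_add]; rfl)
    (fun c v w => by
      unfold evalAt
      rw [smul_finsum' c (M.evalAt_support_finite hY ℓ q v w)]
      exact finsum_congr fun s => by
        rw [map_smul, ← substL_apply, map_smul, map_smul]; rfl)

theorem evalL_apply (hY : M.IsGraded Y) (ℓ q : ℂ) (v : V) (w : W) :
    M.evalL hY ℓ q v w = evalAt M.comp M.internal Y v ℓ w q := rfl

theorem evalAt_mem (v : V) (ℓ : ℂ) (w : W) (q : ℂ) :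
    evalAt M.comp M.internal Y v ℓ w q ∈ degSpace M.comp q :=
  finsum_induction (· ∈ degSpace M.comp q) (Submodule.zero_mem _)
    (fun _ _ => Submodule.add_mem _) fun _ => degProj_mem M.internal q _

end Eval

/-! ### The pairing with the graded dual -/

/-- The functional on `W` given by an element of the dual of one bihomogeneous component. -/
def homDual (i : RightHalfPlane × CModZ) (φ : Module.Dual ℂ (bigraded M.comp i)) : M.GradedDual :=
  DirectSum.lof ℂ (RightHalfPlane × CModZ) (fun i => Module.Dual ℂ (bigraded M.comp i)) i φ

theorem pairing_homDual (i : RightHalfPlane × CModZ) (φ : Module.Dual ℂ (bigraded M.comp i))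
    (x : W) : M.pairing (M.homDual i φ) x = φ (DirectSum.component ℂ _ _ i
      (decompose (bigraded M.comp) M.internal x)) := by
  unfold pairing homDual
  rw [DirectSum.toModule_lof]
  rfl

theorem pairing_homDual_of_mem (i : RightHalfPlane × CModZ)
    (φ : Module.Dual ℂ (bigraded M.comp i)) {p : ℂ} (hp : (i.1 : ℂ) ≠ p) {x : W}
    (hx : x ∈ degSpace M.comp p) : M.pairing (M.homDual i φ) x = 0 := by
  have hle : degSpace M.comp p ≤ LinearMap.ker (M.pairing (M.homDual i φ)) := by
    refine degSpace_le fun j hj x hx => ?_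
    rw [LinearMap.mem_ker, pairing_homDual, decompose_of_mem _ _ hx,
      DirectSum.component.of, dif_neg, map_zero]
    rintro rfl
    exact hp hj
  exact hle hx

/-- The homogeneous elements of `W'` separate the points of `W`. -/
theorem eq_zero_of_pairing {x : W} (h : ∀ i φ, M.pairing (M.homDual i φ) x = 0) : x = 0 := by
  have : decompose (bigraded M.comp) M.internal x = 0 := by
    refine DFinsupp.ext fun i => ?_
    change DirectSum.component ℂ _ _ i (decompose (bigraded M.comp) M.internal x) = 0
    rw [← Module.forall_dual_apply_eq_zero_iff ℂ]
    intro φ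
    rw [← pairing_homDual, h]
  exact (LinearEquiv.map_eq_zero_iff _).1 this

theorem gradedDual_induction {Q : M.GradedDual → Prop} (hom : ∀ i φ, Q (M.homDual i φ))
    (zero : Q 0) (add : ∀ x y, Q x → Q y → Q (x + y)) (w' : M.GradedDual) : Q w' := by
  induction w' using DirectSum.induction_on with
  | zero => exact zero
  | of i φ => exact hom i φ
  | add x y hx hy => exact add x y hx hy

theorem pairCompletion_support_finite (w' : M.GradedDual) {y : ℂ → W}
    (hy : ∀ q, y q ∈ degSpace M.comp q) :
    (Function.support fun q => M.pairing w' (y q)).Finite := by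
  refine M.gradedDual_induction (Q := fun w' =>
    (Function.support fun q => M.pairing w' (y q)).Finite) ?_ ?_ ?_ w'
  · intro i φ
    refine (Set.finite_singleton (i.1 : ℂ)).subset fun q hq => ?_
    by_contra hne
    exact hq (M.pairing_homDual_of_mem i φ (fun h => hne h.symm) (hy q))
  · simp
  · intro a b ha hb
    refine (ha.union hb).subset fun s hs => ?_
    by_contra hne
    rw [Set.mem_union, not_or, Function.notMem_support, Function.notMem_support] at hne
    refine hs ?_
    simp only [map_add, LinearMap.add_apply]
    rw [hne.1, hne.2, add_zero]

theorem pairCompletion_add (w' w'' : M.GradedDual) {y : ℂ → W}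
    (hy : ∀ q, y q ∈ degSpace M.comp q) :
    M.pairCompletion (w' + w'') y = M.pairCompletion w' y + M.pairCompletion w'' y := by
  unfold pairCompletion
  rw [← finsum_add_distrib (M.pairCompletion_support_finite w' hy)
    (M.pairCompletion_support_finite w'' hy)]
  simp

theorem pairCompletion_zero (y : ℂ → W) : M.pairCompletion 0 y = 0 := by
  simp [pairCompletion]

theorem pairCompletion_homDual (i : RightHalfPlane × CModZ)
    (φ : Module.Dual ℂ (bigraded M.comp i)) {y : ℂ → W} (hy : ∀ q, y q ∈ degSpace M.comp q) :
    M.pairCompletion (M.homDual i φ) y = M.pairing (M.homDual i φ) (y i.1) :=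
  finsum_eq_single _ _ fun q hq =>
    M.pairing_homDual_of_mem i φ (fun h => hq h.symm) (hy q)

/-! ### Consequences of equivariance -/

/-- The polynomial in `log x` that is the coefficient of `x^s` in `⟨f, Y^g(v, x)w⟩`. -/
def logPolynomial (f : Module.Dual ℂ W) (v : V) (w : W) (s : ℂ) : Polynomial ℂ :=
  (M.Yg v w).sum fun k c => Polynomial.monomial k (f (c s))

theorem coeff_logPolynomial (f : Module.Dual ℂ W) (v : V) (w : W) (s : ℂ) (k : ℕ) :
    (M.logPolynomial f v w s).coeff k = f (M.Yg v w k s) := by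
  rw [logPolynomial, Finsupp.sum, Polynomial.finsetSum_coeff]
  simp only [Polynomial.coeff_monomial]
  rw [Finset.sum_ite_eq' (M.Yg v w).support k]
  split_ifs with h
  · rfl
  · rw [Finsupp.notMem_support_iff.1 h]
    simp

theorem exp_mul_eval_logPolynomial (f : Module.Dual ℂ W) (v : V) (w : W) (s ℓ : ℂ) :
    Complex.exp (s * ℓ) * (M.logPolynomial f v w s).eval ℓ = f ((M.Yg v w).subst ℓ s) := by
  rw [logPolynomial, LogSeries.subst, Finsupp.sum, Finsupp.sum, Polynomial.eval_finsetSum, map_sum,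
    Finset.mul_sum]
  refine Finset.sum_congr rfl fun k _ => ?_
  rw [Polynomial.eval_monomial, map_smul, smul_eq_mul]
  ring

theorem logPolynomial_add (f : Module.Dual ℂ W) (v v' : V) (w : W) (s : ℂ) :
    M.logPolynomial f (v + v') w s = M.logPolynomial f v w s + M.logPolynomial f v' w s := by
  ext k
  simp [coeff_logPolynomial]

theorem logPolynomial_smul (f : Module.Dual ℂ W) (c : ℂ) (v : V) (w : W) (s : ℂ) :
    M.logPolynomial f (c • v) w s = c • M.logPolynomial f v w s := by
  ext k
  simp [coeff_logPolynomial]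

theorem logPolynomial_sum {ι : Type*} (t : Finset ι) (f : Module.Dual ℂ W) (v : ι → V) (w : W)
    (s : ℂ) : M.logPolynomial f (∑ i ∈ t, v i) w s = ∑ i ∈ t, M.logPolynomial f (v i) w s := by
  ext k
  rw [Polynomial.finsetSum_coeff]
  simp [coeff_logPolynomial, Finset.sum_apply, Finsupp.finsetSum_apply]

/-- Equivariance for the individual powers of `x`: the change of branch replaces `log x` by
`log x + 2πi`. -/
theorem subst_equivariance (v : V) (w : W) (ℓ s : ℂ) :
    (M.Yg (g.toEnd v) w).subst (ℓ + 2 * Real.pi * Complex.I) s = (M.Yg v w).subst ℓ s := by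
  have hv : v ∈ ⨆ n, A.wt n := by
    rw [A.iSup_wt]; trivial
  induction hv using Submodule.iSup_induction' with
  | mem m v hv =>
    refine degSpace_induction M.internal (Q := fun w => (M.Yg (g.toEnd v) w).subst
      (ℓ + 2 * Real.pi * Complex.I) s = (M.Yg v w).subst ℓ s) ?_ ?_ ?_ w
    · intro p w hw
      obtain ⟨r, hr⟩ := exists_lp_exp ℓ
      have h := congrFun (M.equivariance r _ (Complex.exp_ne_zero ℓ) v w) (s + m + p)
      have hgv : g.toEnd v ∈ A.wt m :=
        Module.End.mapsTo_genEigenspace_of_comm g.commute_L_zero.symm _ _ hv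
      rw [M.evalAt_of_mem M.isGraded_Yg hgv hw, M.evalAt_of_mem M.isGraded_Yg hv hw, lp_add_one, hr,
        show s + m + p - m - p = s by ring] at h
      exact h
    · simp only [map_zero, ← substL_apply]
    · intro x y hx hy
      simp only [map_add, ← substL_apply] at hx hy ⊢
      rw [hx, hy]
  | zero => simp only [map_zero, LinearMap.zero_apply, ← substL_apply]
  | add x y _ _ hx hy =>
    simp only [map_add, LinearMap.add_apply, ← substL_apply] at hx hy ⊢
    rw [hx, hy]

theorem eval_logPolynomial_equivariance (f : Module.Dual ℂ W) (v : V) (w : W) (s ℓ : ℂ) :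
    Complex.exp (2 * Real.pi * Complex.I * s) *
      (M.logPolynomial f (g.toEnd v) w s).eval (ℓ + 2 * Real.pi * Complex.I)
      = (M.logPolynomial f v w s).eval ℓ := by
  have h := congrArg f (M.subst_equivariance v w ℓ s)
  rw [← exp_mul_eval_logPolynomial, ← exp_mul_eval_logPolynomial, mul_add, Complex.exp_add,
    mul_assoc] at h
  have := mul_left_cancel₀ (Complex.exp_ne_zero _) h
  rw [← this, mul_comm s]

/-- A polynomial that is multiplied by a constant other than `1` under a translation is zero, as is
seen from its leading coefficient. -/
theorem eq_zero_of_periodic {p : Polynomial ℂ} {ρ c : ℂ} (hρ : ρ ≠ 1)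
    (h : ∀ ℓ, ρ * p.eval (ℓ + c) = p.eval ℓ) : p = 0 := by
  have hpoly : Polynomial.C ρ * p.comp (Polynomial.X + Polynomial.C c) = p :=
    Polynomial.funext fun ℓ => by simp [h]
  have hlc : ρ * p.leadingCoeff = p.leadingCoeff := by
    conv_rhs => rw [← hpoly]
    rw [Polynomial.leadingCoeff_mul, Polynomial.leadingCoeff_C,
      Polynomial.leadingCoeff_comp (by simp)]
    simp
  rw [← Polynomial.leadingCoeff_eq_zero]
  have : (ρ - 1) * p.leadingCoeff = 0 := by linear_combination hlc
  exact (mul_eq_zero.1 this).resolve_left (sub_ne_zero.2 hρ)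

/-- On `V^[a+ℤ]` only powers `x^s` with `s ∈ -a + ℤ` occur in `Y^g`, since otherwise equivariance
multiplies the polynomials in `log x` by a constant other than `1` under `log x ↦ log x + 2πi`. -/
theorem Yg_eq_zero {a s : ℂ} (hs : ∀ k : ℤ, s ≠ -a + k) {v : V} (hv : v ∈ g.genEigen a) (w : W)
    (k : ℕ) : M.Yg v w k s = 0 := by
  obtain ⟨N, hN⟩ := (Module.End.mem_maxGenEigenspace _ _ _).1 hv
  clear hv
  induction N generalizing v k with
  | zero =>
    rw [pow_zero, Module.End.one_apply] at hN
    rw [hN, map_zero]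
    rfl
  | succ N ih =>
    rw [pow_succ, Module.End.mul_apply] at hN
    set μ := Complex.exp (2 * Real.pi * Complex.I * a) with hμ
    have hgv : g.toEnd v = (g.toEnd - μ • 1) v + μ • v := by simp
    rw [← Module.forall_dual_apply_eq_zero_iff ℂ]
    intro f
    have hzero : M.logPolynomial f ((g.toEnd - μ • 1) v) w s = 0 := by
      ext j
      rw [coeff_logPolynomial, ih j hN]
      simp
    have hP : M.logPolynomial f v w s = 0 := by
      refine eq_zero_of_periodic (ρ := Complex.exp (2 * Real.pi * Complex.I * s) * μ)
        (c := 2 * Real.pi * Complex.I) ?_ fun ℓ => ?_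
      · intro h1
        rw [hμ, ← Complex.exp_add, Complex.exp_eq_one_iff] at h1
        obtain ⟨n, hn⟩ := h1
        refine hs n ?_
        have hpi : (2 * Real.pi * Complex.I : ℂ) ≠ 0 := Complex.two_pi_I_ne_zero
        have : (2 * Real.pi * Complex.I : ℂ) * (s - (-a + n)) = 0 := by linear_combination hn
        exact sub_eq_zero.1 ((mul_eq_zero.1 this).resolve_left hpi)
      · have := M.eval_logPolynomial_equivariance f v w s ℓ
        rw [hgv, logPolynomial_add, hzero, zero_add, logPolynomial_smul,
          Polynomial.eval_smul, smul_eq_mul] at this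
        rw [← this]
        ring
    rw [← coeff_logPolynomial, hP, Polynomial.coeff_zero]

theorem coef₀_eq_zero {a s : ℂ} (hs : ∀ k : ℤ, s ≠ -a + k) {v : V} (hv : v ∈ g.genEigen a)
    (w : W) : M.coef₀ v s w = 0 := M.Yg_eq_zero hs hv w 0

/-- The identity `Y^g(v, x) = Y^g_0(x^(-𝒩) v, x)`, for the component of `x^s` with `log x = ℓ`. -/
theorem subst_Yg {a : ℂ} {v : V} (hv : v ∈ g.genEigen a) (w : W) (ℓ s : ℂ) :
    (M.Yg v w).subst ℓ s = Complex.exp (s * ℓ) • M.coef₀ (g.expN (-ℓ) v) s w := by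
  by_cases hs : ∃ k : ℤ, s = -a + k
  · rw [← sub_eq_zero, ← Module.forall_dual_apply_eq_zero_iff ℂ]
    intro f
    rw [map_sub, sub_eq_zero, ← exp_mul_eval_logPolynomial, map_smul, smul_eq_mul]
    congr 1
    have hstep : ∀ u ∈ g.genEigen a, ∀ ℓ, (M.logPolynomial f (g.unipotentPart u) w s).eval
        (ℓ + 2 * Real.pi * Complex.I) = (M.logPolynomial f u w s).eval ℓ := by
      intro u hu ℓ
      rw [← M.eval_logPolynomial_equivariance f u w s ℓ, g.unipotentPart_apply hu,
        logPolynomial_smul, Polynomial.eval_smul, smul_eq_mul, ← Complex.exp_neg]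
      congr 1
      obtain ⟨k, rfl⟩ := hs
      rw [mul_add, Complex.exp_add, exp_two_pi_I_mul_intCast, mul_one, mul_neg]
    have hpow : ∀ n : ℕ, (M.logPolynomial f ((g.unipotentPart ^ n) v) w s).eval
        (ℓ + 2 * Real.pi * Complex.I * n) = (M.logPolynomial f v w s).eval ℓ ∧
        (g.unipotentPart ^ n) v ∈ g.genEigen a := by
      intro n
      induction n with
      | zero => exact ⟨by simp, by simpa using hv⟩
      | succ n ih =>
        rw [pow_succ', Module.End.mul_apply]
        refine ⟨?_, g.unipotentPart_mem_genEigen ih.2⟩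
        rw [← ih.1, ← hstep _ ih.2]
        congr 1
        push_cast
        ring
    obtain ⟨K, hK⟩ := g.exists_𝒩_pow_eq_zero v
    -- `p(t)` is the coefficient of `x^s` in `⟨f, Y^g(e^(2πi t 𝒩) v, x)w⟩` at `log x = ℓ + 2πi t`.
    -- By equivariance it is constant on `ℕ`, hence constant, and `t = -ℓ/(2πi)` gives `log x = 0`.
    set p : Polynomial ℂ := ∑ k ∈ Finset.range K,
      Polynomial.C ((k.factorial : ℂ)⁻¹ * (2 * Real.pi * Complex.I) ^ k) * Polynomial.X ^ k *
        (M.logPolynomial f ((g.𝒩 ^ k) v) w s).comp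
          (Polynomial.C ℓ + Polynomial.C (2 * Real.pi * Complex.I) * Polynomial.X) with hp
    have hpe : ∀ t, p.eval t = (M.logPolynomial f (g.expN (2 * Real.pi * Complex.I * t) v) w s).eval
        (ℓ + 2 * Real.pi * Complex.I * t) := by
      intro t
      rw [g.expN_eq_sum hK, logPolynomial_sum, hp, Polynomial.eval_finsetSum,
        Polynomial.eval_finsetSum]
      refine Finset.sum_congr rfl fun k _ => ?_
      rw [logPolynomial_smul, Polynomial.eval_smul, smul_eq_mul]
      simp only [Polynomial.eval_mul, Polynomial.eval_pow, Polynomial.eval_X, Polynomial.eval_C,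
        Polynomial.eval_comp, Polynomial.eval_add]
      rw [mul_pow (2 * Real.pi * Complex.I), mul_assoc (k.factorial : ℂ)⁻¹]
    have hpc : p = Polynomial.C ((M.logPolynomial f v w s).eval ℓ) := by
      refine Polynomial.eq_of_infinite_eval_eq _ _ (Set.Infinite.mono ?_
        (Set.infinite_range_of_injective (Nat.cast_injective (R := ℂ))))
      rintro _ ⟨n, rfl⟩
      simp only [Set.mem_ofPred_eq]
      rw [hpe, g.expN_two_pi_I_mul_natCast, (hpow n).1, Polynomial.eval_C]
    have hpi : (2 * Real.pi * Complex.I : ℂ) ≠ 0 := Complex.two_pi_I_ne_zero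
    have h := hpe (-ℓ / (2 * Real.pi * Complex.I))
    rw [hpc, Polynomial.eval_C, mul_div_cancel₀ _ hpi, add_neg_cancel,
      ← Polynomial.coeff_zero_eq_eval_zero, coeff_logPolynomial] at h
    exact h
  · push Not at hs
    rw [M.coef₀_eq_zero hs (g.expN_mem (g.𝒩_pow_mem_genEigen hv) _), smul_zero]
    exact (Submodule.mem_bot ℂ).1 (subst_mem (fun k => (Submodule.mem_bot ℂ).2
      (M.Yg_eq_zero hs hv w k)) ℓ)

theorem evalAt_Yg {a : ℂ} {v : V} (hv : v ∈ g.genEigen a) (w : W) (ℓ : ℂ) :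
    evalAt M.comp M.internal M.Yg v ℓ w
      = evalAt M.comp M.internal M.Y₀ (g.expN (-ℓ) v) ℓ w := by
  funext q
  unfold evalAt
  refine finsum_congr fun s => ?_
  rw [M.subst_Yg hv, M.subst_Y₀]

end PreTwistedModule

/-! ### Vectors of the form `Y(u, z₀)v` in the algebraic completion -/

namespace VertexOperatorAlgebra

variable {V : Type*} [AddCommGroup V] [Module ℂ V] (A : VertexOperatorAlgebra V)

theorem iterVec_support_finite (z₀ : ℂ) (n : ℤ) (u v : V) :
    (Function.support fun m : ℤ => z₀ ^ (-m - 1) • A.proj n (A.mode u m v)).Finite := by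
  have hu : u ∈ ⨆ n, A.wt n := by
    rw [A.iSup_wt]; trivial
  have hv : v ∈ ⨆ n, A.wt n := by
    rw [A.iSup_wt]; trivial
  induction hu using Submodule.iSup_induction' with
  | mem i u hu =>
    induction hv using Submodule.iSup_induction' with
    | mem j v hv =>
      refine (Set.finite_singleton (i + j - n - 1)).subset fun m hm => ?_
      by_contra hne
      refine hm ?_
      simp only
      rw [A.proj_of_mem n (A.mode_mem_wt hu hv m), if_neg, smul_zero]
      intro h
      exact hne (by rw [Set.mem_singleton_iff]; omega)
    | zero => simp
    | add x y _ _ hx hy =>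
      refine (hx.union hy).subset fun s hs => ?_
      by_contra hne
      rw [Set.mem_union, not_or, Function.notMem_support, Function.notMem_support] at hne
      refine hs ?_
      simp only [map_add, smul_add]
      rw [hne.1, hne.2, add_zero]
  | zero => simp [mode_zero_left]
  | add x y _ _ hx hy =>
    refine (hx.union hy).subset fun s hs => ?_
    by_contra hne
    rw [Set.mem_union, not_or, Function.notMem_support, Function.notMem_support] at hne
    refine hs ?_
    simp only [mode_add_left, map_add, smul_add]
    rw [hne.1, hne.2, add_zero]

/-- The component of weight `n` of `Y(u, z₀)v`, as a bilinear map. -/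
def iterVec (z₀ : ℂ) (n : ℤ) : V →ₗ[ℂ] V →ₗ[ℂ] V :=
  LinearMap.mk₂ ℂ (fun u v => ∑ᶠ m : ℤ, z₀ ^ (-m - 1) • A.proj n (A.mode u m v))
    (fun u u' v => by
      rw [← finsum_add_distrib (A.iterVec_support_finite z₀ n u v)
        (A.iterVec_support_finite z₀ n u' v)]
      exact finsum_congr fun m => by rw [mode_add_left, map_add, smul_add])
    (fun c u v => by
      rw [smul_finsum' c (A.iterVec_support_finite z₀ n u v)]
      exact finsum_congr fun m => by rw [mode_smul_left, map_smul, smul_comm])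
    (fun u v v' => by
      rw [← finsum_add_distrib (A.iterVec_support_finite z₀ n u v)
        (A.iterVec_support_finite z₀ n u v')]
      exact finsum_congr fun m => by rw [map_add, map_add, smul_add])
    (fun c u v => by
      rw [smul_finsum' c (A.iterVec_support_finite z₀ n u v)]
      exact finsum_congr fun m => by rw [map_smul, map_smul, smul_comm])

theorem iterVec_apply (z₀ : ℂ) (n : ℤ) (u v : V) :
    A.iterVec z₀ n u v = ∑ᶠ m : ℤ, z₀ ^ (-m - 1) • A.proj n (A.mode u m v) := rfl

theorem iterVec_of_mem (z₀ : ℂ) {i j : ℤ} {u v : V} (hu : u ∈ A.wt i) (hv : v ∈ A.wt j) (m : ℤ) :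
    A.iterVec z₀ (i + j - m - 1) u v = z₀ ^ (-m - 1) • A.mode u m v := by
  rw [iterVec_apply, finsum_eq_single _ m]
  · rw [A.proj_of_mem _ (A.mode_mem_wt hu hv m), if_pos rfl]
  · intro m' hm'
    rw [A.proj_of_mem _ (A.mode_mem_wt hu hv m'), if_neg, smul_zero]
    omega

end VertexOperatorAlgebra

namespace PreTwistedModule

variable {V : Type*} [AddCommGroup V] [Module ℂ V] {A : VertexOperatorAlgebra V}
  {g : A.Automorphism} {W : Type*} [AddCommGroup W] [Module ℂ W] (M : PreTwistedModule A g W)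

/-! ### Multilinearity of the terms of the series -/

/-- The pairing of `W'` with the algebraic completion of `W`, as a bilinear map on the space of
all families `ℂ → W`. -/
def completionPairing : M.GradedDual →ₗ[ℂ] (ℂ → W) →ₗ[ℂ] ℂ :=
  DirectSum.toModule ℂ (RightHalfPlane × CModZ) _ fun i =>
    LinearMap.lcomp ℂ ℂ (LinearMap.proj (i.1 : ℂ)) ∘ₗ M.pairing ∘ₗ
      DirectSum.lof ℂ _ (fun i => Module.Dual ℂ (bigraded M.comp i)) i

theorem completionPairing_homDual (i : RightHalfPlane × CModZ)
    (φ : Module.Dual ℂ (bigraded M.comp i)) (y : ℂ → W) :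
    M.completionPairing (M.homDual i φ) y = M.pairing (M.homDual i φ) (y i.1) := by
  unfold completionPairing homDual
  rw [DirectSum.toModule_lof]
  rfl

theorem pairCompletion_eq (w' : M.GradedDual) {y : ℂ → W} (hy : ∀ q, y q ∈ degSpace M.comp q) :
    M.pairCompletion w' y = M.completionPairing w' y := by
  refine M.gradedDual_induction (Q := fun w' => M.pairCompletion w' y = M.completionPairing w' y)
    (fun i φ => ?_) ?_ (fun a b ha hb => ?_) w'
  · rw [M.pairCompletion_homDual i φ hy, completionPairing_homDual]
  · rw [pairCompletion_zero, map_zero]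
    rfl
  · rw [M.pairCompletion_add a b hy, ha, hb, map_add]
    rfl

section Terms

variable {Y : V →ₗ[ℂ] W →ₗ[ℂ] LogSeries W}

/-- The number `⟨w', Y(v, z)w⟩`, where `ℓ` is the value of `log z`, as a trilinear map. -/
def termL (hY : M.IsGraded Y) (ℓ : ℂ) : M.GradedDual →ₗ[ℂ] V →ₗ[ℂ] W →ₗ[ℂ] ℂ :=
  LinearMap.mk₂ ℂ (fun w' v => M.completionPairing w' ∘ₗ LinearMap.pi fun q => M.evalL hY ℓ q v)
    (fun _ _ _ => by ext; simp) (fun _ _ _ => by ext; simp)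
    (fun w' v v' => by
      ext w
      simp only [LinearMap.comp_apply, LinearMap.add_apply]
      rw [← map_add]
      congr 1
      funext q
      simp)
    (fun c w' v => by
      ext w
      simp only [LinearMap.comp_apply, LinearMap.smul_apply]
      rw [← map_smul]
      congr 1
      funext q
      simp)

theorem termL_apply (hY : M.IsGraded Y) (ℓ : ℂ) (w' : M.GradedDual) (v : V) (w : W) :
    M.termL hY ℓ w' v w = M.pairCompletion w' (evalAt M.comp M.internal Y v ℓ w) := by
  rw [M.pairCompletion_eq w' (M.evalAt_mem v ℓ w)]
  rfl

theorem productTerm_eq (hY : M.IsGraded Y) (w' : M.GradedDual) (u : V) (ℓ₁ : ℂ) (v : V)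
    (ℓ₂ : ℂ) (w : W) (n : ℂ) :
    M.productTerm Y w' u ℓ₁ v ℓ₂ w n = M.termL hY ℓ₁ w' u (M.evalL hY ℓ₂ n v w) := by
  rw [termL_apply]
  rfl

theorem iterateTerm_eq (hY : M.IsGraded Y) (w' : M.GradedDual) (u : V) (z₀ : ℂ) (v : V)
    (ℓ₂ : ℂ) (w : W) (n : ℤ) :
    M.iterateTerm Y w' u z₀ v ℓ₂ w n = M.termL hY ℓ₂ w' (A.iterVec z₀ n u v) w := by
  rw [termL_apply]
  rfl

theorem productTerm_add_dual (hY : M.IsGraded Y) (ℓ₁ ℓ₂ : ℂ)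
    (w' w'' : M.GradedDual) (u v : V) (w : W) (n : ℂ) :
    M.productTerm Y (w' + w'') u ℓ₁ v ℓ₂ w n
      = M.productTerm Y w' u ℓ₁ v ℓ₂ w n + M.productTerm Y w'' u ℓ₁ v ℓ₂ w n := by
  simp only [M.productTerm_eq hY, map_add, LinearMap.add_apply]

theorem productTerm_add₁ (hY : M.IsGraded Y) (ℓ₁ ℓ₂ : ℂ)
    (w' : M.GradedDual) (u u' v : V) (w : W) (n : ℂ) :
    M.productTerm Y w' (u + u') ℓ₁ v ℓ₂ w n
      = M.productTerm Y w' u ℓ₁ v ℓ₂ w n + M.productTerm Y w' u' ℓ₁ v ℓ₂ w n := by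
  simp only [M.productTerm_eq hY, map_add, LinearMap.add_apply]

theorem productTerm_add₂ (hY : M.IsGraded Y) (ℓ₁ ℓ₂ : ℂ)
    (w' : M.GradedDual) (u v v' : V) (w : W) (n : ℂ) :
    M.productTerm Y w' u ℓ₁ (v + v') ℓ₂ w n
      = M.productTerm Y w' u ℓ₁ v ℓ₂ w n + M.productTerm Y w' u ℓ₁ v' ℓ₂ w n := by
  simp only [M.productTerm_eq hY, map_add, LinearMap.add_apply]

theorem productTerm_add₃ (hY : M.IsGraded Y) (ℓ₁ ℓ₂ : ℂ)
    (w' : M.GradedDual) (u v : V) (w x : W) (n : ℂ) :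
    M.productTerm Y w' u ℓ₁ v ℓ₂ (w + x) n
      = M.productTerm Y w' u ℓ₁ v ℓ₂ w n + M.productTerm Y w' u ℓ₁ v ℓ₂ x n := by
  simp only [M.productTerm_eq hY, map_add]

theorem productTerm_sum₁ (hY : M.IsGraded Y) (ℓ₁ ℓ₂ : ℂ)
    {ι : Type*} (S : Finset ι) (c : ι → ℂ) (w' : M.GradedDual) (u : ι → V)
    (v : V) (w : W) (n : ℂ) :
    M.productTerm Y w' (∑ k ∈ S, c k • u k) ℓ₁ v ℓ₂ w n
      = ∑ k ∈ S, c k * M.productTerm Y w' (u k) ℓ₁ v ℓ₂ w n := by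
  simp only [M.productTerm_eq hY, map_sum, LinearMap.sum_apply, map_smul, LinearMap.smul_apply,
    smul_eq_mul]

theorem productTerm_sum₂ (hY : M.IsGraded Y) (ℓ₁ ℓ₂ : ℂ)
    {ι : Type*} (S : Finset ι) (c : ι → ℂ) (w' : M.GradedDual) (u : V)
    (v : ι → V) (w : W) (n : ℂ) :
    M.productTerm Y w' u ℓ₁ (∑ k ∈ S, c k • v k) ℓ₂ w n
      = ∑ k ∈ S, c k * M.productTerm Y w' u ℓ₁ (v k) ℓ₂ w n := by
  simp only [M.productTerm_eq hY, map_sum, LinearMap.sum_apply, map_smul, LinearMap.smul_apply,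
    smul_eq_mul]

theorem iterateTerm_add_dual (hY : M.IsGraded Y) (z₀ ℓ₂ : ℂ)
    (w' w'' : M.GradedDual) (u v : V) (w : W) (n : ℤ) :
    M.iterateTerm Y (w' + w'') u z₀ v ℓ₂ w n
      = M.iterateTerm Y w' u z₀ v ℓ₂ w n + M.iterateTerm Y w'' u z₀ v ℓ₂ w n := by
  simp only [M.iterateTerm_eq hY, map_add, LinearMap.add_apply]

theorem iterateTerm_add₁ (hY : M.IsGraded Y) (z₀ ℓ₂ : ℂ)
    (w' : M.GradedDual) (u u' v : V) (w : W) (n : ℤ) :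
    M.iterateTerm Y w' (u + u') z₀ v ℓ₂ w n
      = M.iterateTerm Y w' u z₀ v ℓ₂ w n + M.iterateTerm Y w' u' z₀ v ℓ₂ w n := by
  simp only [M.iterateTerm_eq hY, map_add, LinearMap.add_apply]

theorem iterateTerm_add₂ (hY : M.IsGraded Y) (z₀ ℓ₂ : ℂ)
    (w' : M.GradedDual) (u v v' : V) (w : W) (n : ℤ) :
    M.iterateTerm Y w' u z₀ (v + v') ℓ₂ w n
      = M.iterateTerm Y w' u z₀ v ℓ₂ w n + M.iterateTerm Y w' u z₀ v' ℓ₂ w n := by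
  simp only [M.iterateTerm_eq hY, map_add, LinearMap.add_apply]

theorem iterateTerm_add₃ (hY : M.IsGraded Y) (z₀ ℓ₂ : ℂ)
    (w' : M.GradedDual) (u v : V) (w x : W) (n : ℤ) :
    M.iterateTerm Y w' u z₀ v ℓ₂ (w + x) n
      = M.iterateTerm Y w' u z₀ v ℓ₂ w n + M.iterateTerm Y w' u z₀ v ℓ₂ x n := by
  simp only [M.iterateTerm_eq hY, map_add]

theorem iterateTerm_sum₁ (hY : M.IsGraded Y) (z₀ ℓ₂ : ℂ)
    {ι : Type*} (S : Finset ι) (c : ι → ℂ) (w' : M.GradedDual) (u : ι → V)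
    (v : V) (w : W) (n : ℤ) :
    M.iterateTerm Y w' (∑ k ∈ S, c k • u k) z₀ v ℓ₂ w n
      = ∑ k ∈ S, c k * M.iterateTerm Y w' (u k) z₀ v ℓ₂ w n := by
  simp only [M.iterateTerm_eq hY, map_sum, LinearMap.sum_apply, map_smul, LinearMap.smul_apply,
    smul_eq_mul]

theorem iterateTerm_sum₂ (hY : M.IsGraded Y) (z₀ ℓ₂ : ℂ)
    {ι : Type*} (S : Finset ι) (c : ι → ℂ) (w' : M.GradedDual) (u : V)
    (v : ι → V) (w : W) (n : ℤ) :
    M.iterateTerm Y w' u z₀ (∑ k ∈ S, c k • v k) ℓ₂ w n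
      = ∑ k ∈ S, c k * M.iterateTerm Y w' u z₀ (v k) ℓ₂ w n := by
  simp only [M.iterateTerm_eq hY, map_sum, LinearMap.sum_apply, map_smul, LinearMap.smul_apply,
    smul_eq_mul]

end Terms

/-! ### Modes of `Y^g_0` -/

theorem coef₀_add_left (u u' : V) (s : ℂ) (w : W) :
    M.coef₀ (u + u') s w = M.coef₀ u s w + M.coef₀ u' s w := by
  simp [coef₀]

theorem coef₀_smul_left (c : ℂ) (u : V) (s : ℂ) (w : W) :
    M.coef₀ (c • u) s w = c • M.coef₀ u s w := by
  simp [coef₀]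

theorem coef₀_zero_left (s : ℂ) (w : W) : M.coef₀ 0 s w = 0 := by
  simp [coef₀]

theorem coef₀_sum_left {ι : Type*} (S : Finset ι) (u : ι → V) (s : ℂ) (w : W) :
    M.coef₀ (∑ i ∈ S, u i) s w = ∑ i ∈ S, M.coef₀ (u i) s w := by
  simp [coef₀, LinearMap.sum_apply, Finsupp.finsetSum_apply]

theorem coef₀_mem {m : ℤ} {p : ℂ} {v : V} (hv : v ∈ A.wt m) {w : W}
    (hw : w ∈ degSpace M.comp p) (s : ℂ) : M.coef₀ v s w ∈ degSpace M.comp (m + s + p) :=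
  M.isGraded_Yg m p v hv w hw 0 s

theorem degSpace_eq_bot {q : ℂ} (hq : q.re < 0) : degSpace M.comp q = ⊥ := by
  rw [eq_bot_iff]
  refine degSpace_le fun i hi => ?_
  have := i.1.2
  rw [hi] at this
  linarith

/-- The degree of `v(n)w` has negative real part when the real part of `n` is large. -/
theorem lowerTruncated : M.LowerTruncated := by
  intro u w
  have hu : u ∈ ⨆ n, A.wt n := by
    rw [A.iSup_wt]; trivial
  induction hu using Submodule.iSup_induction' with
  | mem m u hu =>
    refine degSpace_induction M.internal
      (Q := fun w => ∃ R : ℝ, ∀ n : ℂ, R < n.re → M.nmode u n w = 0) ?_ ?_ ?_ w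
    · intro p w hw
      refine ⟨m + p.re, fun n hn => ?_⟩
      have := M.coef₀_mem hu hw (-n - 1)
      rw [M.degSpace_eq_bot] at this
      · exact (Submodule.mem_bot ℂ).1 this
      · simp
        linarith
    · exact ⟨0, fun n _ => map_zero _⟩
    · rintro x y ⟨R, hR⟩ ⟨S, hS⟩
      refine ⟨max R S, fun n hn => ?_⟩
      rw [map_add, hR n ((le_max_left _ _).trans_lt hn), hS n ((le_max_right _ _).trans_lt hn),
        add_zero]
  | zero => exact ⟨0, fun n _ => M.coef₀_zero_left _ _⟩
  | add x y _ _ hx hy =>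
    obtain ⟨R, hR⟩ := hx
    obtain ⟨S, hS⟩ := hy
    refine ⟨max R S, fun n hn => ?_⟩
    have h1 := hR n ((le_max_left _ _).trans_lt hn)
    have h2 := hS n ((le_max_right _ _).trans_lt hn)
    unfold nmode at h1 h2 ⊢
    rw [coef₀_add_left, h1, h2, add_zero]

theorem exists_nmode_eq_zero (u : V) (a : ℂ) (w : W) :
    ∃ K : ℤ, ∀ k : ℤ, K ≤ k → M.nmode u (a + k) w = 0 := by
  obtain ⟨R, hR⟩ := M.lowerTruncated u w
  refine ⟨⌊R - a.re⌋ + 1, fun k hk => hR _ ?_⟩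
  have h1 := Int.lt_floor_add_one (R - a.re)
  have h2 : ((⌊R - a.re⌋ + 1 : ℤ) : ℝ) ≤ k := by exact_mod_cast hk
  push_cast at h2
  simp only [Complex.add_re, Complex.intCast_re]
  linarith

theorem nmode_mode_eq_zero {a b c : ℂ} {u v : V} (hu : u ∈ g.genEigen a) (hv : v ∈ g.genEigen b)
    (hc : ∀ k : ℤ, c ≠ a + b + k) (j : ℤ) (w : W) : M.nmode (A.mode u j v) c w = 0 := by
  refine M.coef₀_eq_zero (fun k hk => hc (-k - 1) ?_) (g.mode_mem_genEigen hu hv j) w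
  push_cast
  linear_combination -hk

theorem nmode_eq_zero {a c : ℂ} {u : V} (hu : u ∈ g.genEigen a) (hc : ∀ k : ℤ, c ≠ a + k) (w : W) :
    M.nmode u c w = 0 := by
  refine M.coef₀_eq_zero (fun k hk => hc (-k - 1) ?_) hu w
  push_cast
  linear_combination -hk

/-! ### Sequences of matrix coefficients -/

/-- The matrix coefficients `⟨f, u(a - k) v(b + k)w⟩`, `k ∈ ℤ`. -/
def prodSeq (f : Module.Dual ℂ W) (u v : V) (w : W) (a b : ℂ) (k : ℤ) : ℂ :=
  f (M.nmode u (a - k) (M.nmode v (b + k) w))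

/-- The matrix coefficients `⟨f, (u_j v)(c - j)w⟩`, `j ∈ ℤ`. -/
def iterSeq (f : Module.Dual ℂ W) (u v : V) (w : W) (c : ℂ) (j : ℤ) : ℂ :=
  f (M.nmode (A.mode u j v) (c - j) w)

/-- The matrix coefficients of `Y^g_0(Y((1 + x₀/x₂)^𝒩 u, x₀)v, x₂)w`: the `j`-th one is the sum of
the `⟨f, ((binom(𝒩, i)u)_(j+i) v)(c - j - i)w⟩` over `i`. -/
def iterNSeq (f : Module.Dual ℂ W) (u v : V) (w : W) (c : ℂ) (j : ℤ) : ℂ :=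
  ∑ᶠ i : ℕ, M.iterSeq f (g.binomN i u) v w c (j + i)

theorem prodSeq_mem (f : Module.Dual ℂ W) (u v : V) (w : W) (a b : ℂ) :
    M.prodSeq f u v w a b ∈ boundedAbove := by
  obtain ⟨K, hK⟩ := M.exists_nmode_eq_zero v b w
  exact ⟨K, fun k hk => by rw [prodSeq, hK k hk, map_zero, map_zero]⟩

/-- The truncation of `Y(binom(𝒩, i)u, x)v` is uniform in `i`, as only finitely many of the vectors
`binom(𝒩, i)u` are nonzero. -/
theorem exists_iterSeq_eq_zero (u v : V) :
    ∃ J : ℤ, ∀ i : ℕ, ∀ j, J ≤ j → A.mode (g.binomN i u) j v = 0 := by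
  obtain ⟨K, hK⟩ := g.exists_𝒩_pow_eq_zero u
  choose N hN using fun k : ℕ => A.exists_mode_eq_zero ((g.𝒩 ^ k) u) v
  refine ⟨∑ k ∈ Finset.range K, |N k|, fun i j hj => ?_⟩
  rw [g.binomN_eq_sum hK, A.mode_sum_left]
  refine Finset.sum_eq_zero fun k hk => ?_
  have hle : |N k| ≤ ∑ k ∈ Finset.range K, |N k| :=
    Finset.single_le_sum (f := fun k => |N k|) (fun _ _ => abs_nonneg _) hk
  rw [A.mode_smul_left, hN k j ((le_abs_self _).trans (hle.trans hj)), smul_zero]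

theorem iterSeq_mem (f : Module.Dual ℂ W) (u v : V) (w : W) (c : ℂ) :
    M.iterSeq f u v w c ∈ boundedAbove := by
  obtain ⟨J, hJ⟩ := A.exists_mode_eq_zero u v
  exact ⟨J, fun j hj => by rw [iterSeq, hJ j hj, nmode, coef₀_zero_left, map_zero]⟩

theorem iterNSeq_mem (f : Module.Dual ℂ W) (u v : V) (w : W) (c : ℂ) :
    M.iterNSeq f u v w c ∈ boundedAbove := by
  obtain ⟨J, hJ⟩ := exists_iterSeq_eq_zero (g := g) u v
  refine ⟨J, fun j hj => ?_⟩
  rw [iterNSeq, ← finsum_zero (α := ℕ)]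
  refine finsum_congr fun i => ?_
  rw [iterSeq, hJ i _ (by omega), nmode, coef₀_zero_left, map_zero]

/-! ### The series for homogeneous elements -/

section Homogeneous

variable {a b p : ℂ} {i j : ℤ} {u v : V} {w : W} {r : RightHalfPlane × CModZ}
  {φ : Module.Dual ℂ (bigraded M.comp r)}

theorem evalL_Y₀_of_mem {m : ℤ} (hv : v ∈ A.wt m) (hw : w ∈ degSpace M.comp p) (ℓ q : ℂ) :
    M.evalL M.isGraded_Y₀ ℓ q v w
      = Complex.exp ((q - m - p) * ℓ) • M.coef₀ v (q - m - p) w := by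
  rw [evalL_apply, M.evalAt_of_mem M.isGraded_Y₀ hv hw, subst_Y₀]

theorem termL_Y₀_of_mem {m : ℤ} (hv : v ∈ A.wt m) (hw : w ∈ degSpace M.comp p) (ℓ : ℂ) :
    M.termL M.isGraded_Y₀ ℓ (M.homDual r φ) v w = Complex.exp ((r.1 - m - p) * ℓ) *
      M.pairing (M.homDual r φ) (M.coef₀ v (r.1 - m - p) w) := by
  rw [termL_apply, M.pairCompletion_homDual r φ (M.evalAt_mem v ℓ w), ← M.evalL_apply M.isGraded_Y₀,
    M.evalL_Y₀_of_mem hv hw, map_smul, smul_eq_mul]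

theorem productTerm_of_mem (hu : u ∈ A.wt i) (hv : v ∈ A.wt j) (hw : w ∈ degSpace M.comp p)
    (ℓ₁ ℓ₂ q : ℂ) : M.productTerm M.Y₀ (M.homDual r φ) u ℓ₁ v ℓ₂ w q
      = Complex.exp ((q - j - p) * ℓ₂) * Complex.exp ((r.1 - i - q) * ℓ₁) *
        M.pairing (M.homDual r φ) (M.coef₀ u (r.1 - i - q) (M.coef₀ v (q - j - p) w)) := by
  have h : M.coef₀ v (q - j - p) w ∈ degSpace M.comp q := by
    have := M.coef₀_mem hv hw (q - j - p)
    rwa [show (j : ℂ) + (q - j - p) + p = q by ring] at this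
  rw [M.productTerm_eq M.isGraded_Y₀, M.evalL_Y₀_of_mem hv hw, map_smul, M.termL_Y₀_of_mem hu h,
    smul_eq_mul, mul_assoc]

/-- The series `⟨w', Y₀(u, z₁)Y₀(v, z₂)w⟩` for homogeneous elements, as a power series in
`z₁/z₂`. -/
theorem hasSum_productTerm_iff (hu : u ∈ A.wt i) (hv : v ∈ A.wt j)
    (hvb : v ∈ g.genEigen b) (hw : w ∈ degSpace M.comp p) (hc : a + b = i + j + p - r.1 - 2)
    (ℓ₁ ℓ₂ S : ℂ) :
    HasSum (M.productTerm M.Y₀ (M.homDual r φ) u ℓ₁ v ℓ₂ w) S ↔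
      HasSum (fun k : ℤ => Complex.exp (-(a + 1) * ℓ₁) * Complex.exp (-(b + 1) * ℓ₂) *
        (M.prodSeq (M.pairing (M.homDual r φ)) u v w a b k * Complex.exp (k * (ℓ₁ - ℓ₂)))) S := by
  have hinj : Function.Injective fun k : ℤ => (j : ℂ) + p - b - k - 1 := by
    intro k k' h
    have : (k : ℂ) = k' := by linear_combination -h
    exact_mod_cast this
  rw [← hinj.hasSum_iff]
  · have : (M.productTerm M.Y₀ (M.homDual r φ) u ℓ₁ v ℓ₂ w) ∘
        (fun k : ℤ => (j : ℂ) + p - b - k - 1) = fun k : ℤ => Complex.exp (-(a + 1) * ℓ₁) *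
        Complex.exp (-(b + 1) * ℓ₂) * (M.prodSeq (M.pairing (M.homDual r φ)) u v w a b k *
          Complex.exp (k * (ℓ₁ - ℓ₂))) := by
      funext k
      rw [Function.comp_apply, M.productTerm_of_mem hu hv hw, prodSeq, nmode, nmode,
        show (j : ℂ) + p - b - k - 1 - j - p = -(b + k) - 1 by ring,
        show (r.1 : ℂ) - i - (j + p - b - k - 1) = -(a - k) - 1 by linear_combination hc,
        mul_comm (M.pairing (M.homDual r φ) _), ← mul_assoc, ← Complex.exp_add, ← Complex.exp_add,
        ← Complex.exp_add]
      congr 2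
      ring
    rw [this]
  · intro q hq
    rw [M.productTerm_of_mem hu hv hw, M.coef₀_eq_zero _ hvb, map_zero, map_zero, mul_zero]
    intro k hk
    refine hq ⟨-k - 1, ?_⟩
    push_cast
    linear_combination -hk

/-- The modes of `u` and `v` have indices in `a + ℤ` and `b + ℤ`, and their degrees have to add up
to that of the functional. -/
theorem productTerm_eq_zero (hu : u ∈ A.wt i) (hv : v ∈ A.wt j) (hua : u ∈ g.genEigen a)
    (hvb : v ∈ g.genEigen b) (hw : w ∈ degSpace M.comp p)
    (hc : ∀ k : ℤ, a + b + k ≠ i + j + p - r.1 - 2) (ℓ₁ ℓ₂ q : ℂ) :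
    M.productTerm M.Y₀ (M.homDual r φ) u ℓ₁ v ℓ₂ w q = 0 := by
  rw [M.productTerm_of_mem hu hv hw]
  by_cases h : ∃ k : ℤ, q - j - p = -b + k
  · obtain ⟨k, hk⟩ := h
    rw [M.coef₀_eq_zero _ hua, map_zero, mul_zero]
    intro k' hk'
    refine hc (-k - k' - 2) ?_
    push_cast
    linear_combination hk + hk'
  · push Not at h
    rw [M.coef₀_eq_zero h hvb, map_zero, map_zero, mul_zero]

theorem iterateTerm_of_mem (hu : u ∈ A.wt i) (hv : v ∈ A.wt j) (hw : w ∈ degSpace M.comp p)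
    (z₀ ℓ₂ : ℂ) (m : ℤ) :
    M.iterateTerm M.Y₀ (M.homDual r φ) u z₀ v ℓ₂ w (i + j - m - 1)
      = z₀ ^ (-m - 1) * Complex.exp ((-((i + j + p - r.1 - 2) - m) - 1) * ℓ₂) *
        M.iterSeq (M.pairing (M.homDual r φ)) u v w (i + j + p - r.1 - 2) m := by
  rw [M.iterateTerm_eq M.isGraded_Y₀, A.iterVec_of_mem z₀ hu hv, map_smul, LinearMap.smul_apply,
    M.termL_Y₀_of_mem (A.mode_mem_wt hu hv m) hw, smul_eq_mul, iterSeq, nmode, mul_assoc]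
  push_cast
  rw [show (r.1 : ℂ) - (i + j - m - 1) - p = -(i + j + p - r.1 - 2 - m) - 1 by ring]

/-- The series `⟨w', Y₀(Y(u, z₀)v, z₂)w⟩` for homogeneous elements, as a power series in
`z₀/z₂`. -/
theorem iterateTerm_eq_zpow (hu : u ∈ A.wt i) (hv : v ∈ A.wt j) (hw : w ∈ degSpace M.comp p)
    {c : ℂ} (hc : c = i + j + p - r.1 - 2) (z₀ ℓ₂ : ℂ) (m : ℤ) :
    M.iterateTerm M.Y₀ (M.homDual r φ) u z₀ v ℓ₂ w (i + j - m - 1)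
      = Complex.exp (-(c + 2) * ℓ₂) * (M.iterSeq (M.pairing (M.homDual r φ)) u v w c m *
        (z₀ / Complex.exp ℓ₂) ^ (-m - 1)) := by
  rw [M.iterateTerm_of_mem hu hv hw, ← hc, div_zpow, ← Complex.exp_int_mul, div_eq_mul_inv,
    ← Complex.exp_neg]
  push_cast
  rw [show (-(c - m) - 1) * ℓ₂ = -(c + 2) * ℓ₂ + -((-(m : ℂ) - 1) * ℓ₂) by ring, Complex.exp_add]
  ring

theorem hasSum_iterateTerm_iff (hu : u ∈ A.wt i) (hv : v ∈ A.wt j) (hw : w ∈ degSpace M.comp p)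
    {c : ℂ} (hc : c = i + j + p - r.1 - 2) (z₀ ℓ₂ S : ℂ) :
    HasSum (M.iterateTerm M.Y₀ (M.homDual r φ) u z₀ v ℓ₂ w) S ↔
      HasSum (fun m : ℤ => Complex.exp (-(c + 2) * ℓ₂) *
        (M.iterSeq (M.pairing (M.homDual r φ)) u v w c m *
          (z₀ / Complex.exp ℓ₂) ^ (-m - 1))) S := by
  let e : ℤ ≃ ℤ := (Equiv.subLeft (i + j - 1))
  rw [← e.hasSum_iff]
  refine iff_of_eq (congrArg (fun F => HasSum F S) (funext fun m => ?_))
  rw [← M.iterateTerm_eq_zpow hu hv hw hc, Function.comp_apply, Equiv.subLeft_apply,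
    show i + j - 1 - m = i + j - m - 1 by ring]

theorem iterateTerm_eq_zero (hu : u ∈ A.wt i) (hv : v ∈ A.wt j) (hua : u ∈ g.genEigen a)
    (hvb : v ∈ g.genEigen b) (hw : w ∈ degSpace M.comp p)
    (hc : ∀ k : ℤ, a + b + k ≠ i + j + p - r.1 - 2) (z₀ ℓ₂ : ℂ) (n : ℤ) :
    M.iterateTerm M.Y₀ (M.homDual r φ) u z₀ v ℓ₂ w n = 0 := by
  obtain ⟨m, rfl⟩ : ∃ m, n = i + j - m - 1 := ⟨i + j - 1 - n, by ring⟩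
  rw [M.iterateTerm_of_mem hu hv hw, iterSeq, M.nmode_mode_eq_zero hua hvb, map_zero, mul_zero]
  intro k hk
  refine hc (k + m) ?_
  push_cast
  linear_combination -hk

end Homogeneous

/-! ### From `Y^g` to `Y^g_0` -/

/-- The identity `Y^g(v, x) = Y^g_0(x^(-𝒩) v, x)` for products. -/
theorem productTerm_Yg {a b : ℂ} {u v : V} (hu : u ∈ g.genEigen a) (hv : v ∈ g.genEigen b)
    (w' : M.GradedDual) (ℓ₁ ℓ₂ : ℂ) (w : W) (n : ℂ) :
    M.productTerm M.Yg w' u ℓ₁ v ℓ₂ w n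
      = M.productTerm M.Y₀ w' (g.expN (-ℓ₁) u) ℓ₁ (g.expN (-ℓ₂) v) ℓ₂ w n := by
  unfold productTerm
  rw [M.evalAt_Yg hv, M.evalAt_Yg hu]

/-- The identity `Y^g(v, x) = Y^g_0(x^(-𝒩) v, x)` for iterates, where `x^(-𝒩)` is distributed over
the factors of `Y(u, z₀)v` because `𝒩` is a derivation. -/
theorem iterateTerm_Yg {a b : ℂ} {i j : ℤ} {u v : V} (hu : u ∈ g.genEigen a)
    (hv : v ∈ g.genEigen b) (hui : u ∈ A.wt i) (hvj : v ∈ A.wt j) {z₀ : ℂ}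
    (w' : M.GradedDual) (ℓ₂ : ℂ) (w : W) (n : ℤ) :
    M.iterateTerm M.Yg w' u z₀ v ℓ₂ w n
      = M.iterateTerm M.Y₀ w' (g.expN (-ℓ₂) u) z₀ (g.expN (-ℓ₂) v) ℓ₂ w n := by
  obtain ⟨m, rfl⟩ : ∃ m, n = i + j - m - 1 := ⟨i + j - 1 - n, by ring⟩
  have hui' := g.expN_mem (g.𝒩_pow_mem_wt hui) (-ℓ₂)
  have hvj' := g.expN_mem (g.𝒩_pow_mem_wt hvj) (-ℓ₂)
  rw [M.iterateTerm_eq M.isGraded_Y₀, M.iterateTerm_eq M.isGraded_Yg, A.iterVec_of_mem z₀ hui hvj,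
    A.iterVec_of_mem z₀ hui' hvj', ← g.expN_mode, map_smul, map_smul, LinearMap.smul_apply,
    LinearMap.smul_apply, termL_apply, termL_apply, M.evalAt_Yg (g.mode_mem_genEigen hu hv m)]

end PreTwistedModule

/-! ### Coefficients of the formal identities -/

theorem finsum_prod_eq_single {ι κ M : Type*} [AddCommMonoid M] (F : ι × κ → M) (l : ι)
    (h : ∀ q, q.1 ≠ l → F q = 0) : ∑ᶠ q, F q = ∑ᶠ k, F (l, k) := by
  have hinj : Function.Injective fun k : κ => (l, k) := fun _ _ h => (Prod.mk.inj h).2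
  rw [← finsum_mem_range (f := F) hinj, ← finsum_mem_univ]
  refine finsum_mem_inter_support_eq' F _ _ fun q hq => ?_
  refine ⟨fun _ => ⟨q.2, ?_⟩, fun _ => trivial⟩
  by_contra hne
  exact hq (h q fun h1 => hne (by rw [← h1]))

theorem map_finsum_nat {W : Type*} [AddCommGroup W] [Module ℂ W] (f : Module.Dual ℂ W)
    {G : ℕ → W} (h : ∃ N, ∀ i, N ≤ i → G i = 0) : f (∑ᶠ i, G i) = ∑ᶠ i, f (G i) := by
  obtain ⟨N, hN⟩ := h
  rw [finsum_eq_sum_range G N hN, finsum_eq_sum_range _ N fun i hi => by rw [hN i hi, map_zero],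
    map_sum]

namespace PreTwistedModule

variable {V : Type*} [AddCommGroup V] [Module ℂ V] {A : VertexOperatorAlgebra V}
  {g : A.Automorphism} {W : Type*} [AddCommGroup W] [Module ℂ W] (M : PreTwistedModule A g W)

theorem exists_nmode_mul_eq_zero (u v : V) (w : W) (a b : ℂ) (x : ℕ → ℂ) :
    ∃ N : ℕ, ∀ i, N ≤ i → x i • M.nmode u (a - i) (M.nmode v (b + i) w) = 0 := by
  obtain ⟨K, hK⟩ := M.exists_nmode_eq_zero v b w
  refine ⟨K.toNat, fun i hi => ?_⟩
  have := hK i (by omega)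
  rw [Int.cast_natCast] at this
  rw [this, map_zero, smul_zero]

/-- The coefficient of `x₀^(-j-1) x₂^(j-c-1)` in `Y^g_0(Y((1 + x₀/x₂)^𝒩 u, x₀)v, x₂)w`. -/
def iterNMode (u v : V) (w : W) (c : ℂ) (j : ℤ) : W :=
  ∑ᶠ i : ℕ, M.nmode (A.mode (g.binomN i u) (j + i) v) (c - j - i) w

theorem map_iterNMode (f : Module.Dual ℂ W) (u v : V) (w : W) (c : ℂ) (j : ℤ) :
    f (M.iterNMode u v w c j) = M.iterNSeq f u v w c j := by
  rw [iterNMode, map_finsum_nat, iterNSeq]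
  · refine finsum_congr fun i => ?_
    rw [iterSeq]
    congr 3
    push_cast
    ring
  · obtain ⟨J, hJ⟩ := exists_iterSeq_eq_zero (g := g) u v
    refine ⟨(J - j).toNat, fun i hi => ?_⟩
    rw [hJ i _ (by omega), nmode, coef₀_zero_left]

theorem iterNMode_eventually (u v : V) (w : W) (c : ℂ) :
    ∃ J : ℤ, ∀ j, J ≤ j → M.iterNMode u v w c j = 0 := by
  obtain ⟨J, hJ⟩ := exists_iterSeq_eq_zero (g := g) u v
  refine ⟨J, fun j hj => ?_⟩
  rw [iterNMode, ← finsum_zero (α := ℕ)]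
  refine finsum_congr fun i => ?_
  rw [hJ i _ (by omega), nmode, coef₀_zero_left]

theorem iter_apply (u v : V) (w : W) (j : ℤ) (s : ℂ) :
    M.iter u v w (-j - 1, 0, s) = M.coef₀ (A.mode u j v) s w := by
  rw [iter, if_pos rfl, finsum_eq_single _ j]
  · rw [if_pos rfl]
  · intro m hm
    rw [if_neg]
    intro h
    have h1 : -(j : ℂ) - 1 = -m - 1 := h
    have : (m : ℂ) = j := by linear_combination h1
    exact hm (by exact_mod_cast this)

theorem iter_eq_zero (u v : V) (w : W) {e : ℂ × ℂ × ℂ}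
    (h : e.2.1 ≠ 0 ∨ ∀ j : ℤ, e.1 ≠ -(j : ℂ) - 1) : M.iter u v w e = 0 := by
  rw [iter]
  rcases h with h | h
  · rw [if_neg h]
  · split_ifs
    · exact (finsum_congr fun m => if_neg (h m)).trans finsum_zero
    · rfl

theorem iterN_apply (u v : V) (w : W) (c : ℂ) (j : ℤ) :
    M.iterN u v w (-j - 1, 0, j - c - 1) = M.iterNMode u v w c j := by
  refine finsum_congr fun i => ?_
  have := M.iter_apply (g.binomN i u) v w (j + i) (-(c - j - i) - 1)
  rw [nmode, ← this]
  congr 1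
  simp only [Prod.mk_sub_mk, sub_zero]
  refine Prod.ext ?_ (Prod.ext rfl ?_)
  · push_cast
    ring
  · simp only
    ring

theorem iterN_eq_zero (u v : V) (w : W) {e : ℂ × ℂ × ℂ}
    (h : e.2.1 ≠ 0 ∨ ∀ j : ℤ, e.1 ≠ -(j : ℂ) - 1) : M.iterN u v w e = 0 := by
  refine (finsum_congr fun i => M.iter_eq_zero _ _ _ ?_).trans finsum_zero
  refine h.imp (fun h => by simpa using h) fun h j hj => h (j - i) ?_
  simp only [Prod.fst_sub] at hj
  push_cast
  linear_combination hj

section Coefficients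

variable (f : Module.Dual ℂ W) (u v : V) (w : W) (a b : ℂ) (l ν : ℤ)

/-- The coefficients of the first term of the twisted Jacobi identity. -/
theorem map_mulDelta₁₂ : f (mulDelta₁₂ (M.prod₁₂ u v w) (-l - 1, -(a - ν - l) - 1, -(b + ν) - 1))
    = conv (fun i => (-1) ^ i * Ring.choose (l : ℂ) i) ν (M.prodSeq f u v w a b) := by
  have h : ∀ i : ℕ, M.prod₁₂ u v w ((-(l : ℂ) - 1, -(a - ν - l) - 1, -(b + ν) - 1)
      - (-(l : ℂ) - 1, (l : ℂ) - i, (i : ℂ)))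
      = M.nmode u (a - ν - i) (M.nmode v (b + ν + i) w) := by
    intro i
    simp only [Prod.mk_sub_mk]
    rw [prod₁₂, if_pos (by simp), nmode, nmode]
    simp only
    rw [show -(a - ν - l) - 1 - ((l : ℂ) - i) = -(a - ν - i) - 1 by ring,
      show -(b + ν) - 1 - (i : ℂ) = -(b + ν + i) - 1 by ring]
  rw [mulDelta₁₂, mulSeries, finsum_prod_eq_single _ l]
  · simp only [h]
    rw [map_finsum_nat f (M.exists_nmode_mul_eq_zero u v w (a - ν) (b + ν) _), conv]
    refine finsum_congr fun i => ?_
    rw [map_smul, smul_eq_mul, prodSeq]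
    push_cast
    rw [← add_assoc, ← sub_sub]
  · intro q hq
    rw [prod₁₂, if_neg, smul_zero]
    intro h0
    simp only [Prod.mk_sub_mk] at h0
    have : (q.1 : ℂ) = l := by linear_combination h0
    exact hq (by exact_mod_cast this)

/-- The coefficients of the second term of the twisted Jacobi identity. The sign `(-1)^l` comes from
the expansion of `(-x₂ + x₁)^l` in powers of `x₁`. -/
theorem map_mulDelta₂₁ : f (mulDelta₂₁ (M.prod₂₁ u v w) (-l - 1, -(a - ν - l) - 1, -(b + ν) - 1))
    = (-1) ^ l * conv (fun i => (-1) ^ i * Ring.choose (l : ℂ) i) (-(ν + l))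
      (M.prodSeq f v u w b a) := by
  have h : ∀ i : ℕ, M.prod₂₁ u v w ((-(l : ℂ) - 1, -(a - ν - l) - 1, -(b + ν) - 1)
      - (-(l : ℂ) - 1, (i : ℂ), (l : ℂ) - i))
        = M.nmode v (b + ν + l - i) (M.nmode u (a - ν - l + i) w) := by
    intro i
    simp only [Prod.mk_sub_mk]
    rw [prod₂₁, if_pos (by simp), nmode, nmode]
    simp only
    rw [show -(b + ν) - 1 - ((l : ℂ) - i) = -(b + ν + l - i) - 1 by ring,
      show -(a - ν - l) - 1 - (i : ℂ) = -(a - ν - l + i) - 1 by ring]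
  rw [mulDelta₂₁, mulSeries, finsum_prod_eq_single _ l]
  · simp only [h]
    rw [map_finsum_nat f (M.exists_nmode_mul_eq_zero v u w (b + ν + l) (a - ν - l) _), conv,
      mul_finsum]
    refine finsum_congr fun i => ?_
    rw [map_smul, smul_eq_mul, prodSeq]
    push_cast
    rw [show b - (-((ν : ℂ) + l) + i) = b + ν + l - i by ring,
      show a + (-((ν : ℂ) + l) + i) = a - ν - l + i by ring, ← mul_assoc, ← mul_assoc,
      zpow_sub₀ (by norm_num : (-1 : ℂ) ≠ 0), zpow_natCast, div_eq_mul_inv, ← inv_pow, inv_neg_one]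
  · intro q hq
    rw [prod₂₁, if_neg, smul_zero]
    intro h0
    simp only [Prod.mk_sub_mk] at h0
    have : (q.1 : ℂ) = l := by linear_combination h0
    exact hq (by exact_mod_cast this)

theorem map_finsum_iterNMode (m c : ℂ) :
    f (∑ᶠ i : ℕ, Ring.choose m i • M.iterNMode u v w c (l + i))
      = conv (fun i => 1 ^ i * Ring.choose m i) l (M.iterNSeq f u v w c) := by
  rw [map_finsum_nat, conv]
  · refine finsum_congr fun i => ?_
    rw [map_smul, smul_eq_mul, map_iterNMode, one_pow, one_mul]
  · obtain ⟨J, hJ⟩ := M.iterNMode_eventually u v w c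
    exact ⟨(J - l).toNat, fun i hi => by rw [hJ _ (by omega), smul_zero]⟩

/-- The coefficients of the right-hand side of the twisted Jacobi identity. The exponent of
`x₂ + x₀` that occurs is `a - ν - l`, whatever the representative `a₀` of `a + ℤ`. -/
theorem map_mulDelta₂₀ {a₀ : ℂ} (ha : ∃ s : ℤ, a = a₀ + s) :
    f (mulDelta₂₀ a₀ (M.iterN u v w) (-l - 1, -(a - ν - l) - 1, -(b + ν) - 1))
      = conv (fun i => 1 ^ i * Ring.choose (a - ν - l) i) l (M.iterNSeq f u v w (a + b)) := by
  obtain ⟨s, hs⟩ := ha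
  rw [← map_finsum_iterNMode, mulDelta₂₀, mulSeries, finsum_prod_eq_single _ (s - ν - l)]
  · congr 1
    refine finsum_congr fun i => ?_
    rw [← iterN_apply]
    congr 2
    · rw [hs]
      push_cast
      ring
    · simp only [Prod.mk_sub_mk]
      rw [hs]
      push_cast
      refine Prod.ext ?_ (Prod.ext ?_ ?_) <;> simp only <;> ring
  · intro q hq
    rw [iterN_eq_zero, smul_zero]
    left
    simp only [Prod.mk_sub_mk, ne_eq]
    intro h0
    rw [hs] at h0
    have : (q.1 : ℂ) = s - ν - l := by linear_combination h0
    exact hq (by exact_mod_cast this)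

/-- The coefficients of the right-hand side of weak associativity. -/
theorem map_mulPow₂₀ : f (mulPow₂₀ (a - ν - l) (M.iterN u v w) (-l - 1, 0, -(b + ν) - 1))
    = conv (fun i => 1 ^ i * Ring.choose (a - ν - l) i) l (M.iterNSeq f u v w (a + b)) := by
  rw [← map_finsum_iterNMode, mulPow₂₀, mulSeries]
  congr 1
  refine finsum_congr fun i => ?_
  rw [← iterN_apply]
  congr 2
  simp only [Prod.mk_sub_mk]
  push_cast
  refine Prod.ext ?_ (Prod.ext ?_ ?_) <;> simp only <;> ring

/-- The upper negation rule. -/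
theorem choose_neg_add_natCast (l : ℤ) (N : ℕ) :
    Ring.choose (-(l : ℂ) - 1 + N) N = (-1) ^ N * Ring.choose (l : ℂ) N := by
  have h := Ring.choose_neg ((l : ℂ) + 1 - N) N
  rw [show -((l : ℂ) + 1 - N) = -(l : ℂ) - 1 + N by ring] at h
  rw [h, show (l : ℂ) + 1 - N + N - 1 = l by ring, Units.smul_def, zsmul_eq_mul]
  congr 1
  simp [Int.negOnePow_def]

/-- Vandermonde's identity turns the product with `(x₀ + x₂)^l` of a series in `x₀ + x₂` into a
single sum. -/
theorem mulPow₀₂_prodShift_apply (l : ℂ) (e₀ e₂ : ℂ) :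
    mulPow₀₂ l (M.prodShift u v w) (e₀, 0, e₂)
      = ∑ᶠ N : ℕ, Ring.choose (e₀ + N) N •
          M.coef₀ u (e₀ - l + N) (M.coef₀ v (e₂ - N) w) := by
  obtain ⟨K, hK⟩ := M.exists_nmode_eq_zero v (-e₂ - 1) w
  have hK' : ∀ N : ℕ, K.toNat ≤ N → M.coef₀ v (e₂ - N) w = 0 := by
    intro N hN
    have := hK N (by omega)
    rw [nmode] at this
    rw [← this]
    congr 2
    push_cast
    ring
  set T := fun N : ℕ => M.coef₀ u (e₀ - l + N) (M.coef₀ v (e₂ - N) w) with hT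
  have hT0 : ∀ N, K.toNat ≤ N → T N = 0 := fun N hN => by
    rw [hT]; simp only; rw [hK' N hN, map_zero]
  have h1 : ∀ k : ℕ, M.prodShift u v w ((e₀, 0, e₂) - (l - k, 0, (k : ℂ)))
      = ∑ j ∈ Finset.range K.toNat, Ring.choose (e₀ - l + ((k + j : ℕ) : ℂ)) j • T (k + j) := by
    intro k
    rw [prodShift, if_pos (by simp), ← finsum_eq_sum_range]
    · refine finsum_congr fun j => ?_
      simp only [Prod.mk_sub_mk, hT]
      push_cast
      rw [show e₀ - (l - k) + (j : ℂ) = e₀ - l + (k + j) by ring, sub_sub]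
    · intro j hj
      rw [hT0 _ (by omega), smul_zero]
  rw [mulPow₀₂, mulSeries]
  simp only [h1]
  rw [finsum_eq_sum_range _ K.toNat]
  · rw [finsum_eq_sum_range _ K.toNat (fun N hN => by rw [hK' N hN, map_zero, smul_zero])]
    simp only [Finset.smul_sum, smul_smul]
    rw [sum_range_eq_sum_antidiagonal (fun k j =>
      (Ring.choose l k * Ring.choose (e₀ - l + ((k + j : ℕ) : ℂ)) j) • T (k + j))
      fun k j h => by rw [hT0 _ h, smul_zero]]
    refine Finset.sum_congr rfl fun N _ => ?_
    rw [show e₀ + (N : ℂ) = l + (e₀ - l + N) by ring, Ring.add_choose_eq N (Commute.all _ _),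
      Finset.sum_smul]
    refine Finset.sum_congr rfl fun q hq => ?_
    rw [Finset.HasAntidiagonal.mem_antidiagonal.1 hq]
  · intro k hk
    rw [Finset.sum_eq_zero, smul_zero]
    intro j _
    rw [hT0 _ (by omega), smul_zero]

/-- The coefficients of the left-hand side of weak associativity. -/
theorem map_mulPow₀₂ :
    f (mulPow₀₂ (a - ν - l) (M.prodShift u v w) (-l - 1, 0, -(b + ν) - 1))
      = conv (fun i => (-1) ^ i * Ring.choose (l : ℂ) i) ν (M.prodSeq f u v w a b) := by
  rw [mulPow₀₂_prodShift_apply, conv, map_finsum_nat]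
  · refine finsum_congr fun i => ?_
    rw [map_smul, smul_eq_mul, choose_neg_add_natCast, prodSeq, nmode, nmode]
    push_cast
    rw [show -(a - ((ν : ℂ) + i)) - 1 = -(l : ℂ) - 1 - (a - ν - l) + i by ring,
      show -(b + ((ν : ℂ) + i)) - 1 = -(b + ν) - 1 - i by ring]
  · obtain ⟨N, hN⟩ := M.exists_nmode_mul_eq_zero u v w (a - ν) (b + ν)
      (fun N => Ring.choose (-(l : ℂ) - 1 + N) N)
    refine ⟨N, fun i hi => ?_⟩
    rw [← hN i hi, nmode, nmode, show -(a - ν - i) - 1 = -(l : ℂ) - 1 - (a - ν - l) + i by ring,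
      show -(b + ν + i) - 1 = -(b + ν) - 1 - i by ring]

end Coefficients

/-! ### The Borcherds identity -/

/-- The defect of the Borcherds identity for the matrix coefficients with respect to `f`. -/
def defect (f : Module.Dual ℂ W) (u v : V) (w : W) (a b : ℂ) (l ν : ℤ) : ℂ :=
  borcherdsDefect (a + 1) (M.prodSeq f u v w a b) (M.prodSeq f v u w b a)
    (M.iterNSeq f u v w (a + b)) l ν

/-- The Borcherds identity: for `u ∈ V^[a+ℤ]`, `l ∈ ℤ`, `m ∈ a + ℤ` and `n ∈ ℂ`,
`∑_k (-1)^k binom(l, k) (u(m+l-k)v(n+k) - (-1)^l v(n+l-k)u(m+k))w`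
`= ∑_{k,j} binom(m, k) ((binom(𝒩, j)u)_(l+k+j) v)(m+n-k-j)w`, tested on the homogeneous elements of
`W'`. Here `m = a - ν - l` and `n = b + ν`. The vectors `v` and `w` and the number `b` are
arbitrary. -/
def Borcherds : Prop :=
  ∀ (r : RightHalfPlane × CModZ) (φ : Module.Dual ℂ (bigraded M.comp r)) (a : ℂ),
    ∀ u ∈ g.genEigen a, ∀ (v : V) (w : W) (b : ℂ) (l ν : ℤ),
      M.defect (M.pairing (M.homDual r φ)) u v w a b l ν = 0

/-- The Borcherds identity for homogeneous elements, with `b` in the coset of `v` and with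
parameters for which the degrees match: `u(a - k)v(b + k)w` has the degree `r` of the functional. -/
def HomogeneousBorcherds : Prop :=
  ∀ (r : RightHalfPlane × CModZ) (φ : Module.Dual ℂ (bigraded M.comp r)) (a b p : ℂ) (i j : ℤ),
    ∀ u ∈ g.genEigen a, u ∈ A.wt i → ∀ v ∈ g.genEigen b, v ∈ A.wt j →
    ∀ w ∈ degSpace M.comp p, a + b = i + j + p - r.1 - 2 → ∀ l ν : ℤ,
      M.defect (M.pairing (M.homDual r φ)) u v w a b l ν = 0

section Additivity

variable (f : Module.Dual ℂ W) (a b c : ℂ)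

theorem prodSeq_add₁ (u u' v : V) (w : W) :
    M.prodSeq f (u + u') v w a b = M.prodSeq f u v w a b + M.prodSeq f u' v w a b := by
  funext k
  simp [prodSeq, nmode, coef₀_add_left]

theorem prodSeq_add₂ (u v v' : V) (w : W) :
    M.prodSeq f u (v + v') w a b = M.prodSeq f u v w a b + M.prodSeq f u v' w a b := by
  funext k
  simp [prodSeq, nmode, coef₀_add_left]

theorem prodSeq_add₃ (u v : V) (w w' : W) :
    M.prodSeq f u v (w + w') a b = M.prodSeq f u v w a b + M.prodSeq f u v w' a b := by
  funext k
  simp [prodSeq]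

theorem iterSeq_eventually (u v : V) (w : W) (j : ℤ) :
    (Function.support fun i : ℕ => M.iterSeq f (g.binomN i u) v w c (j + i)).Finite := by
  obtain ⟨J, hJ⟩ := exists_iterSeq_eq_zero (g := g) u v
  refine (Set.finite_lt_nat (J - j).toNat).subset fun i hi => ?_
  by_contra hlt
  refine hi ?_
  simp only [Set.mem_ofPred_eq, not_lt] at hlt
  simp only
  rw [iterSeq, hJ i _ (by omega), nmode, coef₀_zero_left, map_zero]

theorem iterNSeq_add₁ (u u' v : V) (w : W) :
    M.iterNSeq f (u + u') v w c = M.iterNSeq f u v w c + M.iterNSeq f u' v w c := by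
  funext j
  rw [Pi.add_apply, iterNSeq, iterNSeq, iterNSeq,
    ← finsum_add_distrib (M.iterSeq_eventually f c u v w j) (M.iterSeq_eventually f c u' v w j)]
  exact finsum_congr fun i => by simp [iterSeq, A.mode_add_left, nmode, coef₀_add_left]

theorem iterNSeq_add₂ (u v v' : V) (w : W) :
    M.iterNSeq f u (v + v') w c = M.iterNSeq f u v w c + M.iterNSeq f u v' w c := by
  funext j
  rw [Pi.add_apply, iterNSeq, iterNSeq, iterNSeq,
    ← finsum_add_distrib (M.iterSeq_eventually f c u v w j) (M.iterSeq_eventually f c u v' w j)]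
  exact finsum_congr fun i => by simp [iterSeq, nmode, coef₀_add_left]

theorem iterNSeq_add₃ (u v : V) (w w' : W) :
    M.iterNSeq f u v (w + w') c = M.iterNSeq f u v w c + M.iterNSeq f u v w' c := by
  funext j
  rw [Pi.add_apply, iterNSeq, iterNSeq, iterNSeq,
    ← finsum_add_distrib (M.iterSeq_eventually f c u v w j) (M.iterSeq_eventually f c u v w' j)]
  exact finsum_congr fun i => by simp [iterSeq]

variable (l ν : ℤ)

theorem defect_add₁ (u u' v : V) (w : W) :
    M.defect f (u + u') v w a b l ν = M.defect f u v w a b l ν + M.defect f u' v w a b l ν := by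
  rw [defect, prodSeq_add₁, prodSeq_add₂, iterNSeq_add₁]
  exact borcherdsDefect_add (M.prodSeq_mem _ _ _ _ _ _) (M.prodSeq_mem _ _ _ _ _ _)
    (M.iterNSeq_mem _ _ _ _ _) (M.prodSeq_mem _ _ _ _ _ _) (M.prodSeq_mem _ _ _ _ _ _)
    (M.iterNSeq_mem _ _ _ _ _) _ _

theorem defect_add₂ (u v v' : V) (w : W) :
    M.defect f u (v + v') w a b l ν = M.defect f u v w a b l ν + M.defect f u v' w a b l ν := by
  rw [defect, prodSeq_add₁, prodSeq_add₂, iterNSeq_add₂]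
  exact borcherdsDefect_add (M.prodSeq_mem _ _ _ _ _ _) (M.prodSeq_mem _ _ _ _ _ _)
    (M.iterNSeq_mem _ _ _ _ _) (M.prodSeq_mem _ _ _ _ _ _) (M.prodSeq_mem _ _ _ _ _ _)
    (M.iterNSeq_mem _ _ _ _ _) _ _

theorem defect_add₃ (u v : V) (w w' : W) :
    M.defect f u v (w + w') a b l ν = M.defect f u v w a b l ν + M.defect f u v w' a b l ν := by
  rw [defect, prodSeq_add₃, prodSeq_add₃, iterNSeq_add₃]
  exact borcherdsDefect_add (M.prodSeq_mem _ _ _ _ _ _) (M.prodSeq_mem _ _ _ _ _ _)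
    (M.iterNSeq_mem _ _ _ _ _) (M.prodSeq_mem _ _ _ _ _ _) (M.prodSeq_mem _ _ _ _ _ _)
    (M.iterNSeq_mem _ _ _ _ _) _ _

theorem defect_eq_zero_of_seq {u v : V} {w : W} (h₁ : ∀ k, M.prodSeq f u v w a b k = 0)
    (h₂ : ∀ k, M.prodSeq f v u w b a k = 0) (h₃ : ∀ k, M.iterNSeq f u v w (a + b) k = 0) :
    M.defect f u v w a b l ν = 0 := by
  rw [defect, show M.prodSeq f u v w a b = 0 from funext h₁,
    show M.prodSeq f v u w b a = 0 from funext h₂,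
    show M.iterNSeq f u v w (a + b) = 0 from funext h₃]
  simp [borcherdsDefect, conv_zero]

end Additivity

theorem binomN_mem_wt {i : ℤ} {u : V} (hu : u ∈ A.wt i) (n : ℕ) : g.binomN n u ∈ A.wt i := by
  obtain ⟨K, hK⟩ := g.exists_𝒩_pow_eq_zero u
  rw [g.binomN_eq_sum hK]
  exact Submodule.sum_mem _ fun k _ => Submodule.smul_mem _ _ (g.𝒩_pow_mem_wt hu k)

theorem binomN_mem_genEigen {a : ℂ} {u : V} (hu : u ∈ g.genEigen a) (n : ℕ) :
    g.binomN n u ∈ g.genEigen a := by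
  obtain ⟨K, hK⟩ := g.exists_𝒩_pow_eq_zero u
  rw [g.binomN_eq_sum hK]
  exact Submodule.sum_mem _ fun k _ => Submodule.smul_mem _ _ (g.𝒩_pow_mem_genEigen hu k)

theorem nmode_mem {m : ℤ} {p : ℂ} {v : V} (hv : v ∈ A.wt m) {w : W}
    (hw : w ∈ degSpace M.comp p) (n : ℂ) : M.nmode v n w ∈ degSpace M.comp (m - n - 1 + p) := by
  have := M.coef₀_mem hv hw (-n - 1)
  rwa [show (m : ℂ) + (-n - 1) + p = m - n - 1 + p by ring] at this

/-- By additivity it suffices to treat homogeneous vectors, and for these all matrix coefficients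
vanish unless the condition on the degrees holds and `b` is in the coset of `v`. -/
theorem HomogeneousBorcherds.borcherds (h : M.HomogeneousBorcherds) : M.Borcherds := by
  intro r φ a u hu v w b l ν
  refine g.genEigen_induction a
    (Q := fun u => M.defect (M.pairing (M.homDual r φ)) u v w a b l ν = 0) (fun i u hu hui => ?_)
    ?_ (fun x y hx hy => by rw [defect_add₁, hx, hy, add_zero]) hu
  swap
  · have := M.defect_add₁ (M.pairing (M.homDual r φ)) a b l ν 0 0 v w
    rwa [add_zero, left_eq_add] at this
  refine g.homogeneous_induction
    (Q := fun v => M.defect (M.pairing (M.homDual r φ)) u v w a b l ν = 0)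
    (fun b' _ j v hv hvj => ?_)
    ?_ (fun x y hx hy => by rw [defect_add₂, hx, hy, add_zero]) v
  swap
  · have := M.defect_add₂ (M.pairing (M.homDual r φ)) a b l ν u 0 0 w
    rwa [add_zero, left_eq_add] at this
  refine degSpace_induction M.internal
    (Q := fun w => M.defect (M.pairing (M.homDual r φ)) u v w a b l ν = 0) (fun p w hw => ?_)
    ?_ (fun x y hx hy => by rw [defect_add₃, hx, hy, add_zero]) w
  swap
  · have := M.defect_add₃ (M.pairing (M.homDual r φ)) a b l ν u v 0 0
    rwa [add_zero, left_eq_add] at this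
  by_cases hc : a + b = i + j + p - r.1 - 2
  · by_cases hb : ∃ n : ℤ, b = b' + n
    · obtain ⟨n, rfl⟩ := hb
      exact h r φ a _ p i j u hu hui v (by rwa [g.genEigen_add_intCast]) hvj w hw hc l ν
    · push Not at hb
      refine M.defect_eq_zero_of_seq _ _ _ _ _ (fun k => ?_) (fun k => ?_) (fun k => ?_)
      · rw [prodSeq, M.nmode_eq_zero hv, map_zero, map_zero]
        intro n hn
        refine hb (n - k) ?_
        push_cast
        linear_combination hn
      · rw [prodSeq, M.nmode_eq_zero hv, map_zero]
        intro n hn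
        refine hb (n + k) ?_
        push_cast
        linear_combination hn
      · rw [iterNSeq]
        refine (finsum_congr fun n => ?_).trans finsum_zero
        rw [iterSeq, M.nmode_mode_eq_zero (binomN_mem_genEigen hu n) hv, map_zero]
        intro m hm
        refine hb (m + (k + n)) ?_
        push_cast at hm ⊢
        linear_combination hm
  · refine M.defect_eq_zero_of_seq _ _ _ _ _ (fun k => ?_) (fun k => ?_) (fun k => ?_)
    · refine M.pairing_homDual_of_mem r φ ?_ (M.nmode_mem hui (M.nmode_mem hvj hw _) _)
      intro heq
      exact hc (by linear_combination heq)
    · refine M.pairing_homDual_of_mem r φ ?_ (M.nmode_mem hvj (M.nmode_mem hui hw _) _)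
      intro heq
      exact hc (by linear_combination heq)
    · rw [iterNSeq]
      refine (finsum_congr fun n => ?_).trans finsum_zero
      refine M.pairing_homDual_of_mem r φ ?_
        (M.nmode_mem (A.mode_mem_wt (binomN_mem_wt hui n) hvj _) hw _)
      intro heq
      push_cast at heq
      exact hc (by linear_combination heq)

theorem exists_add_mem_P {a : ℂ} {u : V} (hu : u ∈ g.genEigen a) (h0 : u ≠ 0) :
    ∃ n : ℤ, a + n ∈ g.P := by
  refine ⟨-⌊a.re⌋, ?_, ?_, ?_⟩
  · simp only [Complex.add_re, Complex.intCast_re, Int.cast_neg, Complex.neg_re]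
    linarith [Int.floor_le a.re]
  · simp only [Complex.add_re, Complex.intCast_re, Int.cast_neg, Complex.neg_re]
    linarith [Int.lt_floor_add_one a.re]
  · rw [g.genEigen_add_intCast]
    intro hbot
    rw [hbot] at hu
    exact h0 ((Submodule.mem_bot ℂ).1 hu)

theorem defect_zero₁ (f : Module.Dual ℂ W) (a b : ℂ) (l ν : ℤ) (v : V) (w : W) :
    M.defect f 0 v w a b l ν = 0 := by
  have := M.defect_add₁ f a b l ν 0 0 v w
  rwa [add_zero, left_eq_add] at this

theorem defect_zero₂ (f : Module.Dual ℂ W) (a b : ℂ) (l ν : ℤ) (u : V) (w : W) :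
    M.defect f u 0 w a b l ν = 0 := by
  have := M.defect_add₂ f a b l ν u 0 0 w
  rwa [add_zero, left_eq_add] at this

/-! ### The twisted Jacobi identity -/

/-- The coefficients of the twisted Jacobi identity are the Borcherds identities. -/
theorem map_jacobi (f : Module.Dual ℂ W) (u v : V) (w : W) (a b : ℂ) (l ν : ℤ) {a₀ : ℂ}
    (ha : ∃ s : ℤ, a = a₀ + s) :
    f ((mulDelta₁₂ (M.prod₁₂ u v w) - mulDelta₂₁ (M.prod₂₁ u v w) - mulDelta₂₀ a₀ (M.iterN u v w))
      (-l - 1, -(a - ν - l) - 1, -(b + ν) - 1)) = M.defect f u v w a b l ν := by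
  rw [Pi.sub_apply, Pi.sub_apply, map_sub, map_sub, map_mulDelta₁₂, map_mulDelta₂₁,
    M.map_mulDelta₂₀ f u v w a b l ν ha, defect, borcherdsDefect,
    show a + 1 - 1 - ν - l = a - ν - l by ring]

theorem TwistedJacobi.homogeneousBorcherds (h : M.TwistedJacobi) : M.HomogeneousBorcherds := by
  intro r φ a b p i j u hu _ v hv _ w _ _ l ν
  by_cases hu0 : u = 0
  · rw [hu0, defect_zero₁]
  by_cases hv0 : v = 0
  · rw [hv0, defect_zero₂]
  obtain ⟨n, hn⟩ := exists_add_mem_P hu hu0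
  obtain ⟨n', hn'⟩ := exists_add_mem_P hv hv0
  rw [← M.map_jacobi _ u v w a b l ν (a₀ := a + n) ⟨-n, by push_cast; ring⟩,
    h _ hn _ hn' u (by rwa [g.genEigen_add_intCast]) v (by rwa [g.genEigen_add_intCast]) w,
    sub_self, Pi.zero_apply, map_zero]

theorem mulDelta_eq_zero_of_fst (T : ℂ × ℂ × ℂ → W) (c : ℤ × ℕ → ℂ) (d : ℤ × ℕ → ℂ × ℂ)
    (hT : ∀ e : ℂ × ℂ × ℂ, e.1 ≠ 0 → T e = 0) {e : ℂ × ℂ × ℂ} (he : ∀ l : ℤ, e.1 ≠ -(l : ℂ) - 1) :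
    mulSeries c (fun i => (-(i.1 : ℂ) - 1, d i)) T e = 0 := by
  refine (finsum_congr fun q => ?_).trans finsum_zero
  rw [hT, smul_zero]
  exact sub_ne_zero.2 (he q.1)

/-- The Borcherds identities give the coefficients of `x₀^e₀ x₁^e₁ x₂^e₂` with `e₀ ∈ ℤ` and
`e₁ ∈ -a + ℤ`. All other coefficients are zero. -/
theorem Borcherds.twistedJacobi (h : M.Borcherds) : M.TwistedJacobi := by
  intro a _ b _ u hu v _ w
  rw [← sub_eq_zero]
  funext e
  obtain ⟨e₀, e₁, e₂⟩ := e
  by_cases h0 : ∃ l : ℤ, e₀ = -(l : ℂ) - 1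
  · obtain ⟨l, rfl⟩ := h0
    by_cases h1 : ∃ s : ℤ, e₁ = -a + s
    · obtain ⟨s, rfl⟩ := h1
      refine M.eq_zero_of_pairing fun r φ => ?_
      have hj := M.map_jacobi (M.pairing (M.homDual r φ)) u v w (a - s - 1 + l) (-e₂ - 1) l 0
        (a₀ := a) ⟨-s - 1 + l, by push_cast; ring⟩
      rw [h r φ _ u (by
        have := g.genEigen_add_intCast a (-s - 1 + l)
        rw [show a - s - 1 + l = a + ((-s - 1 + l : ℤ) : ℂ) by push_cast; ring, this]
        exact hu)] at hj
      rw [← hj]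
      refine congrArg _ (congrArg _ (Prod.ext rfl (Prod.ext ?_ ?_))) <;> push_cast <;> ring
    · push Not at h1
      have z₁ : mulDelta₁₂ (M.prod₁₂ u v w) (-(l : ℂ) - 1, e₁, e₂) = 0 := by
        refine (finsum_congr fun q => ?_).trans finsum_zero
        rw [prod₁₂, M.coef₀_eq_zero _ hu, ite_self, smul_zero]
        intro k hk
        simp only [Prod.mk_sub_mk] at hk
        refine h1 (k + q.1 - q.2) ?_
        push_cast
        linear_combination hk
      have z₂ : mulDelta₂₁ (M.prod₂₁ u v w) (-(l : ℂ) - 1, e₁, e₂) = 0 := by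
        refine (finsum_congr fun q => ?_).trans finsum_zero
        rw [prod₂₁, M.coef₀_eq_zero (v := u) _ hu, map_zero, ite_self, smul_zero]
        intro k hk
        simp only [Prod.mk_sub_mk] at hk
        refine h1 (k + q.2) ?_
        push_cast
        linear_combination hk
      have z₃ : mulDelta₂₀ a (M.iterN u v w) (-(l : ℂ) - 1, e₁, e₂) = 0 := by
        refine (finsum_congr fun q => ?_).trans finsum_zero
        rw [iterN_eq_zero, smul_zero]
        left
        intro hk
        simp only [Prod.mk_sub_mk] at hk
        refine h1 (-q.1 - 1) ?_
        push_cast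
        linear_combination hk
      rw [Pi.sub_apply, Pi.sub_apply, z₁, z₂, z₃]
      simp
  · push Not at h0
    have z₁ : mulDelta₁₂ (M.prod₁₂ u v w) (e₀, e₁, e₂) = 0 :=
      mulDelta_eq_zero_of_fst _ _ _ (fun e he => if_neg he) h0
    have z₂ : mulDelta₂₁ (M.prod₂₁ u v w) (e₀, e₁, e₂) = 0 :=
      mulDelta_eq_zero_of_fst _ _ _ (fun e he => if_neg he) h0
    have z₃ : mulDelta₂₀ a (M.iterN u v w) (e₀, e₁, e₂) = 0 := by
      refine (finsum_congr fun q => ?_).trans finsum_zero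
      rw [iterN_eq_zero, smul_zero]
      right
      intro j hj
      simp only [Prod.mk_sub_mk] at hj
      refine h0 (j - q.2) ?_
      push_cast
      linear_combination hj
    rw [Pi.sub_apply, Pi.sub_apply, z₁, z₂, z₃]
    simp

/-! ### The commutator formula and weak associativity -/

theorem mulDelta₁₂_neg_one (u v : V) (w : W) (e₁ e₂ : ℂ) :
    mulDelta₁₂ (M.prod₁₂ u v w) (-1, e₁, e₂) = M.coef₀ u e₁ (M.coef₀ v e₂ w) := by
  rw [mulDelta₁₂, mulSeries, finsum_eq_single _ (0, 0)]
  · simp [prod₁₂]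
  · rintro ⟨l, k⟩ hq
    by_cases hl : l = 0
    · subst hl
      have hk : k ≠ 0 := fun hk => hq (by rw [hk])
      simp only [Int.cast_zero]
      rw [Ring.choose_zero_pos ℂ (Nat.pos_of_ne_zero hk), mul_zero, zero_smul]
    · rw [prod₁₂, if_neg, smul_zero]
      simp only [Prod.mk_sub_mk]
      intro h
      have : (l : ℂ) = 0 := by linear_combination h
      exact hl (by exact_mod_cast this)

theorem mulDelta₂₁_neg_one (u v : V) (w : W) (e₁ e₂ : ℂ) :
    mulDelta₂₁ (M.prod₂₁ u v w) (-1, e₁, e₂) = M.coef₀ v e₂ (M.coef₀ u e₁ w) := by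
  rw [mulDelta₂₁, mulSeries, finsum_eq_single _ (0, 0)]
  · simp [prod₂₁]
  · rintro ⟨l, k⟩ hq
    by_cases hl : l = 0
    · subst hl
      have hk : k ≠ 0 := fun hk => hq (by rw [hk])
      simp only [Int.cast_zero]
      rw [Ring.choose_zero_pos ℂ (Nat.pos_of_ne_zero hk), mul_zero, zero_smul]
    · rw [prod₂₁, if_neg, smul_zero]
      simp only [Prod.mk_sub_mk]
      intro h
      have : (l : ℂ) = 0 := by linear_combination h
      exact hl (by exact_mod_cast this)

/-- The commutator formula is the residue of the twisted Jacobi identity. -/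
theorem commutatorFormula_iff : M.CommutatorFormula ↔
    ∀ a ∈ g.P, ∀ b ∈ g.P, ∀ u ∈ g.genEigen a, ∀ v ∈ g.genEigen b, ∀ (w : W) (e₁ e₂ : ℂ),
      (mulDelta₁₂ (M.prod₁₂ u v w) - mulDelta₂₁ (M.prod₂₁ u v w) - mulDelta₂₀ a (M.iterN u v w))
        (-1, e₁, e₂) = 0 := by
  simp only [CommutatorFormula, Pi.sub_apply, mulDelta₁₂_neg_one, mulDelta₂₁_neg_one, sub_eq_zero]

theorem TwistedJacobi.commutatorFormula (h : M.TwistedJacobi) : M.CommutatorFormula := by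
  rw [commutatorFormula_iff]
  intro a ha b hb u hu v hv w e₁ e₂
  rw [h a ha b hb u hu v hv w, sub_self, Pi.zero_apply]

/-- The Borcherds identities for which the product in the opposite order does not contribute. -/
theorem Borcherds.weakAssociativity (h : M.Borcherds) : M.WeakAssociativity := by
  intro a _ u hu v w m hm hw
  obtain ⟨s, rfl⟩ := hm
  funext e
  obtain ⟨e₀, e₁, e₂⟩ := e
  by_cases h1 : e₁ = 0
  · subst h1
    by_cases h0 : ∃ l : ℤ, e₀ = -(l : ℂ) - 1
    · obtain ⟨l, rfl⟩ := h0
      rw [← sub_eq_zero]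
      refine M.eq_zero_of_pairing fun r φ => ?_
      have hd := h r φ (a + s + l) u (by
        have := g.genEigen_add_intCast a (s + l)
        rw [show a + s + l = a + ((s + l : ℤ) : ℂ) by push_cast; ring, this]
        exact hu) v w (-e₂ - 1) l 0
      have hβ : conv (fun i => (-1) ^ i * Ring.choose (l : ℂ) i) (-(0 + l))
          (M.prodSeq (M.pairing (M.homDual r φ)) v u w (-e₂ - 1) (a + s + l)) = 0 := by
        refine (finsum_congr fun i => ?_).trans finsum_zero
        have := hw i
        rw [prodSeq]
        push_cast
        rw [show a + s + l + (-(0 + (l : ℂ)) + i) = a + s + i by ring, this, map_zero, map_zero,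
          mul_zero]
      have h₁ := M.map_mulPow₀₂ (M.pairing (M.homDual r φ)) u v w (a + s + l) (-e₂ - 1) l 0
      have h₂ := M.map_mulPow₂₀ (M.pairing (M.homDual r φ)) u v w (a + s + l) (-e₂ - 1) l 0
      rw [defect, borcherdsDefect, hβ, mul_zero, sub_zero,
        show a + s + (l : ℂ) + 1 - 1 - (0 : ℤ) - l = a + s + l - (0 : ℤ) - l by ring,
        ← h₁, ← h₂] at hd
      rw [Int.cast_zero, show a + s + (l : ℂ) - 0 - l = a + s by ring,
        show -(-e₂ - 1 + 0) - 1 = e₂ by ring] at hd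
      rw [map_sub, hd]
    · push Not at h0
      rw [mulPow₀₂_prodShift_apply]
      refine ((finsum_congr fun i => ?_).trans finsum_zero).trans
        ((finsum_congr fun i => ?_).trans finsum_zero).symm
      · rw [M.coef₀_eq_zero _ hu, smul_zero]
        intro k hk
        refine h0 (-k - s + i - 1) ?_
        push_cast
        linear_combination hk
      · rw [iterN_eq_zero, smul_zero]
        right
        intro j hj
        simp only [Prod.mk_sub_mk] at hj
        refine h0 (j - i) ?_
        push_cast
        linear_combination hj
  · refine ((finsum_congr fun i => ?_).trans finsum_zero).trans
      ((finsum_congr fun i => ?_).trans finsum_zero).symm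
    · rw [prodShift, if_neg (by simpa using h1), smul_zero]
    · rw [iterN_eq_zero _ _ _ _ (Or.inl (by simpa using h1)), smul_zero]

/-- The commutator formula is the Borcherds identity for `l = 0`, and weak associativity is the
Borcherds identity for those `m` for which the second product vanishes. -/
theorem HomogeneousBorcherds.of_commutatorFormula (hc : M.CommutatorFormula)
    (hw : M.WeakAssociativity) : M.HomogeneousBorcherds := by
  rw [commutatorFormula_iff] at hc
  intro r φ a b p i j u hu _ v hv _ w _ _ l ν
  by_cases hu0 : u = 0
  · rw [hu0, defect_zero₁]
  by_cases hv0 : v = 0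
  · rw [hv0, defect_zero₂]
  obtain ⟨n, hn⟩ := exists_add_mem_P hu hu0
  obtain ⟨n', hn'⟩ := exists_add_mem_P hv hv0
  have hun : u ∈ g.genEigen (a + n) := by rwa [g.genEigen_add_intCast]
  have hvn : v ∈ g.genEigen (b + n') := by rwa [g.genEigen_add_intCast]
  obtain ⟨K, hK⟩ := M.exists_nmode_eq_zero u a w
  -- the modes of `u` in the second product have indices `a - ν - l + k` with `k ≥ 0`, so weak
  -- associativity applies with the exponent `a - ν - l` as soon as `ν + l ≤ -K`
  refine borcherdsDefect_eq_zero (M.prodSeq_mem _ _ _ _ _ _) (M.prodSeq_mem _ _ _ _ _ _)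
    (M.iterNSeq_mem _ _ _ _ _) (fun ν => ?_) (-K) (fun l ν hl => ?_) l ν
  · have h := M.map_jacobi (M.pairing (M.homDual r φ)) u v w a b 0 ν (a₀ := a + n)
      ⟨-n, by push_cast; ring⟩
    have h0 : -((0 : ℤ) : ℂ) - 1 = -1 := by simp
    rw [h0, hc _ hn _ hn' u hun v hvn w, map_zero] at h
    exact h.symm
  · have hz : ∀ k : ℕ, M.nmode u (a - ν - l + k) w = 0 := by
      intro k
      have := hK (-ν - l + k) (by omega)
      rw [← this]
      congr 2
      push_cast
      ring
    have h := congrArg (M.pairing (M.homDual r φ)) (congrFun (hw _ hn u hun v w (a - ν - l)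
      ⟨-n - ν - l, by push_cast; ring⟩ hz) (-l - 1, 0, -(b + ν) - 1))
    rw [map_mulPow₀₂, map_mulPow₂₀] at h
    have hβ : conv (fun i => (-1) ^ i * Ring.choose (l : ℂ) i) (-(ν + l))
        (M.prodSeq (M.pairing (M.homDual r φ)) v u w b a) = 0 := by
      refine (finsum_congr fun k => ?_).trans finsum_zero
      rw [prodSeq]
      push_cast
      rw [show a + (-((ν : ℂ) + l) + k) = a - ν - l + k by ring, hz, map_zero, map_zero, mul_zero]
    rw [borcherdsDefect, h, hβ, show a + 1 - 1 - ν - l = a - ν - l by ring]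
    ring

/-! ### The logarithmic shift -/

theorem 𝒩_pow_pow_eq_zero {K : ℕ} {u : V} (hK : ∀ k, K ≤ k → (g.𝒩 ^ k) u = 0) (n : ℕ) :
    ∀ k, K ≤ k → (g.𝒩 ^ k) ((g.𝒩 ^ n) u) = 0 := by
  intro k hk
  rw [← Module.End.mul_apply, ← pow_add, hK _ (by omega)]

/-- Multiplication by `(1 + x)^𝒩 = ∑_k 𝒩^k log(1 + x)^k / k!` in terms of sequences. -/
theorem iterNSeq_eq_sum (f : Module.Dual ℂ W) {K : ℕ} {u : V}
    (hK : ∀ k, K ≤ k → (g.𝒩 ^ k) u = 0) (v : V) (w : W) (c : ℂ) (j : ℤ) :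
    M.iterNSeq f u v w c j = ∑ k ∈ Finset.range K,
      conv (fun i => chooseCoeff i k) j (M.iterSeq f ((g.𝒩 ^ k) u) v w c) := by
  unfold conv
  rw [← finsum_sum_comm _ _ fun k _ => conv_finite_support _ j (M.iterSeq_mem f _ v w c), iterNSeq]
  refine finsum_congr fun i => ?_
  simp only [iterSeq]
  rw [g.binomN_eq_sum hK, A.mode_sum_left, nmode]
  simp only [A.mode_smul_left]
  rw [coef₀_sum_left, map_sum]
  refine Finset.sum_congr rfl fun k _ => ?_
  rw [coef₀_smul_left, map_smul, smul_eq_mul]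
  rfl

/-! ### Sums of the series for homogeneous elements -/

/-- The three sequences of matrix coefficients are the expansions of one rational function. -/
def HasExpansion (f : Module.Dual ℂ W) (u v : V) (w : W) (a b : ℂ) (t : ℕ) (H : ℤ →₀ ℂ) : Prop :=
  M.prodSeq f u v w a b = comb H (expInfty t) ∧ M.prodSeq f v u w b a = comb H (expZero t) ∧
    M.iterNSeq f u v w (a + b) = comb H (expOne (a + 1) t)

theorem Borcherds.exists_hasExpansion (h : M.Borcherds) (r : RightHalfPlane × CModZ)
    (φ : Module.Dual ℂ (bigraded M.comp r)) {a : ℂ} {u : V} (hu : u ∈ g.genEigen a) (v : V) (w : W)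
    (b : ℂ) : ∃ (t : ℕ) (H : ℤ →₀ ℂ),
      M.HasExpansion (M.pairing (M.homDual r φ)) u v w a b t H :=
  exists_eq_comb (M.prodSeq_mem _ _ _ _ _ _) (M.prodSeq_mem _ _ _ _ _ _)
    (M.iterNSeq_mem _ _ _ _ _) (h r φ a u hu v w b)

section Homogeneous

variable {a b p : ℂ} {i j : ℤ} {u v : V} {w : W} {r : RightHalfPlane × CModZ}
  {φ : Module.Dual ℂ (bigraded M.comp r)} {t : ℕ} {H : ℤ →₀ ℂ}

/-- The common value of the series for homogeneous elements, as a function of the logarithms. -/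
def corrFun (a b : ℂ) (t : ℕ) (H : ℤ →₀ ℂ) (ℓ₁ ℓ₂ : ℂ) : ℂ :=
  Complex.exp (-(a + 1) * ℓ₁) * Complex.exp (-(b + 1) * ℓ₂) * ratFun t H (Complex.exp (ℓ₁ - ℓ₂))

theorem HasExpansion.hasSum_productTerm
    (h : M.HasExpansion (M.pairing (M.homDual r φ)) u v w a b t H) (hu : u ∈ A.wt i)
    (hv : v ∈ A.wt j) (hvb : v ∈ g.genEigen b) (hw : w ∈ degSpace M.comp p)
    (hc : a + b = i + j + p - r.1 - 2) {ℓ₁ ℓ₂ : ℂ} (hℓ : ‖Complex.exp ℓ₂‖ < ‖Complex.exp ℓ₁‖) :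
    HasSum (M.productTerm M.Y₀ (M.homDual r φ) u ℓ₁ v ℓ₂ w) (corrFun a b t H ℓ₁ ℓ₂) := by
  rw [M.hasSum_productTerm_iff hu hv hvb hw hc, h.1]
  refine HasSum.mul_left _ ?_
  have hx : 1 < ‖Complex.exp (ℓ₁ - ℓ₂)‖ := by
    rw [Complex.exp_sub, norm_div, one_lt_div (norm_pos_iff.2 (Complex.exp_ne_zero _))]
    exact hℓ
  refine hasSum_of_eq (hasSum_comb_expInfty t H hx) (fun k => ?_) rfl
  rw [Complex.exp_int_mul]

theorem HasExpansion.hasSum_productTerm_reverse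
    (h : M.HasExpansion (M.pairing (M.homDual r φ)) u v w a b t H) (hu : u ∈ A.wt i)
    (hv : v ∈ A.wt j) (hua : u ∈ g.genEigen a) (hw : w ∈ degSpace M.comp p)
    (hc : a + b = i + j + p - r.1 - 2) {ℓ₁ ℓ₂ : ℂ} (hℓ : ‖Complex.exp ℓ₁‖ < ‖Complex.exp ℓ₂‖) :
    HasSum (M.productTerm M.Y₀ (M.homDual r φ) v ℓ₂ u ℓ₁ w) (corrFun a b t H ℓ₁ ℓ₂) := by
  rw [M.hasSum_productTerm_iff (a := b) hv hu hua hw (by linear_combination hc), h.2.1, corrFun,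
    mul_comm (Complex.exp (-(a + 1) * ℓ₁))]
  refine HasSum.mul_left _ ?_
  have hx : ‖Complex.exp (ℓ₁ - ℓ₂)‖ < 1 := by
    rw [Complex.exp_sub, norm_div, div_lt_one (norm_pos_iff.2 (Complex.exp_ne_zero _))]
    exact hℓ
  refine hasSum_of_eq (hasSum_comb_expZero t H (Complex.exp_ne_zero _) hx) (fun k => ?_) rfl
  rw [← Complex.exp_int_mul]
  congr 2
  push_cast
  ring

/-- The sums of the series `⟨w', Y₀(Y(𝒩^k u, z₀)v, z₂)w⟩`, and their relation to the common value
of the other series. -/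
theorem exists_hasSum_iterateTerm {t : ℕ → ℕ} {H : ℕ → ℤ →₀ ℂ}
    (h : ∀ k, M.HasExpansion (M.pairing (M.homDual r φ)) ((g.𝒩 ^ k) u) v w a b (t k) (H k))
    {K : ℕ} (hK : ∀ k, K ≤ k → (g.𝒩 ^ k) u = 0) (hu : u ∈ A.wt i)
    (hv : v ∈ A.wt j) (hw : w ∈ degSpace M.comp p)
    (hc : a + b = i + j + p - r.1 - 2) {z₀ ℓ₂ : ℂ} (hz₀ : z₀ ≠ 0) (hz : ‖z₀‖ < ‖Complex.exp ℓ₂‖) :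
    ∃ ρ : ℕ → ℂ,
      (∀ k, HasSum (M.iterateTerm M.Y₀ (M.homDual r φ) ((g.𝒩 ^ k) u) z₀ v ℓ₂ w) (ρ k)) ∧
      (∀ k, K ≤ k → ρ k = 0) ∧
      ∀ k ℓ₁, ℓ₁ - ℓ₂ = Complex.log (1 + z₀ / Complex.exp ℓ₂) →
        corrFun a b (t k) (H k) ℓ₁ ℓ₂ = ∑ k' ∈ Finset.range K,
          (((k'.factorial : ℂ)⁻¹ * (ℓ₁ - ℓ₂) ^ k') * ρ (k + k')) := by
  set y := z₀ / Complex.exp ℓ₂ with hydef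
  have hy0 : y ≠ 0 := div_ne_zero hz₀ (Complex.exp_ne_zero _)
  have hy : ‖y‖ < 1 := by
    rw [hydef, norm_div, div_lt_one (norm_pos_iff.2 (Complex.exp_ne_zero _))]
    exact hz
  obtain ⟨ρ, hρ, hρK, hρG⟩ := exists_hasSum_of_logShift (K := K)
    (R := fun k => M.iterSeq (M.pairing (M.homDual r φ)) ((g.𝒩 ^ k) u) v w (a + b))
    (Γ := fun k => M.iterNSeq (M.pairing (M.homDual r φ)) ((g.𝒩 ^ k) u) v w (a + b))
    (fun k => M.iterSeq_mem _ _ _ _ _)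
    (fun k hk => by
      funext m
      rw [hK k hk, iterSeq, A.mode_zero_left, nmode, coef₀_zero_left, map_zero]
      rfl)
    (fun k m => by
      rw [M.iterNSeq_eq_sum _ (𝒩_pow_pow_eq_zero hK k)]
      refine Finset.sum_congr rfl fun k' _ => ?_
      rw [← Module.End.mul_apply, ← pow_add, add_comm k' k])
    hy0 hy (G := fun k => (1 + y) ^ (-(a + 1)) * ratFun (t k) (H k) (1 + y))
    (fun k => by
      rw [(h k).2.2]
      exact hasSum_comb_expOne _ _ _ hy0 hy)
  refine ⟨fun k => Complex.exp (-(a + b + 2) * ℓ₂) * ρ k, fun k => ?_, fun k hk => ?_,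
    fun k ℓ₁ hℓ => ?_⟩
  · rw [M.hasSum_iterateTerm_iff (g.𝒩_pow_mem_wt hu k) hv hw hc]
    exact (hρ k).mul_left _
  · simp only [hρK k hk, mul_zero]
  · have h1 := hρG k
    have h1y : 1 + y ≠ 0 := one_add_ne_zero hy
    rw [← hℓ] at h1
    have hexp : Complex.exp (ℓ₁ - ℓ₂) = 1 + y := by rw [hℓ, Complex.exp_log h1y]
    rw [corrFun, hexp]
    rw [Complex.cpow_def_of_ne_zero h1y, ← hℓ] at h1
    have h2 : Complex.exp (-(a + 1) * ℓ₁) * Complex.exp (-(b + 1) * ℓ₂)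
        = Complex.exp (-(a + b + 2) * ℓ₂) * Complex.exp ((ℓ₁ - ℓ₂) * -(a + 1)) := by
      rw [← Complex.exp_add, ← Complex.exp_add]
      congr 1
      ring
    rw [h2, mul_assoc, h1, Finset.mul_sum]
    refine Finset.sum_congr rfl fun k' _ => ?_
    ring

end Homogeneous

end PreTwistedModule

/-! ### Rational functions with poles along `z₁ = 0`, `z₂ = 0` and `z₁ = z₂` -/

/-- A function of `z₁`, `z₂` that agrees with an element of `ℂ[z₁^±, z₂^±, (z₁ - z₂)⁻¹]` wherever
the latter is defined. -/
def IsRational (F : ℂ → ℂ → ℂ) : Prop :=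
  ∃ (n : ℕ) (G : MvPolynomial (Fin 2) ℂ), ∀ z₁ z₂ : ℂ, z₁ ≠ 0 → z₂ ≠ 0 → z₁ - z₂ ≠ 0 →
    F z₁ z₂ * (z₁ * z₂ * (z₁ - z₂)) ^ n = MvPolynomial.eval ![z₁, z₂] G

theorem IsRational.zero : IsRational fun _ _ => 0 := ⟨0, 0, by simp⟩

theorem IsRational.add {F F' : ℂ → ℂ → ℂ} (h : IsRational F) (h' : IsRational F') :
    IsRational fun z₁ z₂ => F z₁ z₂ + F' z₁ z₂ := by
  obtain ⟨n, G, hG⟩ := h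
  obtain ⟨n', G', hG'⟩ := h'
  let D : MvPolynomial (Fin 2) ℂ :=
    MvPolynomial.X 0 * MvPolynomial.X 1 * (MvPolynomial.X 0 - MvPolynomial.X 1)
  refine ⟨n + n', G * D ^ n' + G' * D ^ n, fun z₁ z₂ h1 h2 h3 => ?_⟩
  simp only [D, map_add, map_mul, map_pow, map_sub, MvPolynomial.eval_X, ← hG z₁ z₂ h1 h2 h3,
    ← hG' z₁ z₂ h1 h2 h3, Matrix.cons_val_zero, Matrix.cons_val_one]
  ring

theorem IsRational.const_mul {F : ℂ → ℂ → ℂ} (h : IsRational F) (c : ℂ) :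
    IsRational fun z₁ z₂ => c * F z₁ z₂ := by
  obtain ⟨n, G, hG⟩ := h
  refine ⟨n, MvPolynomial.C c * G, fun z₁ z₂ h1 h2 h3 => ?_⟩
  rw [map_mul, MvPolynomial.eval_C, ← hG z₁ z₂ h1 h2 h3]
  ring

theorem IsRational.zpow (d e : ℤ) (t : ℕ) :
    IsRational fun z₁ z₂ => z₁ ^ d * z₂ ^ e * (z₁ - z₂) ^ (-(t : ℤ)) := by
  set n := d.natAbs + e.natAbs + t with hn
  refine ⟨n, MvPolynomial.X 0 ^ (d + n).toNat * MvPolynomial.X 1 ^ (e + n).toNat *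
    (MvPolynomial.X 0 - MvPolynomial.X 1) ^ (n - t), fun z₁ z₂ h1 h2 h3 => ?_⟩
  simp only [map_mul, map_pow, map_sub, MvPolynomial.eval_X, Matrix.cons_val_zero,
    Matrix.cons_val_one]
  rw [← zpow_natCast z₁, ← zpow_natCast z₂, ← zpow_natCast (z₁ - z₂), ← zpow_natCast (_ * _),
    mul_zpow, mul_zpow, Int.toNat_of_nonneg (by omega), Int.toNat_of_nonneg (by omega),
    zpow_add₀ h1, zpow_add₀ h2, show ((n - t : ℕ) : ℤ) = -(t : ℤ) + n by omega, zpow_add₀ h3]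
  ring

theorem IsRational.congr {F F' : ℂ → ℂ → ℂ} (h : IsRational F)
    (heq : ∀ z₁ z₂ : ℂ, z₁ ≠ 0 → z₂ ≠ 0 → z₁ - z₂ ≠ 0 → F' z₁ z₂ = F z₁ z₂) : IsRational F' := by
  obtain ⟨n, G, hG⟩ := h
  exact ⟨n, G, fun z₁ z₂ h1 h2 h3 => by rw [heq z₁ z₂ h1 h2 h3, hG z₁ z₂ h1 h2 h3]⟩

theorem IsRational.mul_ratFun (d e : ℤ) (t : ℕ) (H : ℤ →₀ ℂ) :
    IsRational fun z₁ z₂ => z₁ ^ d * z₂ ^ e * ratFun t H (z₁ / z₂) := by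
  induction H using Finsupp.induction_linear with
  | zero => simpa [ratFun] using IsRational.zero
  | add H H' h h' =>
    refine (h.add h').congr fun z₁ z₂ _ _ _ => ?_
    rw [ratFun, Finsupp.sum_add_index' (by simp) (by intros; ring), ← ratFun, ← ratFun, mul_add]
  | single k c =>
    refine ((IsRational.zpow (d + k) (e - k + t) t).const_mul c).congr fun z₁ z₂ h1 h2 h3 => ?_
    rw [ratFun, Finsupp.sum_single_index (by simp), div_sub_one h2, div_zpow, div_zpow,
      zpow_add₀ h1, zpow_add₀ h2, zpow_sub₀ h2, zpow_neg z₂, zpow_natCast z₂]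
    field_simp

namespace PreTwistedModule

variable {V : Type*} [AddCommGroup V] [Module ℂ V] {A : VertexOperatorAlgebra V}
  {g : A.Automorphism} {W : Type*} [AddCommGroup W] [Module ℂ W] (M : PreTwistedModule A g W)

/-! ### Duality for `Y^g_0` from the Borcherds identity -/

/-- The three series in the duality property of `Y^g_0` converge to
`e^(-a log z₁) e^(-b log z₂) F(z₁, z₂)`. -/
def HasNonlogSum (a b : ℂ) (u v : V) (w : W) (w' : M.GradedDual) (F : ℂ → ℂ → ℂ) : Prop :=
  ∀ z₁ z₂ : ℂ,
    let f : ℂ := Complex.exp (-a * lp 0 z₁) * Complex.exp (-b * lp 0 z₂) * F z₁ z₂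
    (‖z₂‖ < ‖z₁‖ → 0 < ‖z₂‖ →
      HasSum (M.productTerm M.Y₀ w' u (lp 0 z₁) v (lp 0 z₂) w) f) ∧
    (‖z₁‖ < ‖z₂‖ → 0 < ‖z₁‖ →
      HasSum (M.productTerm M.Y₀ w' v (lp 0 z₂) u (lp 0 z₁) w) f) ∧
    (‖z₁ - z₂‖ < ‖z₂‖ → 0 < ‖z₁ - z₂‖ →
      ∃ S, HasSum (fun q : ℤ × ℕ => ((z₁ - z₂) / z₂) ^ q.2 *
        M.iterateTerm M.Y₀ w' (g.binomN q.2 u) (z₁ - z₂) v (lp 0 z₂) w q.1) S ∧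
        (|arg₀ z₁ - arg₀ z₂| < Real.pi / 2 → S = f))

/-- The duality property of `Y^g_0` for given vectors. -/
def NonlogDualityFor (a b : ℂ) (u v : V) (w : W) (w' : M.GradedDual) : Prop :=
  ∃ F, IsRational F ∧ M.HasNonlogSum a b u v w w' F

theorem nonlogDuality_of_forall (h : ∀ a ∈ g.P, ∀ b ∈ g.P, ∀ u ∈ g.genEigen a, ∀ v ∈ g.genEigen b,
    ∀ (w : W) (w' : M.GradedDual), M.NonlogDualityFor a b u v w w') : M.NonlogDuality := by
  intro a ha b hb u hu v hv w w'
  obtain ⟨F, ⟨n, G, hG⟩, hF⟩ := h a ha b hb u hu v hv w w'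
  refine ⟨G, n, n, n, fun z₁ z₂ => ?_⟩
  have key : z₁ ≠ 0 → z₂ ≠ 0 → z₁ - z₂ ≠ 0 →
      F z₁ z₂ = MvPolynomial.eval ![z₁, z₂] G / (z₁ ^ (n : ℤ) * z₂ ^ (n : ℤ) * (z₁ - z₂) ^ (n : ℤ))
      := by
    intro h1 h2 h3
    rw [← hG z₁ z₂ h1 h2 h3, ← mul_zpow, ← mul_zpow, zpow_natCast, mul_div_assoc, div_self, mul_one]
    exact pow_ne_zero _ (mul_ne_zero (mul_ne_zero h1 h2) h3)
  have hsub : ∀ x y : ℂ, ‖x‖ < ‖y‖ → y - x ≠ 0 := by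
    intro x y hxy h0
    rw [sub_eq_zero.1 h0] at hxy
    exact lt_irrefl _ hxy
  have hf := hF z₁ z₂
  intro f
  refine ⟨fun h1 h2 => ?_, fun h1 h2 => ?_, fun h1 h2 => ?_⟩
  · have := hf.1 h1 h2
    rw [key (norm_pos_iff.1 (h2.trans h1)) (norm_pos_iff.1 h2) (hsub _ _ h1)] at this
    exact ⟨this.summable.norm, this⟩
  · have := hf.2.1 h1 h2
    rw [key (norm_pos_iff.1 h2) (norm_pos_iff.1 (h2.trans h1))
      (by rw [← neg_sub]; exact neg_ne_zero.2 (hsub _ _ h1))] at this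
    exact ⟨this.summable.norm, this⟩
  · obtain ⟨S, hS, hSf⟩ := hf.2.2 h1 h2
    refine ⟨hS.summable.norm, fun harg => ?_⟩
    rw [hSf harg] at hS
    have h20 : z₂ ≠ 0 := norm_pos_iff.1 (h2.trans h1)
    have h10 : z₁ ≠ 0 := by
      rintro rfl
      rw [zero_sub, norm_neg] at h1
      exact lt_irrefl _ h1
    rw [key h10 h20 (norm_pos_iff.1 h2)] at hS
    exact hS

/-- The sums of the series add up whenever their terms do. -/
theorem NonlogDualityFor.add_of {a b : ℂ} {u u' u'' v v' v'' : V} {w x y : W}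
    {w' x' y' : M.GradedDual} (h : M.NonlogDualityFor a b u v w w')
    (h' : M.NonlogDualityFor a b u' v' x x')
    (hprod : ∀ ℓ₁ ℓ₂ q, M.productTerm M.Y₀ y' u'' ℓ₁ v'' ℓ₂ y q
      = M.productTerm M.Y₀ w' u ℓ₁ v ℓ₂ w q + M.productTerm M.Y₀ x' u' ℓ₁ v' ℓ₂ x q)
    (hrev : ∀ ℓ₁ ℓ₂ q, M.productTerm M.Y₀ y' v'' ℓ₂ u'' ℓ₁ y q
      = M.productTerm M.Y₀ w' v ℓ₂ u ℓ₁ w q + M.productTerm M.Y₀ x' v' ℓ₂ u' ℓ₁ x q)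
    (hiter : ∀ z₀ ℓ₂ n i, M.iterateTerm M.Y₀ y' (g.binomN i u'') z₀ v'' ℓ₂ y n
      = M.iterateTerm M.Y₀ w' (g.binomN i u) z₀ v ℓ₂ w n
        + M.iterateTerm M.Y₀ x' (g.binomN i u') z₀ v' ℓ₂ x n) :
    M.NonlogDualityFor a b u'' v'' y y' := by
  obtain ⟨F, hF, hS⟩ := h
  obtain ⟨F', hF', hS'⟩ := h'
  refine ⟨_, hF.add hF', fun z₁ z₂ => ?_⟩
  have h1 := hS z₁ z₂
  have h2 := hS' z₁ z₂
  intro f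
  refine ⟨fun ha hb => ?_, fun ha hb => ?_, fun ha hb => ?_⟩
  · exact hasSum_of_eq ((h1.1 ha hb).add (h2.1 ha hb)) (fun q => hprod _ _ _) (mul_add _ _ _)
  · exact hasSum_of_eq ((h1.2.1 ha hb).add (h2.2.1 ha hb)) (fun q => hrev _ _ _) (mul_add _ _ _)
  · obtain ⟨S, hs, hsf⟩ := h1.2.2 ha hb
    obtain ⟨S', hs', hsf'⟩ := h2.2.2 ha hb
    refine ⟨S + S', hasSum_of_eq (hs.add hs') (fun q => ?_) rfl, fun harg => ?_⟩
    · rw [hiter, mul_add]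
    · rw [hsf harg, hsf' harg]
      exact (mul_add _ _ _).symm

theorem NonlogDualityFor.of_eq_zero {a b : ℂ} {u v : V} {w : W} {w' : M.GradedDual}
    (hprod : ∀ ℓ₁ ℓ₂ q, M.productTerm M.Y₀ w' u ℓ₁ v ℓ₂ w q = 0)
    (hrev : ∀ ℓ₁ ℓ₂ q, M.productTerm M.Y₀ w' v ℓ₂ u ℓ₁ w q = 0)
    (hiter : ∀ z₀ ℓ₂ n i, M.iterateTerm M.Y₀ w' (g.binomN i u) z₀ v ℓ₂ w n = 0) :
    M.NonlogDualityFor a b u v w w' := by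
  refine ⟨_, IsRational.zero, fun z₁ z₂ => ?_⟩
  refine ⟨fun ha hb => ?_, fun ha hb => ?_, fun ha hb => ⟨0, ?_, fun _ => (mul_zero _).symm⟩⟩
  · exact hasSum_of_eq hasSum_zero (fun q => hprod _ _ _) (mul_zero _)
  · exact hasSum_of_eq hasSum_zero (fun q => hrev _ _ _) (mul_zero _)
  · exact hasSum_of_eq hasSum_zero (fun q => by rw [hiter, mul_zero]) rfl

theorem one_add_sub_div {z₁ z₂ : ℂ} (h2 : z₂ ≠ 0) : 1 + (z₁ - z₂) / z₂ = z₁ / z₂ := by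
  field_simp
  ring

/-- The three series are expansions of one rational function of `z₁/z₂`. The factor `(1 + x)^𝒩` in
the third one is expanded in powers of `log(1 + x)`. -/
theorem Borcherds.nonlogDualityFor_of_mem (h : M.Borcherds) {a b p : ℂ} {i j : ℤ} {u v : V} {w : W}
    (hua : u ∈ g.genEigen a) (hui : u ∈ A.wt i) (hvb : v ∈ g.genEigen b) (hvj : v ∈ A.wt j)
    (hw : w ∈ degSpace M.comp p) (r : RightHalfPlane × CModZ)
    (φ : Module.Dual ℂ (bigraded M.comp r)) :
    M.NonlogDualityFor a b u v w (M.homDual r φ) := by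
  by_cases hc : ∃ k : ℤ, a + b + k = i + j + p - r.1 - 2
  swap
  · push Not at hc
    refine NonlogDualityFor.of_eq_zero M
      (fun ℓ₁ ℓ₂ q => M.productTerm_eq_zero hui hvj hua hvb hw hc ℓ₁ ℓ₂ q)
      (fun ℓ₁ ℓ₂ q => M.productTerm_eq_zero hvj hui hvb hua hw (fun k hk => hc k ?_) ℓ₂ ℓ₁ q)
      (fun z₀ ℓ₂ n i => M.iterateTerm_eq_zero (binomN_mem_wt hui i) hvj
        (binomN_mem_genEigen hua i) hvb hw hc z₀ ℓ₂ n)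
    linear_combination hk
  obtain ⟨n, hn⟩ := hc
  have hua' : u ∈ g.genEigen (a + n) := by rwa [g.genEigen_add_intCast]
  have hc : a + n + b = i + j + p - r.1 - 2 := by linear_combination hn
  choose t H hE using fun k : ℕ =>
    h.exists_hasExpansion M r φ (g.𝒩_pow_mem_genEigen hua' k) v w b
  have hE0 : M.HasExpansion (M.pairing (M.homDual r φ)) u v w (a + n) b (t 0) (H 0) := hE 0
  obtain ⟨K, hK⟩ := g.exists_𝒩_pow_eq_zero u
  have hcorr : ∀ z₁ z₂ : ℂ, z₁ ≠ 0 → z₂ ≠ 0 → corrFun (a + n) b (t 0) (H 0) (lp 0 z₁) (lp 0 z₂)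
      = Complex.exp (-a * lp 0 z₁) * Complex.exp (-b * lp 0 z₂) *
        (z₁ ^ (-n - 1) * z₂ ^ (-1 : ℤ) * ratFun (t 0) (H 0) (z₁ / z₂)) := by
    intro z₁ z₂ h1 h2
    have e1 : Complex.exp (-(a + n + 1) * lp 0 z₁)
        = Complex.exp (-a * lp 0 z₁) * z₁ ^ (-n - 1) := by
      conv_rhs => rw [← exp_lp 0 h1, ← Complex.exp_int_mul, exp_lp 0 h1, ← Complex.exp_add]
      congr 1
      push_cast
      ring
    have e2 : Complex.exp (-(b + 1) * lp 0 z₂) = Complex.exp (-b * lp 0 z₂) * z₂ ^ (-1 : ℤ) := by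
      conv_rhs => rw [← exp_lp 0 h2, ← Complex.exp_int_mul, exp_lp 0 h2, ← Complex.exp_add]
      congr 1
      push_cast
      ring
    rw [corrFun, e1, e2, Complex.exp_sub, exp_lp 0 h1, exp_lp 0 h2]
    ring
  refine ⟨_, IsRational.mul_ratFun (-n - 1) (-1) (t 0) (H 0), fun z₁ z₂ => ?_⟩
  intro f
  refine ⟨fun h1 h2 => ?_, fun h1 h2 => ?_, fun h1 h2 => ?_⟩
  · have h20 := norm_pos_iff.1 h2
    have h10 := norm_pos_iff.1 (h2.trans h1)
    have := hE0.hasSum_productTerm M hui hvj hvb hw hc (ℓ₁ := lp 0 z₁) (ℓ₂ := lp 0 z₂)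
      (by rwa [exp_lp 0 h10, exp_lp 0 h20])
    rwa [hcorr z₁ z₂ h10 h20] at this
  · have h10 := norm_pos_iff.1 h2
    have h20 := norm_pos_iff.1 (h2.trans h1)
    have := hE0.hasSum_productTerm_reverse M hui hvj hua' hw hc (ℓ₁ := lp 0 z₁) (ℓ₂ := lp 0 z₂)
      (by rwa [exp_lp 0 h10, exp_lp 0 h20])
    rwa [hcorr z₁ z₂ h10 h20] at this
  · have h20 := norm_pos_iff.1 (h2.trans h1)
    have h10 : z₁ ≠ 0 := by
      rintro rfl
      rw [zero_sub, norm_neg] at h1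
      exact lt_irrefl _ h1
    obtain ⟨ρ, hρ, hρK, hsum⟩ := M.exists_hasSum_iterateTerm hE hK hui hvj hw hc
      (ℓ₂ := lp 0 z₂) (norm_pos_iff.1 h2) (by rwa [exp_lp 0 h20])
    have hy : ‖(z₁ - z₂) / z₂‖ < 1 := by
      rw [norm_div, div_lt_one (h2.trans h1)]
      exact h1
    refine ⟨∑ k ∈ Finset.range K, ρ k * ((k.factorial : ℂ)⁻¹ *
      Complex.log (1 + (z₁ - z₂) / z₂) ^ k), ?_, fun harg => ?_⟩
    · refine hasSum_of_eq (hasSum_sum fun k _ =>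
        hasSum_mul_prod (hρ k) (hasSum_chooseCoeff k hy)) (fun q => ?_) rfl
      rw [g.binomN_eq_sum hK, M.iterateTerm_sum₁ M.isGraded_Y₀, Finset.mul_sum]
      refine Finset.sum_congr rfl fun k _ => ?_
      ring
    · have hlog : lp 0 z₁ - lp 0 z₂ = Complex.log (z₁ / z₂) := lp_sub_lp 0 h10 h20 harg
      have h0 := hsum 0 (lp 0 z₁) (by rw [exp_lp 0 h20, one_add_sub_div h20, hlog])
      rw [hcorr z₁ z₂ h10 h20] at h0
      refine Eq.trans ?_ h0.symm
      refine Finset.sum_congr rfl fun k _ => ?_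
      rw [zero_add, one_add_sub_div h20, hlog]
      ring

/-- All terms are additive in `u`, `v`, `w`, `w'`, and the sums can be added. -/
theorem Borcherds.nonlogDuality (h : M.Borcherds) : M.NonlogDuality := by
  refine M.nonlogDuality_of_forall fun a _ b _ u hu v hv w w' => ?_
  refine g.genEigen_induction a (Q := fun u => M.NonlogDualityFor a b u v w w')
    (fun i u hu hui => ?_) ?_ (fun x y hx hy => hx.add_of M hy ?_ ?_ ?_) hu
  rotate_left
  · refine NonlogDualityFor.of_eq_zero M (fun _ _ _ => ?_) (fun _ _ _ => ?_) (fun _ _ _ _ => ?_)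
    · simp [M.productTerm_eq M.isGraded_Y₀]
    · simp [M.productTerm_eq M.isGraded_Y₀]
    · simp [M.iterateTerm_eq M.isGraded_Y₀]
  · exact fun _ _ _ => M.productTerm_add₁ M.isGraded_Y₀ _ _ _ _ _ _ _ _
  · exact fun _ _ _ => M.productTerm_add₂ M.isGraded_Y₀ _ _ _ _ _ _ _ _
  · exact fun _ _ _ _ => by rw [map_add]; exact M.iterateTerm_add₁ M.isGraded_Y₀ _ _ _ _ _ _ _ _
  refine g.genEigen_induction b (Q := fun v => M.NonlogDualityFor a b u v w w')
    (fun j v hv hvj => ?_) ?_ (fun x y hx hy => hx.add_of M hy ?_ ?_ ?_) hv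
  rotate_left
  · refine NonlogDualityFor.of_eq_zero M (fun _ _ _ => ?_) (fun _ _ _ => ?_) (fun _ _ _ _ => ?_)
    · simp [M.productTerm_eq M.isGraded_Y₀]
    · simp [M.productTerm_eq M.isGraded_Y₀]
    · simp [M.iterateTerm_eq M.isGraded_Y₀]
  · exact fun _ _ _ => M.productTerm_add₂ M.isGraded_Y₀ _ _ _ _ _ _ _ _
  · exact fun _ _ _ => M.productTerm_add₁ M.isGraded_Y₀ _ _ _ _ _ _ _ _
  · exact fun _ _ _ _ => M.iterateTerm_add₂ M.isGraded_Y₀ _ _ _ _ _ _ _ _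
  refine degSpace_induction M.internal (Q := fun w => M.NonlogDualityFor a b u v w w')
    (fun p w hw => ?_) ?_ (fun x y hx hy => hx.add_of M hy ?_ ?_ ?_) w
  rotate_left
  · refine NonlogDualityFor.of_eq_zero M (fun _ _ _ => ?_) (fun _ _ _ => ?_) (fun _ _ _ _ => ?_)
    · simp [M.productTerm_eq M.isGraded_Y₀]
    · simp [M.productTerm_eq M.isGraded_Y₀]
    · simp [M.iterateTerm_eq M.isGraded_Y₀]
  · exact fun _ _ _ => M.productTerm_add₃ M.isGraded_Y₀ _ _ _ _ _ _ _ _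
  · exact fun _ _ _ => M.productTerm_add₃ M.isGraded_Y₀ _ _ _ _ _ _ _ _
  · exact fun _ _ _ _ => M.iterateTerm_add₃ M.isGraded_Y₀ _ _ _ _ _ _ _ _
  refine M.gradedDual_induction (Q := fun w' => M.NonlogDualityFor a b u v w w')
    (fun r φ => ?_) ?_ (fun x y hx hy => hx.add_of M hy ?_ ?_ ?_) w'
  rotate_left
  · refine NonlogDualityFor.of_eq_zero M (fun _ _ _ => ?_) (fun _ _ _ => ?_) (fun _ _ _ _ => ?_)
    · simp [M.productTerm_eq M.isGraded_Y₀]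
    · simp [M.productTerm_eq M.isGraded_Y₀]
    · simp [M.iterateTerm_eq M.isGraded_Y₀]
  · exact fun _ _ _ => M.productTerm_add_dual M.isGraded_Y₀ _ _ _ _ _ _ _ _
  · exact fun _ _ _ => M.productTerm_add_dual M.isGraded_Y₀ _ _ _ _ _ _ _ _
  · exact fun _ _ _ _ => M.iterateTerm_add_dual M.isGraded_Y₀ _ _ _ _ _ _ _ _
  exact h.nonlogDualityFor_of_mem M hu hui hv hvj hw r φ

end PreTwistedModule

/-! ### The Borcherds identity from duality -/

theorem eval_mem_expPoly (G : MvPolynomial (Fin 2) ℂ) :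
    (fun ℓ => MvPolynomial.eval ![Complex.exp ℓ, 1] G) ∈ expPoly := by
  induction G using MvPolynomial.induction_on with
  | C c => simpa using const_mem_expPoly c
  | add p q hp hq =>
    simp only [map_add]
    exact expPoly.add_mem hp hq
  | mul_X p i hp =>
    simp only [map_mul, MvPolynomial.eval_X]
    refine expPoly.mul_mem hp ?_
    fin_cases i
    · simpa using exp_mem_expPoly 1
    · simpa using const_mem_expPoly 1

namespace PreTwistedModule

variable {V : Type*} [AddCommGroup V] [Module ℂ V] {A : VertexOperatorAlgebra V}
  {g : A.Automorphism} {W : Type*} [AddCommGroup W] [Module ℂ W] (M : PreTwistedModule A g W)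

/-- If the three series at `z₂ = 1` and `z₁ > 0` have the same sum, of the form
`F(log z₁)(z₁ - 1)^(-t)` with an exponential polynomial `F`, the Borcherds identity holds. -/
theorem defect_eq_zero_of_hasSum {a b p : ℂ} {i j : ℤ} {u v : V} {w : W}
    {r : RightHalfPlane × CModZ} {φ : Module.Dual ℂ (bigraded M.comp r)}
    (hua : u ∈ g.genEigen a) (hui : u ∈ A.wt i) (hvb : v ∈ g.genEigen b) (hvj : v ∈ A.wt j)
    (hw : w ∈ degSpace M.comp p) (hc : a + b = i + j + p - r.1 - 2) {F : ℂ → ℂ} (hF : F ∈ expPoly)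
    (t : ℕ)
    (hinf : ∀ ℓ : ℝ, 0 < ℓ → HasSum (M.productTerm M.Y₀ (M.homDual r φ) u ℓ v 0 w)
      (F ℓ * (Complex.exp ℓ - 1) ^ (-(t : ℤ))))
    (hzero : ∀ ℓ : ℝ, ℓ < 0 → HasSum (M.productTerm M.Y₀ (M.homDual r φ) v 0 u ℓ w)
      (F ℓ * (Complex.exp ℓ - 1) ^ (-(t : ℤ))))
    (hone : ∀ ℓ : ℝ, 0 < ℓ → ℓ < Real.log 2 →
      HasSum (fun k => M.iterNSeq (M.pairing (M.homDual r φ)) u v w (a + b) k *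
        (Complex.exp ℓ - 1) ^ (-k - 1)) (F ℓ * (Complex.exp ℓ - 1) ^ (-(t : ℤ)))) (l ν : ℤ) :
    M.defect (M.pairing (M.homDual r φ)) u v w a b l ν = 0 := by
  have hexp : ∀ ℓ : ℂ, Complex.exp ((a + 1) * ℓ) * Complex.exp (-(a + 1) * ℓ) = 1 := by
    intro ℓ
    rw [← Complex.exp_add, neg_mul, add_neg_cancel, Complex.exp_zero]
  refine borcherdsDefect_eq_zero_of_hasSum (F := fun ℓ => Complex.exp ((a + 1) * ℓ) * F ℓ)
    (M.prodSeq_mem _ _ _ _ _ _) (M.prodSeq_mem _ _ _ _ _ _) (M.iterNSeq_mem _ _ _ _ _)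
    (expPoly.mul_mem (exp_mem_expPoly _) hF) t (fun ℓ hℓ => ?_) (fun ℓ hℓ => ?_)
    (fun ℓ hℓ hℓ' => ?_) l ν
  · have h := hinf ℓ hℓ
    rw [M.hasSum_productTerm_iff hui hvj hvb hw hc] at h
    refine hasSum_of_eq (h.mul_left (Complex.exp ((a + 1) * ℓ))) (fun k => ?_) (mul_assoc _ _ _)
    rw [mul_zero, Complex.exp_zero, mul_one, ← mul_assoc, hexp, one_mul, sub_zero]
  · have h := hzero ℓ hℓ
    rw [M.hasSum_productTerm_iff (a := b) hvj hui hua hw (by linear_combination hc)] at h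
    refine hasSum_of_eq (h.mul_left (Complex.exp ((a + 1) * ℓ))) (fun k => ?_) (mul_assoc _ _ _)
    rw [mul_zero, Complex.exp_zero, one_mul, ← mul_assoc, hexp, one_mul, zero_sub, mul_neg, neg_mul]
  · refine hasSum_of_eq (hone ℓ hℓ hℓ') (fun _ => rfl) ?_
    rw [← mul_assoc, ← mul_assoc, mul_comm (Complex.exp (-(a + 1) * ℓ)), hexp, one_mul]

theorem norm_exp_ofReal (ℓ : ℝ) : ‖Complex.exp ℓ‖ = Real.exp ℓ := by
  rw [← Complex.ofReal_exp, Complex.norm_real, Real.norm_of_nonneg (Real.exp_pos _).le]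

theorem norm_exp_ofReal_sub_one {ℓ : ℝ} (hℓ : 0 < ℓ) : ‖Complex.exp ℓ - 1‖ = Real.exp ℓ - 1 := by
  have : Complex.exp ℓ - 1 = ((Real.exp ℓ - 1 : ℝ) : ℂ) := by push_cast; rfl
  rw [this, Complex.norm_real, Real.norm_of_nonneg]
  linarith [Real.add_one_le_exp ℓ]

/-- Duality of `Y^g_0` is used at `z₂ = 1` and `z₁ > 0` only. The third series is summed over pairs
`(n, j)`, and grouping it by the power of `z₁ - 1` gives the sequence of the Borcherds identity. -/
theorem NonlogDuality.homogeneousBorcherds (h : M.NonlogDuality) : M.HomogeneousBorcherds := by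
  intro r φ a b p i j u hua hui v hvb hvj w hw hc l ν
  by_cases hu0 : u = 0
  · rw [hu0, defect_zero₁]
  by_cases hv0 : v = 0
  · rw [hv0, defect_zero₂]
  obtain ⟨n, hn⟩ := exists_add_mem_P hua hu0
  obtain ⟨n', hn'⟩ := exists_add_mem_P hvb hv0
  obtain ⟨G, d, s, t, hG⟩ := h _ hn _ hn' u (by rwa [g.genEigen_add_intCast]) v
    (by rwa [g.genEigen_add_intCast]) w (M.homDual r φ)
  have hF : (fun ℓ => Complex.exp (-(a + n + d) * ℓ) * MvPolynomial.eval ![Complex.exp ℓ, 1] G *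
      (Complex.exp ℓ - 1) ^ (-t).toNat) ∈ expPoly := by
    refine expPoly.mul_mem (expPoly.mul_mem (exp_mem_expPoly _) (eval_mem_expPoly G))
      (expPoly.pow_mem (expPoly.sub_mem ?_ (const_mem_expPoly 1)) _)
    simpa using exp_mem_expPoly 1
  have hval : ∀ ℓ : ℝ, ℓ ≠ 0 → Complex.exp (-(a + n + d) * ℓ) *
      MvPolynomial.eval ![Complex.exp ℓ, 1] G * (Complex.exp ℓ - 1) ^ (-t).toNat *
        (Complex.exp ℓ - 1) ^ (-(t.toNat : ℤ))
      = Complex.exp (-(a + n) * ℓ) * Complex.exp (-(b + n') * 0) *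
        (MvPolynomial.eval ![Complex.exp ℓ, 1] G /
          (Complex.exp ℓ ^ d * 1 ^ s * (Complex.exp ℓ - 1) ^ t)) := by
    intro ℓ hℓ
    have h1 := exp_ofReal_ne_one hℓ
    have h2 : (Complex.exp ℓ - 1) ^ (-t).toNat * (Complex.exp ℓ - 1) ^ (-(t.toNat : ℤ))
        = ((Complex.exp ℓ - 1) ^ t)⁻¹ := by
      rw [← zpow_natCast, ← zpow_add₀ h1, ← zpow_neg]
      congr 1
      omega
    rw [mul_assoc _ (_ ^ (-t).toNat), h2, mul_zero, Complex.exp_zero, mul_one, one_zpow, mul_one,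
      ← Complex.exp_int_mul, neg_add (a + n), add_mul, Complex.exp_add, div_eq_mul_inv, mul_inv,
      ← Complex.exp_neg, neg_mul (d : ℂ)]
    ring
  have hlt : ∀ ℓ : ℝ, 0 < ℓ → 1 < ‖Complex.exp ℓ‖ := fun ℓ hℓ => by
    rw [norm_exp_ofReal]
    exact Real.one_lt_exp_iff.2 hℓ
  refine M.defect_eq_zero_of_hasSum hua hui hvb hvj hw hc hF t.toNat (fun ℓ hℓ => ?_)
    (fun ℓ hℓ => ?_) (fun ℓ hℓ hℓ' => ?_) l ν
  · have h1 := ((hG (Complex.exp ℓ) 1).1 (by simpa using hlt ℓ hℓ) (by simp)).2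
    rw [lp_zero_ofReal_exp, lp_zero_one, ← hval ℓ hℓ.ne'] at h1
    exact h1
  · have h1 := ((hG (Complex.exp ℓ) 1).2.1 (by
      rw [norm_exp_ofReal, norm_one]
      exact Real.exp_lt_one_iff.2 hℓ) (by
      rw [norm_exp_ofReal]
      exact Real.exp_pos _)).2
    rw [lp_zero_ofReal_exp, lp_zero_one, ← hval ℓ hℓ.ne] at h1
    exact h1
  · have hy0 := exp_ofReal_ne_one hℓ.ne'
    have h1 := ((hG (Complex.exp ℓ) 1).2.2 (by
      rw [norm_exp_ofReal_sub_one hℓ, norm_one]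
      have := Real.exp_lt_exp.2 hℓ'
      rw [Real.exp_log (by norm_num)] at this
      linarith) (norm_pos_iff.2 hy0)).2 (by
      rw [arg₀_ofReal_exp, arg₀_one, sub_zero, abs_zero]
      exact half_pos Real.pi_pos)
    rw [lp_zero_ofReal_exp, lp_zero_one, ← hval ℓ hℓ.ne'] at h1
    obtain ⟨J, hJ⟩ := exists_iterSeq_eq_zero (g := g) u v
    refine hasSum_regroup (J := J) (T := fun m k =>
      M.iterSeq (M.pairing (M.homDual r φ)) (g.binomN k u) v w (a + b) m) (fun m k hm => ?_) ?_
    · rw [iterSeq, hJ k m hm, nmode, coef₀_zero_left, map_zero]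
    · let e : ℤ × ℕ ≃ ℤ × ℕ := (Equiv.subLeft (i + j - 1)).prodCongr (Equiv.refl ℕ)
      rw [← e.hasSum_iff] at h1
      refine hasSum_of_eq h1 (fun q => ?_) rfl
      obtain ⟨m, k⟩ := q
      have h2 := M.iterateTerm_eq_zpow (r := r) (φ := φ) (binomN_mem_wt (g := g) hui k) hvj hw hc
        (Complex.exp ℓ - 1) 0 m
      simp only [Function.comp_apply, e, Equiv.prodCongr_apply, Prod.map, Equiv.subLeft_apply,
        Equiv.refl_apply]
      rw [show i + j - 1 - m = i + j - m - 1 by ring, h2, mul_zero, Complex.exp_zero, div_one,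
        one_mul, show (k : ℤ) - m - 1 = k + (-m - 1) by ring, zpow_add₀ hy0, zpow_natCast]
      ring

/-- The identity `Y^g_0(u, z₁) = Y^g(z₁^𝒩 u, z₁)` in a product with `z₂ = 1`. -/
theorem productTerm_Y₀_eq_sum {a b : ℂ} {u v : V} (hu : u ∈ g.genEigen a) (hv : v ∈ g.genEigen b)
    {K : ℕ} (hK : ∀ k, K ≤ k → (g.𝒩 ^ k) u = 0) (w' : M.GradedDual) (ℓ : ℂ) (w : W) (q : ℂ) :
    M.productTerm M.Y₀ w' u ℓ v 0 w q = ∑ k ∈ Finset.range K,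
      ((k.factorial : ℂ)⁻¹ * ℓ ^ k) * M.productTerm M.Yg w' ((g.𝒩 ^ k) u) ℓ v 0 w q := by
  have h := M.productTerm_Yg (g.expN_mem (g.𝒩_pow_mem_genEigen hu) ℓ) hv w' ℓ 0 w q
  rw [g.expN_add, neg_add_cancel, neg_zero, g.expN_zero, g.expN_zero] at h
  rw [← h, g.expN_eq_sum hK, M.productTerm_sum₁ M.isGraded_Yg]

/-- The identity `Y^g_0(u, z₁) = Y^g(z₁^𝒩 u, z₁)` in a product with `z₂ = 1`. -/
theorem productTerm_Y₀_reverse_eq_sum {a b : ℂ} {u v : V} (hu : u ∈ g.genEigen a)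
    (hv : v ∈ g.genEigen b) {K : ℕ} (hK : ∀ k, K ≤ k → (g.𝒩 ^ k) u = 0) (w' : M.GradedDual)
    (ℓ : ℂ) (w : W) (q : ℂ) :
    M.productTerm M.Y₀ w' v 0 u ℓ w q = ∑ k ∈ Finset.range K,
      ((k.factorial : ℂ)⁻¹ * ℓ ^ k) * M.productTerm M.Yg w' v 0 ((g.𝒩 ^ k) u) ℓ w q := by
  have h := M.productTerm_Yg hv (g.expN_mem (g.𝒩_pow_mem_genEigen hu) ℓ) w' 0 ℓ w q
  rw [g.expN_add, neg_add_cancel, neg_zero, g.expN_zero, g.expN_zero] at h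
  rw [← h, g.expN_eq_sum hK, M.productTerm_sum₂ M.isGraded_Yg]

/-- Duality of `Y^g` is used on the principal branch at `z₂ = 1` and `z₁ = e^ℓ > 0` only, for all
vectors `𝒩^k u`. Since `Y^g_0(u, z₁) = Y^g(z₁^𝒩 u, z₁)`, the sums for `Y^g_0` are combinations of
those for `Y^g` with coefficients `ℓ^k / k!`. -/
theorem Duality.homogeneousBorcherds (h : M.Duality) : M.HomogeneousBorcherds := by
  intro r φ a b p i j u hua hui v hvb hvj w hw hc l ν
  obtain ⟨K, hK⟩ := g.exists_𝒩_pow_eq_zero u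
  choose N c m n t ht hD using fun k : ℕ => h ((g.𝒩 ^ k) u) v w (M.homDual r φ)
  set F : ℕ → ℂ → ℂ := fun q ℓ => ∑ i ∈ Finset.range (N q + 1), ∑ j ∈ Finset.range (N q + 1),
    ∑ k ∈ Finset.range (N q + 1), ∑ l ∈ Finset.range (N q + 1),
      c q i j k l * Complex.exp (m q i * ℓ) * Complex.exp (n q j * 0) * ℓ ^ k * 0 ^ l with hF
  have hFmem : ∀ q, F q ∈ expPoly := by
    intro q
    have : F q = ∑ i ∈ Finset.range (N q + 1), ∑ j ∈ Finset.range (N q + 1),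
        ∑ k ∈ Finset.range (N q + 1), ∑ l ∈ Finset.range (N q + 1), fun ℓ : ℂ =>
          c q i j k l * Complex.exp (m q i * ℓ) * Complex.exp (n q j * 0) * ℓ ^ k * 0 ^ l := by
      funext ℓ
      simp only [hF, Finset.sum_apply]
    rw [this]
    refine expPoly.sum_mem fun i _ => expPoly.sum_mem fun j _ => expPoly.sum_mem fun k _ =>
      expPoly.sum_mem fun l _ => ?_
    exact expPoly.mul_mem (expPoly.mul_mem (expPoly.mul_mem (expPoly.mul_mem (const_mem_expPoly _)
      (exp_mem_expPoly _)) (const_mem_expPoly _)) (expPoly.pow_mem id_mem_expPoly k))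
      (const_mem_expPoly _)
  have hval : ∀ q (ℓ : ℝ), (∑ i ∈ Finset.range (N q + 1), ∑ j ∈ Finset.range (N q + 1),
      ∑ k ∈ Finset.range (N q + 1), ∑ l ∈ Finset.range (N q + 1),
        c q i j k l * Complex.exp (m q i * lp 0 (Complex.exp ℓ)) * Complex.exp (n q j * lp 0 1) *
          lp 0 (Complex.exp ℓ) ^ k * lp 0 1 ^ l * (Complex.exp ℓ - 1) ^ (-(t q : ℤ)))
        = F q ℓ * (Complex.exp ℓ - 1) ^ (-(t q : ℤ)) := by
    intro q ℓ
    simp only [hF, Finset.sum_mul, lp_zero_ofReal_exp, lp_zero_one]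
  set T := ∑ k ∈ Finset.range K, t k with hT
  have hle : ∀ k ∈ Finset.range K, t k ≤ T := fun k hk =>
    Finset.single_le_sum (f := t) (fun _ _ => Nat.zero_le _) hk
  have hG : (fun ℓ : ℂ => ∑ k ∈ Finset.range K, ((k.factorial : ℂ)⁻¹ * ℓ ^ k) *
      (F k ℓ * (Complex.exp ℓ - 1) ^ (T - t k))) ∈ expPoly := by
    have : (fun ℓ : ℂ => ∑ k ∈ Finset.range K, ((k.factorial : ℂ)⁻¹ * ℓ ^ k) *
        (F k ℓ * (Complex.exp ℓ - 1) ^ (T - t k))) = ∑ k ∈ Finset.range K, fun ℓ : ℂ =>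
          ((k.factorial : ℂ)⁻¹ * ℓ ^ k) * (F k ℓ * (Complex.exp ℓ - 1) ^ (T - t k)) := by
      funext ℓ
      simp only [Finset.sum_apply]
    rw [this]
    refine expPoly.sum_mem fun k _ => expPoly.mul_mem
      (expPoly.mul_mem (const_mem_expPoly _) (expPoly.pow_mem id_mem_expPoly k))
      (expPoly.mul_mem (hFmem k) (expPoly.pow_mem (expPoly.sub_mem ?_ (const_mem_expPoly 1)) _))
    simpa using exp_mem_expPoly 1
  have hsum : ∀ ℓ : ℝ, ℓ ≠ 0 → (∑ k ∈ Finset.range K, ((k.factorial : ℂ)⁻¹ * (ℓ : ℂ) ^ k) *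
      (F k ℓ * (Complex.exp ℓ - 1) ^ (T - t k))) * (Complex.exp ℓ - 1) ^ (-(T : ℤ))
      = ∑ k ∈ Finset.range K, ((k.factorial : ℂ)⁻¹ * (ℓ : ℂ) ^ k) *
        (F k ℓ * (Complex.exp ℓ - 1) ^ (-(t k : ℤ))) := by
    intro ℓ hℓ
    rw [Finset.sum_mul]
    refine Finset.sum_congr rfl fun k hk => ?_
    have hp : (Complex.exp ℓ - 1) ^ (T - t k) * (Complex.exp ℓ - 1) ^ (-(T : ℤ))
        = (Complex.exp ℓ - 1) ^ (-(t k : ℤ)) := by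
      rw [← zpow_natCast, ← zpow_add₀ (exp_ofReal_ne_one hℓ)]
      congr 1
      have := hle k hk
      omega
    rw [← hp]
    ring
  have hlt : ∀ ℓ : ℝ, 0 < ℓ → 1 < ‖Complex.exp ℓ‖ := fun ℓ hℓ => by
    rw [norm_exp_ofReal]
    exact Real.one_lt_exp_iff.2 hℓ
  have harg : ∀ ℓ : ℝ, |arg₀ (Complex.exp ℓ) - arg₀ 1| < Real.pi / 2 := fun ℓ => by
    rw [arg₀_ofReal_exp, arg₀_one, sub_zero, abs_zero]
    exact half_pos Real.pi_pos
  refine M.defect_eq_zero_of_hasSum hua hui hvb hvj hw hc hG T (fun ℓ hℓ => ?_)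
    (fun ℓ hℓ => ?_) (fun ℓ hℓ hℓ' => ?_) l ν
  · refine hasSum_of_eq (hasSum_sum fun k _ => HasSum.mul_left ((k.factorial : ℂ)⁻¹ * (ℓ : ℂ) ^ k)
      (a₁ := F k ℓ * (Complex.exp ℓ - 1) ^ (-(t k : ℤ))) ?_)
      (M.productTerm_Y₀_eq_sum hua hvb hK _ _ _) (hsum ℓ hℓ.ne')
    have h1 := ((hD k 0 (Complex.exp ℓ) 1).1 (by simpa using hlt ℓ hℓ) (by simp)).2 (harg ℓ)
    rw [hval] at h1
    rwa [lp_zero_ofReal_exp, lp_zero_one] at h1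
  · refine hasSum_of_eq (hasSum_sum fun k _ => HasSum.mul_left ((k.factorial : ℂ)⁻¹ * (ℓ : ℂ) ^ k)
      (a₁ := F k ℓ * (Complex.exp ℓ - 1) ^ (-(t k : ℤ))) ?_)
      (M.productTerm_Y₀_reverse_eq_sum hua hvb hK _ _ _) (hsum ℓ hℓ.ne)
    have h1 := ((hD k 0 (Complex.exp ℓ) 1).2.1 (by
      rw [norm_exp_ofReal, norm_one]
      exact Real.exp_lt_one_iff.2 hℓ) (by
      rw [norm_exp_ofReal]
      exact Real.exp_pos _)).2 (harg ℓ)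
    rw [hval] at h1
    rwa [lp_zero_ofReal_exp, lp_zero_one] at h1
  · have hy0 := exp_ofReal_ne_one hℓ.ne'
    have hy : ‖Complex.exp ℓ - 1‖ < 1 := by
      rw [norm_exp_ofReal_sub_one hℓ]
      have := Real.exp_lt_exp.2 hℓ'
      rw [Real.exp_log (by norm_num)] at this
      linarith
    have hlog : Complex.log (1 + (Complex.exp ℓ - 1)) = ℓ := by
      rw [add_sub_cancel, ← Complex.ofReal_exp, ← Complex.ofReal_log (Real.exp_pos _).le,
        Real.log_exp]
    have hR : ∀ k, HasSum (fun m =>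
        M.iterSeq (M.pairing (M.homDual r φ)) ((g.𝒩 ^ k) u) v w (a + b) m
        * (Complex.exp ℓ - 1) ^ (-m - 1)) (F k ℓ * (Complex.exp ℓ - 1) ^ (-(t k : ℤ))) := by
      intro k
      have h1 := ((hD k 0 (Complex.exp ℓ) 1).2.2 (by rwa [norm_one]) (norm_pos_iff.2 hy0)).2
        (harg ℓ)
      rw [hval, lp_zero_one] at h1
      have h2 : M.iterateTerm M.Yg (M.homDual r φ) ((g.𝒩 ^ k) u) (Complex.exp ℓ - 1) v 0 w
          = M.iterateTerm M.Y₀ (M.homDual r φ) ((g.𝒩 ^ k) u) (Complex.exp ℓ - 1) v 0 w := by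
        funext q
        rw [M.iterateTerm_Yg (g.𝒩_pow_mem_genEigen hua k) hvb (g.𝒩_pow_mem_wt hui k) hvj, neg_zero,
          g.expN_zero, g.expN_zero]
      rw [h2, M.hasSum_iterateTerm_iff (g.𝒩_pow_mem_wt hui k) hvj hw hc] at h1
      refine hasSum_of_eq h1 (fun q => ?_) rfl
      rw [mul_zero, Complex.exp_zero, one_mul, div_one]
    refine hasSum_of_eq (hasSum_sum (s := Finset.range K) fun k _ =>
      hasSum_conv (M.iterSeq_mem _ _ _ _ _) hy0
      (hasSum_chooseCoeff k hy) (hR k)) (fun q => ?_) ?_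
    · rw [M.iterNSeq_eq_sum _ hK, Finset.sum_mul]
    · rw [hsum ℓ hℓ.ne', hlog]

end PreTwistedModule

/-! ### Exponential polynomials in two logarithms -/

/-- The function `e^(m ℓ₁) e^(n ℓ₂) ℓ₁^k ℓ₂^l` for `q = (m, n, k, l)`. -/
def expMonomial (q : ℂ × ℂ × ℕ × ℕ) (ℓ : ℂ × ℂ) : ℂ :=
  Complex.exp (q.1 * ℓ.1) * Complex.exp (q.2.1 * ℓ.2) * ℓ.1 ^ q.2.2.1 * ℓ.2 ^ q.2.2.2

/-- The algebra of exponential polynomials in two variables. -/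
def expPoly₂ : Submodule ℂ (ℂ × ℂ → ℂ) := Submodule.span ℂ (Set.range expMonomial)

theorem expMonomial_mem (q : ℂ × ℂ × ℕ × ℕ) : expMonomial q ∈ expPoly₂ :=
  Submodule.subset_span ⟨q, rfl⟩

theorem expMonomial_mul (q q' : ℂ × ℂ × ℕ × ℕ) :
    expMonomial q * expMonomial q' = expMonomial (q + q') := by
  funext ℓ
  simp only [expMonomial, Pi.mul_apply, Prod.fst_add, Prod.snd_add, add_mul, Complex.exp_add,
    pow_add]
  ring

theorem expPoly₂_mul_mem {F G : ℂ × ℂ → ℂ} (hF : F ∈ expPoly₂) (hG : G ∈ expPoly₂) :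
    F * G ∈ expPoly₂ := by
  induction hF using Submodule.span_induction with
  | mem F hF =>
    obtain ⟨q, rfl⟩ := hF
    induction hG using Submodule.span_induction with
    | mem G hG =>
      obtain ⟨q', rfl⟩ := hG
      rw [expMonomial_mul]
      exact expMonomial_mem _
    | zero => rw [mul_zero]; exact expPoly₂.zero_mem
    | add x y _ _ hx hy => rw [mul_add]; exact expPoly₂.add_mem hx hy
    | smul c x _ hx => rw [mul_smul_comm]; exact expPoly₂.smul_mem c hx
  | zero => rw [zero_mul]; exact expPoly₂.zero_mem
  | add x y _ _ hx hy => rw [add_mul]; exact expPoly₂.add_mem hx hy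
  | smul c x _ hx => rw [smul_mul_assoc]; exact expPoly₂.smul_mem c hx

theorem exists_eq_sum_of_mem_expPoly₂ {F : ℂ × ℂ → ℂ} (hF : F ∈ expPoly₂) :
    ∃ (n : ℕ) (c : ℕ → ℂ) (q : ℕ → ℂ × ℂ × ℕ × ℕ),
      ∀ ℓ, F ℓ = ∑ i ∈ Finset.range n, c i * expMonomial (q i) ℓ := by
  induction hF using Submodule.span_induction with
  | mem F hF =>
    obtain ⟨q, rfl⟩ := hF
    exact ⟨1, fun _ => 1, fun _ => q, fun ℓ => by simp⟩
  | zero => exact ⟨0, 0, 0, fun ℓ => by simp⟩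
  | add x y _ _ hx hy =>
    obtain ⟨n, c, q, h⟩ := hx
    obtain ⟨n', c', q', h'⟩ := hy
    refine ⟨n + n', fun i => if i < n then c i else c' (i - n),
      fun i => if i < n then q i else q' (i - n), fun ℓ => ?_⟩
    rw [Finset.sum_range_add, Pi.add_apply, h, h']
    congr 1
    · refine Finset.sum_congr rfl fun i hi => ?_
      beta_reduce
      rw [if_pos (Finset.mem_range.1 hi), if_pos (Finset.mem_range.1 hi)]
    · refine Finset.sum_congr rfl fun i _ => ?_
      beta_reduce
      rw [if_neg (by omega), if_neg (by omega), Nat.add_sub_cancel_left]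
  | smul a x _ hx =>
    obtain ⟨n, c, q, h⟩ := hx
    refine ⟨n, fun i => a * c i, q, fun ℓ => ?_⟩
    rw [Pi.smul_apply, h, smul_eq_mul, Finset.mul_sum]
    exact Finset.sum_congr rfl fun i _ => (mul_assoc _ _ _).symm

/-- The normal form of exponential polynomials in two variables. The `i`-th term of a sum of
`expMonomial`s becomes the term with indices `(i, i, k, l)`, with its own exponents `k`, `l`. -/
theorem exists_normalForm {F : ℂ × ℂ → ℂ} (hF : F ∈ expPoly₂) :
    ∃ (N : ℕ) (a : ℕ → ℕ → ℕ → ℕ → ℂ) (m n : ℕ → ℂ), ∀ ℓ₁ ℓ₂ : ℂ,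
      F (ℓ₁, ℓ₂) = ∑ i ∈ Finset.range (N + 1), ∑ j ∈ Finset.range (N + 1),
        ∑ k ∈ Finset.range (N + 1), ∑ l ∈ Finset.range (N + 1),
          a i j k l * Complex.exp (m i * ℓ₁) * Complex.exp (n j * ℓ₂) * ℓ₁ ^ k * ℓ₂ ^ l := by
  obtain ⟨n, c, q, h⟩ := exists_eq_sum_of_mem_expPoly₂ hF
  set N := n + ∑ i ∈ Finset.range n, ((q i).2.2.1 + (q i).2.2.2) with hN
  refine ⟨N, fun i j k l => if i < n ∧ i = j ∧ k = (q i).2.2.1 ∧ l = (q i).2.2.2 then c i else 0,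
    fun i => (q i).1, fun j => (q j).2.1, fun ℓ₁ ℓ₂ => ?_⟩
  have hsub : Finset.range n ⊆ Finset.range (N + 1) := Finset.range_subset_range.2 (by omega)
  rw [h, Finset.sum_subset_zero_on_sdiff hsub]
  · intro i hi
    rw [Finset.mem_sdiff, Finset.mem_range, Finset.mem_range] at hi
    refine Finset.sum_eq_zero fun j _ => Finset.sum_eq_zero fun k _ =>
      Finset.sum_eq_zero fun l _ => ?_
    beta_reduce
    rw [if_neg (fun h => hi.2 h.1)]
    ring
  · intro i hi
    have hle : (q i).2.2.1 + (q i).2.2.2 ≤ ∑ i ∈ Finset.range n, ((q i).2.2.1 + (q i).2.2.2) :=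
      Finset.single_le_sum (f := fun i => (q i).2.2.1 + (q i).2.2.2) (fun _ _ => Nat.zero_le _) hi
    have hin := Finset.mem_range.1 hi
    rw [Finset.sum_eq_single i, Finset.sum_eq_single (q i).2.2.1, Finset.sum_eq_single (q i).2.2.2]
    · beta_reduce
      rw [if_pos ⟨hin, rfl, rfl, rfl⟩, expMonomial]
      ring
    · intro l _ hl
      beta_reduce
      rw [if_neg (fun h => hl h.2.2.2)]
      ring
    · intro hl
      exact absurd (Finset.mem_range.2 (by omega)) hl
    · intro k _ hk
      refine Finset.sum_eq_zero fun l _ => ?_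
      beta_reduce
      rw [if_neg (fun h => hk h.2.2.1)]
      ring
    · intro hl
      exact absurd (Finset.mem_range.2 (by omega)) hl
    · intro j _ hj
      refine Finset.sum_eq_zero fun k _ => Finset.sum_eq_zero fun l _ => ?_
      beta_reduce
      rw [if_neg (fun h => hj h.2.1.symm)]
      ring
    · intro hl
      exact absurd (hsub hi) hl

/-- A function of `ℓ₁ = log z₁` and `ℓ₂ = log z₂` that is the quotient of an exponential polynomial
by a power of `z₁ - z₂`. -/
def IsLogRational (F : ℂ → ℂ → ℂ) : Prop :=
  ∃ (t : ℕ) (P : ℂ × ℂ → ℂ), P ∈ expPoly₂ ∧ ∀ ℓ₁ ℓ₂, Complex.exp ℓ₁ - Complex.exp ℓ₂ ≠ 0 →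
    F ℓ₁ ℓ₂ = P (ℓ₁, ℓ₂) * (Complex.exp ℓ₁ - Complex.exp ℓ₂) ^ (-(t : ℤ))

theorem exp_sub_exp_mem : (fun ℓ : ℂ × ℂ => Complex.exp ℓ.1 - Complex.exp ℓ.2) ∈ expPoly₂ := by
  have h := expPoly₂.sub_mem (expMonomial_mem (1, 0, 0, 0)) (expMonomial_mem (0, 1, 0, 0))
  convert h using 1
  funext ℓ
  simp [expMonomial]

theorem exp_sub_exp_pow_mem (t : ℕ) :
    (fun ℓ : ℂ × ℂ => (Complex.exp ℓ.1 - Complex.exp ℓ.2) ^ t) ∈ expPoly₂ := by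
  induction t with
  | zero =>
    convert expMonomial_mem (0, 0, 0, 0) using 1
    funext ℓ
    simp [expMonomial]
  | succ t ih =>
    simp only [pow_succ]
    exact expPoly₂_mul_mem ih exp_sub_exp_mem

theorem IsLogRational.zero : IsLogRational fun _ _ => 0 :=
  ⟨0, 0, expPoly₂.zero_mem, by simp⟩

theorem IsLogRational.add {F F' : ℂ → ℂ → ℂ} (h : IsLogRational F) (h' : IsLogRational F') :
    IsLogRational fun ℓ₁ ℓ₂ => F ℓ₁ ℓ₂ + F' ℓ₁ ℓ₂ := by
  obtain ⟨t, P, hP, hF⟩ := h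
  obtain ⟨t', P', hP', hF'⟩ := h'
  refine ⟨t + t', _, expPoly₂.add_mem (expPoly₂_mul_mem hP (exp_sub_exp_pow_mem t'))
    (expPoly₂_mul_mem hP' (exp_sub_exp_pow_mem t)), fun ℓ₁ ℓ₂ hne => ?_⟩
  beta_reduce
  rw [hF _ _ hne, hF' _ _ hne]
  simp only [Pi.add_apply, Pi.mul_apply, zpow_neg, zpow_natCast, Nat.cast_add]
  rw [zpow_add₀ hne, zpow_natCast, zpow_natCast]
  field_simp

theorem IsLogRational.mul_expMonomial {F : ℂ → ℂ → ℂ} (h : IsLogRational F)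
    (c : ℂ) (q : ℂ × ℂ × ℕ × ℕ) :
    IsLogRational fun ℓ₁ ℓ₂ => c * expMonomial q (ℓ₁, ℓ₂) * F ℓ₁ ℓ₂ := by
  obtain ⟨t, P, hP, hF⟩ := h
  refine ⟨t, _, expPoly₂_mul_mem (expPoly₂.smul_mem c (expMonomial_mem q)) hP,
    fun ℓ₁ ℓ₂ hne => ?_⟩
  beta_reduce
  rw [hF _ _ hne]
  simp only [Pi.mul_apply, Pi.smul_apply, smul_eq_mul]
  ring

theorem IsLogRational.congr {F F' : ℂ → ℂ → ℂ} (h : IsLogRational F)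
    (heq : ∀ ℓ₁ ℓ₂, Complex.exp ℓ₁ - Complex.exp ℓ₂ ≠ 0 → F' ℓ₁ ℓ₂ = F ℓ₁ ℓ₂) :
    IsLogRational F' := by
  obtain ⟨t, P, hP, hF⟩ := h
  exact ⟨t, P, hP, fun ℓ₁ ℓ₂ hne => by rw [heq _ _ hne, hF _ _ hne]⟩

theorem IsLogRational.sum {ι : Type*} (s : Finset ι) {F : ι → ℂ → ℂ → ℂ}
    (h : ∀ i, IsLogRational (F i)) : IsLogRational fun ℓ₁ ℓ₂ => ∑ i ∈ s, F i ℓ₁ ℓ₂ := by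
  induction s using Finset.induction_on with
  | empty => simpa using IsLogRational.zero
  | insert i s hi ih =>
    simp only [Finset.sum_insert hi]
    exact (h i).add ih

theorem IsLogRational.zpow (t : ℕ) :
    IsLogRational fun ℓ₁ ℓ₂ => (Complex.exp ℓ₁ - Complex.exp ℓ₂) ^ (-(t : ℤ)) :=
  ⟨t, _, exp_sub_exp_pow_mem 0, fun ℓ₁ ℓ₂ _ => by simp⟩

namespace PreTwistedModule

variable {V : Type*} [AddCommGroup V] [Module ℂ V] {A : VertexOperatorAlgebra V}
  {g : A.Automorphism} {W : Type*} [AddCommGroup W] [Module ℂ W] (M : PreTwistedModule A g W)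

theorem isLogRational_corrFun (a b : ℂ) (t : ℕ) (H : ℤ →₀ ℂ) :
    IsLogRational (corrFun a b t H) := by
  induction H using Finsupp.induction_linear with
  | zero => exact IsLogRational.zero.congr fun ℓ₁ ℓ₂ _ => by simp [corrFun, ratFun]
  | add H H' h h' =>
    refine (h.add h').congr fun ℓ₁ ℓ₂ _ => ?_
    rw [corrFun, ratFun, Finsupp.sum_add_index' (by simp) (by intros; ring), ← ratFun, ← ratFun,
      mul_add, ← corrFun, ← corrFun]
  | single d c =>
    refine ((IsLogRational.zpow t).mul_expMonomial c
      (-(a + 1) + d, -(b + 1) - d + t, 0, 0)).congr fun ℓ₁ ℓ₂ _ => ?_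
    have h1 : Complex.exp (ℓ₁ - ℓ₂) - 1
        = (Complex.exp ℓ₁ - Complex.exp ℓ₂) * Complex.exp (-ℓ₂) := by
      rw [sub_mul, ← Complex.exp_add, ← Complex.exp_add, add_neg_cancel, Complex.exp_zero,
        ← sub_eq_add_neg]
    rw [corrFun, ratFun, Finsupp.sum_single_index (by simp), h1, mul_zpow, ← Complex.exp_int_mul,
      ← Complex.exp_int_mul, expMonomial]
    simp only [pow_zero, mul_one]
    have h2 : Complex.exp (-(a + 1) * ℓ₁) * Complex.exp (-(b + 1) * ℓ₂) *
        (Complex.exp (d * (ℓ₁ - ℓ₂)) * Complex.exp ((-(t : ℤ) : ℤ) * -ℓ₂))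
        = Complex.exp ((-(a + 1) + d) * ℓ₁) * Complex.exp ((-(b + 1) - d + t) * ℓ₂) := by
      rw [← Complex.exp_add, ← Complex.exp_add, ← Complex.exp_add, ← Complex.exp_add]
      congr 1
      push_cast
      ring
    rw [mul_assoc c, ← h2]
    ring

/-! ### Duality for `Y^g` from the Borcherds identity -/

/-- The three series in the duality property of `Y^g` converge to `F(log z₁, log z₂)`. -/
def HasLogSum (u v : V) (w : W) (w' : M.GradedDual) (F : ℂ → ℂ → ℂ) : Prop :=
  ∀ (p : ℤ) (z₁ z₂ : ℂ),
    (‖z₂‖ < ‖z₁‖ → 0 < ‖z₂‖ →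
      HasSum (M.productTerm M.Yg w' u (lp p z₁) v (lp p z₂) w) (F (lp p z₁) (lp p z₂))) ∧
    (‖z₁‖ < ‖z₂‖ → 0 < ‖z₁‖ →
      HasSum (M.productTerm M.Yg w' v (lp p z₂) u (lp p z₁) w) (F (lp p z₁) (lp p z₂))) ∧
    (‖z₁ - z₂‖ < ‖z₂‖ → 0 < ‖z₁ - z₂‖ →
      ∃ S, HasSum (M.iterateTerm M.Yg w' u (z₁ - z₂) v (lp p z₂) w) S ∧
        (|arg₀ z₁ - arg₀ z₂| < Real.pi / 2 → S = F (lp p z₁) (lp p z₂)))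

/-- The duality property of `Y^g` for given vectors. -/
def DualityFor (u v : V) (w : W) (w' : M.GradedDual) : Prop :=
  ∃ F, IsLogRational F ∧ M.HasLogSum u v w w' F

theorem duality_of_forall (h : ∀ (u v : V) (w : W) (w' : M.GradedDual), M.DualityFor u v w w') :
    M.Duality := by
  intro u v w w'
  obtain ⟨F, ⟨t, P, hP, hPF⟩, hF⟩ := h u v w w'
  -- the denominator gets one more factor, since its exponent has to be positive
  obtain ⟨N, a, m, n, hform⟩ := exists_normalForm (expPoly₂_mul_mem hP exp_sub_exp_mem)
  refine ⟨N, a, m, n, t + 1, Nat.succ_pos t, fun p z₁ z₂ => ?_⟩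
  intro f
  have key : z₁ ≠ 0 → z₂ ≠ 0 → z₁ - z₂ ≠ 0 → F (lp p z₁) (lp p z₂) = f := by
    intro h1 h2 h3
    have h4 := hform (lp p z₁) (lp p z₂)
    rw [hPF _ _ (by rwa [exp_lp p h1, exp_lp p h2]), exp_lp p h1, exp_lp p h2]
    simp only [f, ← Finset.sum_mul]
    rw [← h4, Pi.mul_apply, exp_lp p h1, exp_lp p h2, Nat.cast_succ, neg_add, zpow_add₀ h3,
      zpow_neg_one]
    field_simp
  have hsub : ∀ x y : ℂ, ‖x‖ < ‖y‖ → y - x ≠ 0 := by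
    intro x y hxy h0
    rw [sub_eq_zero.1 h0] at hxy
    exact lt_irrefl _ hxy
  have hf := hF p z₁ z₂
  refine ⟨fun h1 h2 => ?_, fun h1 h2 => ?_, fun h1 h2 => ?_⟩
  · have := hf.1 h1 h2
    rw [key (norm_pos_iff.1 (h2.trans h1)) (norm_pos_iff.1 h2) (hsub _ _ h1)] at this
    exact ⟨this.summable.norm, fun _ => this⟩
  · have := hf.2.1 h1 h2
    rw [key (norm_pos_iff.1 h2) (norm_pos_iff.1 (h2.trans h1))
      (by rw [← neg_sub]; exact neg_ne_zero.2 (hsub _ _ h1))] at this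
    exact ⟨this.summable.norm, fun _ => this⟩
  · obtain ⟨S, hS, hSf⟩ := hf.2.2 h1 h2
    refine ⟨hS.summable.norm, fun harg => ?_⟩
    rw [hSf harg] at hS
    have h20 : z₂ ≠ 0 := norm_pos_iff.1 (h2.trans h1)
    have h10 : z₁ ≠ 0 := by
      rintro rfl
      rw [zero_sub, norm_neg] at h1
      exact lt_irrefl _ h1
    rw [key h10 h20 (norm_pos_iff.1 h2)] at hS
    exact hS

/-- The sums of the series add up whenever their terms do. -/
theorem DualityFor.add_of {u u' u'' v v' v'' : V} {w x y : W}
    {w' x' y' : M.GradedDual} (h : M.DualityFor u v w w')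
    (h' : M.DualityFor u' v' x x')
    (hprod : ∀ ℓ₁ ℓ₂ q, M.productTerm M.Yg y' u'' ℓ₁ v'' ℓ₂ y q
      = M.productTerm M.Yg w' u ℓ₁ v ℓ₂ w q + M.productTerm M.Yg x' u' ℓ₁ v' ℓ₂ x q)
    (hrev : ∀ ℓ₁ ℓ₂ q, M.productTerm M.Yg y' v'' ℓ₂ u'' ℓ₁ y q
      = M.productTerm M.Yg w' v ℓ₂ u ℓ₁ w q + M.productTerm M.Yg x' v' ℓ₂ u' ℓ₁ x q)
    (hiter : ∀ z₀ ℓ₂ n, M.iterateTerm M.Yg y' u'' z₀ v'' ℓ₂ y n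
      = M.iterateTerm M.Yg w' u z₀ v ℓ₂ w n + M.iterateTerm M.Yg x' u' z₀ v' ℓ₂ x n) :
    M.DualityFor u'' v'' y y' := by
  obtain ⟨F, hF, hS⟩ := h
  obtain ⟨F', hF', hS'⟩ := h'
  refine ⟨_, hF.add hF', fun p z₁ z₂ => ?_⟩
  have h1 := hS p z₁ z₂
  have h2 := hS' p z₁ z₂
  refine ⟨fun ha hb => ?_, fun ha hb => ?_, fun ha hb => ?_⟩
  · exact hasSum_of_eq ((h1.1 ha hb).add (h2.1 ha hb)) (fun q => hprod _ _ _) rfl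
  · exact hasSum_of_eq ((h1.2.1 ha hb).add (h2.2.1 ha hb)) (fun q => hrev _ _ _) rfl
  · obtain ⟨S, hs, hsf⟩ := h1.2.2 ha hb
    obtain ⟨S', hs', hsf'⟩ := h2.2.2 ha hb
    refine ⟨S + S', hasSum_of_eq (hs.add hs') (fun q => hiter _ _ _) rfl, fun harg => ?_⟩
    rw [hsf harg, hsf' harg]

theorem DualityFor.of_eq_zero {u v : V} {w : W} {w' : M.GradedDual}
    (hprod : ∀ ℓ₁ ℓ₂ q, M.productTerm M.Yg w' u ℓ₁ v ℓ₂ w q = 0)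
    (hrev : ∀ ℓ₁ ℓ₂ q, M.productTerm M.Yg w' v ℓ₂ u ℓ₁ w q = 0)
    (hiter : ∀ z₀ ℓ₂ n, M.iterateTerm M.Yg w' u z₀ v ℓ₂ w n = 0) :
    M.DualityFor u v w w' := by
  refine ⟨_, IsLogRational.zero, fun p z₁ z₂ => ?_⟩
  refine ⟨fun ha hb => ?_, fun ha hb => ?_, fun ha hb => ⟨0, ?_, fun _ => rfl⟩⟩
  · exact hasSum_of_eq hasSum_zero (fun q => hprod _ _ _) rfl
  · exact hasSum_of_eq hasSum_zero (fun q => hrev _ _ _) rfl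
  · exact hasSum_of_eq hasSum_zero (fun q => hiter _ _ _) rfl

/-- The vectors `u` and `v` are replaced by `z₁^(-𝒩)u` and `z₂^(-𝒩)v` in the series for `Y^g_0`. In
the third series both get the factor `z₂^(-𝒩)`, and `z₂^(-𝒩) = (z₁/z₂)^𝒩 z₁^(-𝒩)`. -/
theorem Borcherds.dualityFor_of_mem (h : M.Borcherds) {a b p : ℂ} {i j : ℤ} {u v : V} {w : W}
    (hua : u ∈ g.genEigen a) (hui : u ∈ A.wt i) (hvb : v ∈ g.genEigen b) (hvj : v ∈ A.wt j)
    (hw : w ∈ degSpace M.comp p) (r : RightHalfPlane × CModZ)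
    (φ : Module.Dual ℂ (bigraded M.comp r)) :
    M.DualityFor u v w (M.homDual r φ) := by
  by_cases hc : ∃ k : ℤ, a + b + k = i + j + p - r.1 - 2
  swap
  · push Not at hc
    have hu₁ := fun x => g.expN_mem (g.𝒩_pow_mem_genEigen hua) x
    have hv₁ := fun x => g.expN_mem (g.𝒩_pow_mem_genEigen hvb) x
    have hu₂ := fun x => g.expN_mem (g.𝒩_pow_mem_wt hui) x
    have hv₂ := fun x => g.expN_mem (g.𝒩_pow_mem_wt hvj) x
    refine DualityFor.of_eq_zero M (fun ℓ₁ ℓ₂ q => ?_) (fun ℓ₁ ℓ₂ q => ?_) (fun z₀ ℓ₂ n => ?_)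
    · rw [M.productTerm_Yg hua hvb]
      exact M.productTerm_eq_zero (hu₂ _) (hv₂ _) (hu₁ _) (hv₁ _) hw hc ℓ₁ ℓ₂ q
    · rw [M.productTerm_Yg hvb hua]
      refine M.productTerm_eq_zero (hv₂ _) (hu₂ _) (hv₁ _) (hu₁ _) hw (fun k hk => hc k ?_) ℓ₂ ℓ₁ q
      linear_combination hk
    · rw [M.iterateTerm_Yg hua hvb hui hvj]
      exact M.iterateTerm_eq_zero (hu₂ _) (hv₂ _) (hu₁ _) (hv₁ _) hw hc z₀ ℓ₂ n
  obtain ⟨n, hn⟩ := hc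
  have hua' : u ∈ g.genEigen (a + n) := by rwa [g.genEigen_add_intCast]
  have hc : a + n + b = i + j + p - r.1 - 2 := by linear_combination hn
  choose t H hE using fun l k : ℕ =>
    h.exists_hasExpansion M r φ (g.𝒩_pow_mem_genEigen hua' k) ((g.𝒩 ^ l) v) w b
  obtain ⟨K, hK⟩ := g.exists_𝒩_pow_eq_zero u
  obtain ⟨L, hL⟩ := g.exists_𝒩_pow_eq_zero v
  refine ⟨fun ℓ₁ ℓ₂ => ∑ l ∈ Finset.range L, ((l.factorial : ℂ)⁻¹ * (-ℓ₂) ^ l) *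
    ∑ k ∈ Finset.range K, ((k.factorial : ℂ)⁻¹ * (-ℓ₁) ^ k) *
      corrFun (a + n) b (t l k) (H l k) ℓ₁ ℓ₂, ?_, fun s z₁ z₂ => ?_⟩
  · refine (IsLogRational.sum (Finset.range L) fun l => (IsLogRational.sum (Finset.range K) fun k =>
      (isLogRational_corrFun (a + n) b (t l k) (H l k)).mul_expMonomial
        ((k.factorial : ℂ)⁻¹ * (-1) ^ k) (0, 0, k, 0)).mul_expMonomial
        ((l.factorial : ℂ)⁻¹ * (-1) ^ l) (0, 0, 0, l)).congr fun ℓ₁ ℓ₂ _ => ?_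
    refine Finset.sum_congr rfl fun l _ => ?_
    congr 1
    · rw [expMonomial, neg_pow ℓ₂]
      simp
      ring
    · refine Finset.sum_congr rfl fun k _ => ?_
      congr 1
      rw [expMonomial, neg_pow ℓ₁]
      simp
      ring
  refine ⟨fun h1 h2 => ?_, fun h1 h2 => ?_, fun h1 h2 => ?_⟩
  · have h20 := norm_pos_iff.1 h2
    have h10 := norm_pos_iff.1 (h2.trans h1)
    refine hasSum_of_eq (hasSum_sum fun l _ => (hasSum_sum fun k _ =>
      ((hE l k).hasSum_productTerm M (g.𝒩_pow_mem_wt hui k) (g.𝒩_pow_mem_wt hvj l)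
        (g.𝒩_pow_mem_genEigen hvb l) hw hc (ℓ₁ := lp s z₁) (ℓ₂ := lp s z₂)
        (by rwa [exp_lp s h10, exp_lp s h20])).mul_left
        ((k.factorial : ℂ)⁻¹ * (-lp s z₁) ^ k)).mul_left
        ((l.factorial : ℂ)⁻¹ * (-lp s z₂) ^ l)) (fun q => ?_) rfl
    rw [M.productTerm_Yg hua hvb, g.expN_eq_sum hL, M.productTerm_sum₂ M.isGraded_Y₀]
    refine Finset.sum_congr rfl fun l _ => ?_
    rw [g.expN_eq_sum hK, M.productTerm_sum₁ M.isGraded_Y₀]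
  · have h10 := norm_pos_iff.1 h2
    have h20 := norm_pos_iff.1 (h2.trans h1)
    refine hasSum_of_eq (hasSum_sum fun l _ => (hasSum_sum fun k _ =>
      ((hE l k).hasSum_productTerm_reverse M (g.𝒩_pow_mem_wt hui k) (g.𝒩_pow_mem_wt hvj l)
        (g.𝒩_pow_mem_genEigen hua' k) hw hc (ℓ₁ := lp s z₁) (ℓ₂ := lp s z₂)
        (by rwa [exp_lp s h10, exp_lp s h20])).mul_left
        ((k.factorial : ℂ)⁻¹ * (-lp s z₁) ^ k)).mul_left
        ((l.factorial : ℂ)⁻¹ * (-lp s z₂) ^ l)) (fun q => ?_) rfl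
    rw [M.productTerm_Yg hvb hua, g.expN_eq_sum hL, M.productTerm_sum₁ M.isGraded_Y₀]
    refine Finset.sum_congr rfl fun l _ => ?_
    rw [g.expN_eq_sum hK, M.productTerm_sum₂ M.isGraded_Y₀]
  · have h20 := norm_pos_iff.1 (h2.trans h1)
    have h10 : z₁ ≠ 0 := by
      rintro rfl
      rw [zero_sub, norm_neg] at h1
      exact lt_irrefl _ h1
    choose ρ hρ hρK hsum using fun l : ℕ => M.exists_hasSum_iterateTerm (hE l) hK hui
      (g.𝒩_pow_mem_wt hvj l) hw hc (ℓ₂ := lp s z₂) (norm_pos_iff.1 h2) (by rwa [exp_lp s h20])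
    refine ⟨∑ l ∈ Finset.range L, ((l.factorial : ℂ)⁻¹ * (-lp s z₂) ^ l) *
      ∑ k ∈ Finset.range K, ((k.factorial : ℂ)⁻¹ * (-lp s z₂) ^ k) * ρ l k, ?_, fun harg => ?_⟩
    · refine hasSum_of_eq (hasSum_sum fun l _ => (hasSum_sum fun k _ =>
        (hρ l k).mul_left ((k.factorial : ℂ)⁻¹ * (-lp s z₂) ^ k)).mul_left
          ((l.factorial : ℂ)⁻¹ * (-lp s z₂) ^ l)) (fun q => ?_) rfl
      rw [M.iterateTerm_Yg hua hvb hui hvj, g.expN_eq_sum hL, M.iterateTerm_sum₂ M.isGraded_Y₀]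
      refine Finset.sum_congr rfl fun l _ => ?_
      rw [g.expN_eq_sum hK, M.iterateTerm_sum₁ M.isGraded_Y₀]
    · have hlog : lp s z₁ - lp s z₂ = Complex.log (1 + (z₁ - z₂) / Complex.exp (lp s z₂)) := by
        rw [exp_lp s h20, one_add_sub_div h20, lp_sub_lp s h10 h20 harg]
      refine Finset.sum_congr rfl fun l _ => ?_
      congr 1
      -- `e^(-ℓ₁ 𝒩) e^((ℓ₁ - ℓ₂) 𝒩) = e^(-ℓ₂ 𝒩)`
      have hadd := sum_exp_add (ρ l) (hρK l) (-lp s z₁) (lp s z₁ - lp s z₂)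
      simp only [smul_eq_mul] at hadd
      rw [show -lp s z₁ + (lp s z₁ - lp s z₂) = -lp s z₂ by ring] at hadd
      rw [← hadd]
      refine Finset.sum_congr rfl fun k _ => ?_
      rw [hsum l k _ hlog, Finset.mul_sum]
      exact Finset.sum_congr rfl fun k' _ => mul_assoc _ _ _

/-- All terms are additive in `u`, `v`, `w`, `w'`, and the sums can be added. -/
theorem Borcherds.duality (h : M.Borcherds) : M.Duality := by
  refine M.duality_of_forall fun u v w w' => ?_
  refine g.homogeneous_induction (Q := fun u => M.DualityFor u v w w')
    (fun a _ i u hu hui => ?_) ?_ (fun x y hx hy => hx.add_of M hy ?_ ?_ ?_) u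
  rotate_left
  · refine DualityFor.of_eq_zero M (fun _ _ _ => ?_) (fun _ _ _ => ?_) (fun _ _ _ => ?_)
    · simp [M.productTerm_eq M.isGraded_Yg]
    · simp [M.productTerm_eq M.isGraded_Yg]
    · simp [M.iterateTerm_eq M.isGraded_Yg]
  · exact fun _ _ _ => M.productTerm_add₁ M.isGraded_Yg _ _ _ _ _ _ _ _
  · exact fun _ _ _ => M.productTerm_add₂ M.isGraded_Yg _ _ _ _ _ _ _ _
  · exact fun _ _ _ => M.iterateTerm_add₁ M.isGraded_Yg _ _ _ _ _ _ _ _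
  refine g.homogeneous_induction (Q := fun v => M.DualityFor u v w w')
    (fun b _ j v hv hvj => ?_) ?_ (fun x y hx hy => hx.add_of M hy ?_ ?_ ?_) v
  rotate_left
  · refine DualityFor.of_eq_zero M (fun _ _ _ => ?_) (fun _ _ _ => ?_) (fun _ _ _ => ?_)
    · simp [M.productTerm_eq M.isGraded_Yg]
    · simp [M.productTerm_eq M.isGraded_Yg]
    · simp [M.iterateTerm_eq M.isGraded_Yg]
  · exact fun _ _ _ => M.productTerm_add₂ M.isGraded_Yg _ _ _ _ _ _ _ _
  · exact fun _ _ _ => M.productTerm_add₁ M.isGraded_Yg _ _ _ _ _ _ _ _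
  · exact fun _ _ _ => M.iterateTerm_add₂ M.isGraded_Yg _ _ _ _ _ _ _ _
  refine degSpace_induction M.internal (Q := fun w => M.DualityFor u v w w')
    (fun p w hw => ?_) ?_ (fun x y hx hy => hx.add_of M hy ?_ ?_ ?_) w
  rotate_left
  · refine DualityFor.of_eq_zero M (fun _ _ _ => ?_) (fun _ _ _ => ?_) (fun _ _ _ => ?_)
    · simp [M.productTerm_eq M.isGraded_Yg]
    · simp [M.productTerm_eq M.isGraded_Yg]
    · simp [M.iterateTerm_eq M.isGraded_Yg]
  · exact fun _ _ _ => M.productTerm_add₃ M.isGraded_Yg _ _ _ _ _ _ _ _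
  · exact fun _ _ _ => M.productTerm_add₃ M.isGraded_Yg _ _ _ _ _ _ _ _
  · exact fun _ _ _ => M.iterateTerm_add₃ M.isGraded_Yg _ _ _ _ _ _ _ _
  refine M.gradedDual_induction (Q := fun w' => M.DualityFor u v w w')
    (fun r φ => ?_) ?_ (fun x y hx hy => hx.add_of M hy ?_ ?_ ?_) w'
  rotate_left
  · refine DualityFor.of_eq_zero M (fun _ _ _ => ?_) (fun _ _ _ => ?_) (fun _ _ _ => ?_)
    · simp [M.productTerm_eq M.isGraded_Yg]
    · simp [M.productTerm_eq M.isGraded_Yg]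
    · simp [M.iterateTerm_eq M.isGraded_Yg]
  · exact fun _ _ _ => M.productTerm_add_dual M.isGraded_Yg _ _ _ _ _ _ _ _
  · exact fun _ _ _ => M.productTerm_add_dual M.isGraded_Yg _ _ _ _ _ _ _ _
  · exact fun _ _ _ => M.iterateTerm_add_dual M.isGraded_Yg _ _ _ _ _ _ _ _
  exact h.dualityFor_of_mem M hu hui hv hvj hw r φ

end PreTwistedModule

end

end TwistedVOA

open TwistedVOA in
theorem theorem2p10 {V W : Type*} [AddCommGroup V] [Module ℂ V] [AddCommGroup W] [Module ℂ W]
    (A : VertexOperatorAlgebra V) (g : A.Automorphism) (M : PreTwistedModule A g W) :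
    List.TFAE [
      M.Duality,
      M.NonlogDuality,
      M.LowerTruncated ∧ M.TwistedJacobi,
      M.LowerTruncated ∧ M.CommutatorFormula ∧ M.WeakAssociativity] := by
  tfae_have 1 → 2 := fun h => ((h.homogeneousBorcherds M).borcherds M).nonlogDuality M
  tfae_have 2 → 3 := fun h =>
    ⟨M.lowerTruncated, ((h.homogeneousBorcherds M).borcherds M).twistedJacobi M⟩
  tfae_have 3 → 4 := fun h =>
    ⟨M.lowerTruncated, h.2.commutatorFormula M,
      ((h.2.homogeneousBorcherds M).borcherds M).weakAssociativity M⟩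
  tfae_have 4 → 1 := fun h =>
    (PreTwistedModule.HomogeneousBorcherds.of_commutatorFormula M h.2.1 h.2.2
      |>.borcherds M).duality M
  tfae_finish
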